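/- **Setting.** Let $\Bbbk$ be a field of characteristic $0$ and $\Bbbk_q=\bigcup_{m\ge 1}\Bbbk(q^{1/m})$. Let $A=(a_{ij})_{i,j\in I}$ ($I$ finite) be a symmetrizable generalized Cartan matrix, $D=\mathrm{diag}(d_i)$ with $d_i$ positive integers and $DA$ symmetric, $q_i=q^{d_i}$. Let $Q=\bigoplus_i\mathbb Z\alpha_i\subset \mathbb QQ=\bigoplus_i\mathbb Q\alpha_i$, with the symmetric bilinear form $(\alpha_i,\alpha_j)=d_ia_{ij}$; a *lattice* is a finitely generated subgroup $\Gamma$ of $\mathbb QQ$ with $Q\subseteq\Gamma$. For a lattice $\Gamma$, $U_{q,\Gamma}(\mathfrak b_+)$, resp. $U_{q,\Gamma}(\mathfrak b_-)$, is the $\Bbbk_q$-algebra generated by $K_\gamma$ ($\gamma\in\Gamma$) and $E_i$, resp. $F_i$ ($i\in I$), with relations $K_0=1$, $K_{\gamma+\delta}=K_\gamma K_\delta$, $K_\gamma E_j=q^{(\gamma,\alpha_j)}E_jK_\gamma$, resp. $K_\gamma F_j=q^{-(\gamma,\alpha_j)}F_jK_\gamma$, and the quantum Serre relations. It is a Hopf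 algebra in which the $K_\gamma$ are group-like and $\Delta(E_i)=E_i\otimes 1+K_{\alpha_i}\otimes E_i$, resp. $\Delta(F_i)=F_i\otimes K_{-\alpha_i}+1\otimes F_i$. A *skew-Hopf pairing* between Hopf algebras $H,K$ with bijective antipodes is a bilinear $\eta:H\times K\to\Bbbk_q$ with $\eta(h,k'k'')=\eta(h_{(1)},k')\,\eta(h_{(2)},k'')$, $\eta(h'h'',k)=\eta(h',k_{(2)})\,\eta(h'',k_{(1)})$, $\eta(h,1)=\epsilon(h)$, $\eta(1,k)=\epsilon(k)$ and $\eta(S^{\pm1}(h),k)=\eta(h,S^{\mp1}(k))$. The *standard* one, between $U_{q,\Gamma_+}(\mathfrak b_+)$ and $U_{q,\Gamma_-}(\mathfrak b_-)$, is the skew-Hopf pairing such that $\eta(K_\gamma,K_\delta)=q^{-(\gamma,\delta)}$, $\eta(E_i,F_j)=\delta_{ij}/(q_i^{-1}-q_i)$, $\eta(E_i,K_\delta)=0=\eta(K_\gamma,F_j)$. For a 2-cocycle $\sigma$ (normalized, convolution invertible) of a Hopf algebra $H$, the deformation $H_\sigma$ has product $x\cdot_\sigma y=\sigma(x_{(1)},y_{(1)})\,x_{(2)}y_{(2)}\,\sigma^{-1}(x_{(3)},y_{(3)})$,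 antipode $S_\sigma(x)=\sigma(x_{(1)},S(x_{(2)}))\,S(x_{(3)})\,\sigma^{-1}(S(x_{(4)}),x_{(5)})$, and the same unit, coproduct and counit. Let $\Psi\in\mathfrak{so}_n(\mathbb Q)$, i.e. $\Psi=(\psi_{ij})_{i,j\in I}$ is rational with $\Psi^T=-\Psi$. Set $\psi_+(\alpha_\ell)=\zeta^+_\ell=\sum_{i,j}\psi_{ij}a_{j\ell}d_i^{-1}\alpha_i$ and $\psi_-(\alpha_\ell)=\zeta^-_\ell=\sum_{i,j}\psi_{ji}a_{j\ell}d_i^{-1}\alpha_i$, extended linearly to $\mathbb QQ$. A lattice $\Gamma$ is *$\Psi$-admissible* if $Q+\psi_+(Q)+\psi_-(Q)\subseteq\Gamma$. Then the twisted Hopf algebra $U^\Psi_{q,\Gamma}(\mathfrak b_\pm)$ has the algebra structure and counit of $U_{q,\Gamma}(\mathfrak b_\pm)$, group-like $K_\gamma$, and $$\Delta^{(\Psi)}(E_\ell)=E_\ell\otimes K_{\zeta^-_\ell}+K_{\alpha_\ell+\zeta^+_\ell}\otimes E_\ell,\qquad \Delta^{(\Psi)}(F_\ell)=F_\ell\otimes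 K_{-\alpha_\ell-\zeta^-_\ell}+K_{-\zeta^+_\ell}\otimes F_\ell ,$$ $$S^{(\Psi)}(E_\ell)=-K_{-\alpha_\ell-\zeta^+_\ell}E_\ell K_{-\zeta^-_\ell},\qquad S^{(\Psi)}(F_\ell)=-K_{\zeta^+_\ell}F_\ell K_{\alpha_\ell+\zeta^-_\ell}.$$ Let $p$ be the projection of $U_{q,\Gamma}(\mathfrak b_\pm)$ onto its torus ($p(K_\gamma)=K_\gamma$, $p(E_i)=0$, resp. $p(F_i)=0$). A 2-cocycle $\sigma$ is *toral* if $\sigma=\sigma\circ(p\otimes p)$, and *rational toral* if moreover there is a rational matrix $S$ with $\sigma(K_\gamma,K_\delta)=q^{\gamma^TS\delta}$ for all $\gamma,\delta\in\Gamma$ (coordinates with respect to the simple roots). Write $\Psi\leftrightarrow\sigma$ if $\sigma$ is toral and $$\sigma(K_\gamma,K_\delta)=q^{-\gamma^T(A^T\Psi A)\,\delta}\qquad\text{for all }\gamma,\delta\in\Gamma\text{ with }\gamma\in Q\text{ or }\delta\in Q .$$ **Theorem.** 1. For any lattices $\Gamma_+,\Gamma_-$, the groups $\Gamma'_\pm=(\mathrm{id}+\psi_+)(\Gamma_\pm)-\psi_-(\Gamma_\mp)+Q$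 are $\Psi$-admissible lattices. 2. For any lattices $M_+,M_-$, the standard skew-Hopf pairing $\eta$ between $U_{q,M_+}(\mathfrak b_+)$ and $U_{q,M_-}(\mathfrak b_-)$ exists and is unique. 3. (Twist on the positive side, cocycle on the negative side.) Let moreover $M_+$ be $\Psi$-admissible (for instance $M_\pm=\Gamma'_\pm$), and let $\sigma$ be any 2-cocycle of $U_{q,M_-}(\mathfrak b_-)$. If $\det A\neq0$, or if $\sigma$ is toral, then the following are equivalent: - $\eta$ is a skew-Hopf pairing between $U^\Psi_{q,M_+}(\mathfrak b_+)$ and $\big(U_{q,M_-}(\mathfrak b_-)\big)_\sigma$; - $\Delta^{(\Psi)}$ and $\cdot_\sigma$ are dual to each other via $\eta$, i.e. $\eta(x,y\cdot_\sigma z)=(\eta\otimes\eta)\big(\Delta^{(\Psi)}(x),y\otimes z\big)$ for all $x,y,z$; - $\Psi\leftrightarrow\sigma$. If $\sigma$ is rational toral, then $\Psi\leftrightarrow\sigma$ holds if and only if $\sigma(K_{\alpha_i},K_{\alpha_j})=q^{-(A^T\Psi A)_{ij}}$ for all $i,j\in I$. 4. (Cocycle on the positive side, twist on the negative side.) Symmetrically,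 let $M_-$ be $\Psi$-admissible and let $\sigma$ be any 2-cocycle of $U_{q,M_+}(\mathfrak b_+)$. If $\det A\neq0$, or if $\sigma$ is toral, then the following are equivalent: - $\eta$ is a skew-Hopf pairing between $\big(U_{q,M_+}(\mathfrak b_+)\big)_\sigma$ and $U^\Psi_{q,M_-}(\mathfrak b_-)$; - the product $\cdot_\sigma$ and the coproduct $\Delta^{(\Psi)}$ of $U^\Psi_{q,M_-}(\mathfrak b_-)$ are dual to each other via $\eta$, i.e. $\eta(x\cdot_\sigma y,z)=\eta\big(x,z^{(\Psi)}_{(2)}\big)\,\eta\big(y,z^{(\Psi)}_{(1)}\big)$ for all $x,y,z$; - $\Psi\leftrightarrow\sigma$. If $\sigma$ is rational toral, then $\Psi\leftrightarrow\sigma$ holds if and only if $\sigma(K_{\alpha_i},K_{\alpha_j})=q^{-(A^T\Psi A)_{ij}}$ for all $i,j\in I$. -/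

import Mathlib

open scoped TensorProduct

noncomputable section

set_option linter.unusedSectionVars false

namespace QBorel

section QNumbers

variable {F : Type*} [Field F]

/-- The symmetric quantum integer `[n]_v = (v^n - v^{-n}) / (v - v^{-1})`. -/
def qint (v : F) (n : ℕ) : F := (v ^ n - v⁻¹ ^ n) / (v - v⁻¹)

/-- The quantum factorial `[n]_v! = [1]_v [2]_v ⋯ [n]_v`. -/
def qfact (v : F) (n : ℕ) : F := ∏ i ∈ Finset.range n, qint v (i + 1)

/-- The quantum binomial coefficient `[m]_v! / ([k]_v! [m - k]_v!)` for `k ≤ m`. -/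
def qbinom (v : F) (m k : ℕ) : F :=
  if k ≤ m then qfact v m / (qfact v k * qfact v (m - k)) else 0

/-- The quantum Serre expression
`∑ₖ (-1)^k [m choose k]_v x^{m-k} y x^k`. -/
def serre {R : Type*} [Ring R] [Algebra F R] (v : F) (m : ℕ) (x y : R) : R :=
  ∑ k ∈ Finset.range (m + 1), ((-1) ^ k * qbinom v m k) • (x ^ (m - k) * y * x ^ k)

/-- `v` is nonzero and not a root of unity. -/
def Generic (v : F) : Prop := v ≠ 0 ∧ ∀ n : ℕ, 0 < n → v ^ (2 * n) ≠ 1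

theorem qint_inv (v : F) (n : ℕ) : qint v⁻¹ n = qint v n := by
  unfold qint
  rw [inv_inv, ← neg_sub (v ^ n), ← neg_sub v, neg_div_neg_eq]

theorem qbinom_inv (v : F) (m k : ℕ) : qbinom v⁻¹ m k = qbinom v m k := by
  simp only [qbinom, qfact, qint_inv]

theorem serre_inv {R : Type*} [Ring R] [Algebra F R] (v : F) (m : ℕ) (x y : R) :
    serre v⁻¹ m x y = serre v m x y := by
  simp only [serre, qbinom_inv]

theorem Generic.inv {v : F} (h : Generic v) : Generic v⁻¹ := by
  refine ⟨inv_ne_zero h.1, fun n hn => ?_⟩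
  rw [inv_pow]
  exact fun h' => h.2 n hn (inv_eq_one.1 h')

theorem Generic.sub_ne {v : F} (h : Generic v) (n : ℕ) (hn : 0 < n) :
    v ^ n - v⁻¹ ^ n ≠ 0 := by
  intro h'
  apply h.2 n hn
  have hv : v ^ n ≠ 0 := pow_ne_zero _ h.1
  rw [sub_eq_zero, inv_pow] at h'
  rw [two_mul, pow_add]
  nth_rewrite 2 [h']
  exact mul_inv_cancel₀ hv

theorem Generic.qint_ne {v : F} (h : Generic v) (n : ℕ) : qint v (n + 1) ≠ 0 := by
  have h1 := h.sub_ne 1 one_pos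
  simp only [pow_one] at h1
  exact div_ne_zero (h.sub_ne _ n.succ_pos) h1

theorem Generic.qfact_ne {v : F} (h : Generic v) (n : ℕ) : qfact v n ≠ 0 :=
  Finset.prod_ne_zero_iff.2 fun i _ => h.qint_ne i

theorem qfact_succ (v : F) (n : ℕ) : qfact v (n + 1) = qfact v n * qint v (n + 1) :=
  Finset.prod_range_succ _ _

theorem qfact_zero (v : F) : qfact v 0 = 1 := Finset.prod_range_zero _

theorem qbinom_zero_right {v : F} (h : Generic v) (m : ℕ) : qbinom v m 0 = 1 := by
  simp [qbinom, qfact_zero, h.qfact_ne]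

theorem qbinom_self {v : F} (h : Generic v) (m : ℕ) : qbinom v m m = 1 := by
  simp [qbinom, qfact_zero, h.qfact_ne]

theorem qbinom_of_lt (v : F) {m k : ℕ} (h : m < k) : qbinom v m k = 0 := by
  simp [qbinom, not_le.2 h]

theorem qbinom_symm (v : F) {m k : ℕ} (h : k ≤ m) : qbinom v m (m - k) = qbinom v m k := by
  simp only [qbinom, Nat.sub_le, h, if_true, Nat.sub_sub_self h, mul_comm]

theorem qint_add {v : F} (h : Generic v) (k j : ℕ) :
    qint v (k + j + 2) = v⁻¹ ^ (k + 1) * qint v (j + 1) + v ^ (j + 1) * qint v (k + 1) := by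
  have h0 := h.1
  unfold qint
  rw [← mul_div_assoc, ← mul_div_assoc, ← add_div]
  congr 1
  have e : v ^ (j + 1) * v⁻¹ ^ (j + 1) = 1 := by
    rw [← mul_pow, mul_inv_cancel₀ h0, one_pow]
  have e1 : v ^ (k + j + 2) = v ^ (j + 1) * v ^ (k + 1) := by rw [← pow_add]; congr 1; ring
  have e2 : v⁻¹ ^ (k + j + 2) = v⁻¹ ^ (j + 1) * v⁻¹ ^ (k + 1) := by
    rw [← pow_add]; congr 1; ring
  rw [e1, e2]
  ring

theorem qbinom_succ_succ {v : F} (h : Generic v) {m k : ℕ} (hk : k ≤ m) :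
    qbinom v (m + 1) (k + 1) =
      v⁻¹ ^ (k + 1) * qbinom v m (k + 1) + v ^ (m - k) * qbinom v m k := by
  obtain ⟨j, rfl⟩ := Nat.exists_eq_add_of_le hk
  rcases j with _ | j
  · simp [qbinom_self h, qbinom_of_lt]
  · have e1 : k + (j + 1) + 1 - (k + 1) = j + 1 := by omega
    have e2 : k + (j + 1) - (k + 1) = j := by omega
    have e3 : k + (j + 1) - k = j + 1 := by omega
    have l1 : k + 1 ≤ k + (j + 1) + 1 := by omega
    have l2 : k + 1 ≤ k + (j + 1) := by omega
    have l3 : k ≤ k + (j + 1) := by omega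
    simp only [qbinom, l1, l2, l3, if_true, e1, e2, e3]
    rw [qfact_succ v (k + (j + 1)), qfact_succ v k, qfact_succ v j]
    have := qint_add h k j
    rw [show k + (j + 1) + 1 = k + j + 2 by ring, this]
    have a1 := h.qfact_ne k
    have a2 := h.qfact_ne j
    have a3 := h.qint_ne k
    have a4 := h.qint_ne j
    field_simp

section Twisted

variable {R : Type*} [Ring R] [Algebra F R]

/-- Iterated `q`-commutators, an auxiliary form of the Serre expression. -/
def adq (v c : F) (x y : R) : ℕ → R
  | 0 => y
  | t + 1 => x * adq v c x y t - (c * v ^ (2 * t)) • (adq v c x y t * x)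

theorem adq_eq_sum {v : F} (h : Generic v) (c : F) (x y : R) (m : ℕ) :
    adq v c x y m = ∑ k ∈ Finset.range (m + 1),
      ((-1) ^ k * (c ^ k * v ^ (k * m) * v⁻¹ ^ k * qbinom v m k)) •
        (x ^ (m - k) * y * x ^ k) := by
  induction m with
  | zero => simp [adq, qbinom_self h]
  | succ m ih =>
    have h0 := h.1
    rw [adq, ih, Finset.sum_range_succ' _ (m + 1)]
    have s1 : x * ∑ k ∈ Finset.range (m + 1),
        ((-1) ^ k * (c ^ k * v ^ (k * m) * v⁻¹ ^ k * qbinom v m k)) •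
        (x ^ (m - k) * y * x ^ k) = ∑ k ∈ Finset.range (m + 1),
        ((-1) ^ (k + 1) * (c ^ (k + 1) * v ^ ((k + 1) * m) * v⁻¹ ^ (k + 1) *
          qbinom v m (k + 1))) • (x ^ (m - k) * y * x ^ (k + 1)) + x ^ (m + 1) * y := by
      have : x * ∑ k ∈ Finset.range (m + 1),
        ((-1) ^ k * (c ^ k * v ^ (k * m) * v⁻¹ ^ k * qbinom v m k)) •
        (x ^ (m - k) * y * x ^ k) = ∑ k ∈ Finset.range (m + 1 + 1),
        ((-1) ^ k * (c ^ k * v ^ (k * m) * v⁻¹ ^ k * qbinom v m k)) •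
        (x ^ (m + 1 - k) * y * x ^ k) := by
        rw [Finset.sum_range_succ _ (m + 1), qbinom_of_lt v (Nat.lt_succ_self m), Finset.mul_sum]
        simp only [mul_zero, zero_smul, add_zero]
        refine Finset.sum_congr rfl fun k hk => ?_
        rw [mul_smul_comm, ← mul_assoc x, ← mul_assoc x, ← pow_succ',
          Nat.succ_sub (Nat.lt_succ_iff.1 (Finset.mem_range.1 hk))]
      rw [this, Finset.sum_range_succ']
      simp [qbinom_zero_right h]
    rw [s1, Finset.sum_mul, Finset.smul_sum]
    simp only [smul_mul_assoc, smul_smul, mul_assoc _ _ x, ← pow_succ]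
    rw [add_sub_right_comm, ← Finset.sum_sub_distrib]
    congr 1
    · refine Finset.sum_congr rfl fun k hk => ?_
      have hk' : k ≤ m := Nat.lt_succ_iff.1 (Finset.mem_range.1 hk)
      rw [← sub_smul, Nat.add_sub_add_right, qbinom_succ_succ h hk']
      congr 1
      obtain ⟨j, rfl⟩ := Nat.exists_eq_add_of_le hk'
      rw [Nat.add_sub_cancel_left]
      have e : v * v⁻¹ = 1 := mul_inv_cancel₀ h0
      simp only [inv_pow]
      field_simp
      ring
    · simp [qbinom_zero_right h]

theorem adq_eq_serre {v : F} (h : Generic v) {c : F} {m : ℕ} (hc : c * v ^ m = v) (x y : R) :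
    adq v c x y m = serre v m x y := by
  rw [adq_eq_sum h, serre]
  refine Finset.sum_congr rfl fun k _ => ?_
  have : c ^ k * v ^ (k * m) * v⁻¹ ^ k = 1 := by
    rw [mul_comm k m, pow_mul, ← mul_pow, hc, ← mul_pow, mul_inv_cancel₀ h.1, one_pow]
  rw [this, one_mul]

theorem serre_zero_right (v : F) (m : ℕ) (x : R) : serre v m x 0 = 0 := by
  simp [serre]

theorem map_serre {S : Type*} [Ring S] [Algebra F S] (f : R →ₐ[F] S) (v : F) (m : ℕ) (x y : R) :
    f (serre v m x y) = serre v m (f x) (f y) := by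
  simp [serre, map_sum]

theorem mul_adq (v c : F) {x y g : R} {p r : F} (hx : g * x = p • (x * g))
    (hy : g * y = r • (y * g)) (t : ℕ) :
    g * adq v c x y t = (p ^ t * r) • (adq v c x y t * g) := by
  induction t with
  | zero => simpa [adq] using hy
  | succ t ih =>
    have e1 : g * (x * adq v c x y t) = (p ^ (t + 1) * r) • (x * adq v c x y t * g) := by
      rw [← mul_assoc, hx, smul_mul_assoc, mul_assoc, ih, mul_smul_comm, smul_smul, mul_assoc]
      congr 1
      ring
    have e2 : g * (adq v c x y t * x) = (p ^ (t + 1) * r) • (adq v c x y t * x * g) := by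
      rw [← mul_assoc, ih, smul_mul_assoc, mul_assoc, hx, mul_smul_comm, smul_smul, ← mul_assoc]
      congr 1
      ring
    rw [adq, mul_sub, sub_mul, smul_sub, e1, mul_smul_comm, e2, smul_mul_assoc, smul_comm]

theorem adq_mul (v c : F) {x y g : R} {p r : F} (hx : x * g = p • (g * x))
    (hy : y * g = r • (g * y)) (t : ℕ) :
    adq v c x y t * g = (p ^ t * r) • (g * adq v c x y t) := by
  induction t with
  | zero => simpa [adq] using hy
  | succ t ih =>
    have e1 : x * adq v c x y t * g = (p ^ (t + 1) * r) • (g * (x * adq v c x y t)) := by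
      rw [mul_assoc, ih, mul_smul_comm, ← mul_assoc, hx, smul_mul_assoc, smul_smul, mul_assoc]
      congr 1
      · ring
      · exact mul_assoc _ _ _
    have e2 : adq v c x y t * x * g = (p ^ (t + 1) * r) • (g * (adq v c x y t * x)) := by
      rw [mul_assoc, hx, mul_smul_comm, ← mul_assoc, ih, smul_mul_assoc, smul_smul, mul_assoc g]
      congr 1
      ring
    rw [adq, mul_sub, sub_mul, smul_sub, e1, mul_smul_comm, smul_mul_assoc, e2, smul_comm]

theorem serre_add {v : F} (h : Generic v) {c : F} (hc0 : c ≠ 0) {m : ℕ} (hc : c * v ^ m = v)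
    {X Y x y : R} (hYX : Y * X = v ^ 2 • (X * Y)) (hYx : Y * x = c • (x * Y))
    (hyX : y * X = c • (X * y)) (hX : serre v m X x = 0) (hY : serre v m Y y = 0) :
    serre v m (X + Y) (x + y) = 0 := by
  have add : serre v m (X + Y) (x + y) = serre v m (X + Y) x + serre v m (X + Y) y := by
    simp [serre, mul_add, add_mul, smul_add, Finset.sum_add_distrib]
  have k1 : ∀ t, Y * adq v c X x t = (c * v ^ (2 * t)) • (adq v c X x t * Y) := by
    intro t
    rw [mul_adq v c hYX hYx t, ← pow_mul, mul_comm c]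
  have k2 : ∀ t, adq v c (X + Y) x t = adq v c X x t := by
    intro t
    induction t with
    | zero => rfl
    | succ t ih =>
      rw [adq, ih, adq, add_mul, mul_add, k1 t, smul_add]
      abel
  have k3 : ∀ t, adq v⁻¹ c⁻¹ Y y t * X = (c * v ^ (2 * t)) • (X * adq v⁻¹ c⁻¹ Y y t) := by
    intro t
    rw [adq_mul v⁻¹ c⁻¹ hYX hyX t, ← pow_mul, mul_comm c]
  have k4 : ∀ t, adq v⁻¹ c⁻¹ (X + Y) y t = adq v⁻¹ c⁻¹ Y y t := by
    intro t
    induction t with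
    | zero => rfl
    | succ t ih =>
      have e : c⁻¹ * v⁻¹ ^ (2 * t) * (c * v ^ (2 * t)) = 1 := by
        have := h.1
        simp only [inv_pow]
        field_simp
      rw [adq, ih, adq, add_mul, mul_add, k3 t, smul_add, smul_smul, e, one_smul]
      abel
  have hc' : c⁻¹ * v⁻¹ ^ m = v⁻¹ := by
    rw [inv_pow, ← mul_inv, hc]
  rw [add, ← adq_eq_serre h hc, k2, adq_eq_serre h hc, hX, ← serre_inv,
    ← adq_eq_serre h.inv hc', k4, adq_eq_serre h.inv hc', serre_inv, hY, add_zero]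

theorem serre_mul {v : F} (h : Generic v) (m : ℕ) {X x G g : R} {p r : F}
    (hGX : G * X = p • (X * G)) (hGx : G * x = r • (x * G)) (hgX : g * X = r • (X * g))
    (hGg : g * G = G * g) (hX : serre v m X x = 0) : serre v m (X * G) (x * g) = 0 := by
  have h0 : v ^ m ≠ 0 := pow_ne_zero _ h.1
  set c : F := v * (v ^ m)⁻¹ with hcdef
  have hc : c * v ^ m = v := by rw [hcdef, mul_assoc, inv_mul_cancel₀ h0, mul_one]
  have k1 := mul_adq v c hGX hGx
  have k2 : ∀ t, G ^ t * X = p ^ t • (X * G ^ t) := by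
    intro t
    induction t with
    | zero => simp
    | succ t ih =>
      rw [pow_succ, mul_assoc, hGX, mul_smul_comm, ← mul_assoc, ih, smul_mul_assoc, smul_smul,
        mul_assoc]
      congr 1
      ring
  have k3 : ∀ t, ∃ w : F,
      adq v c (X * G) (x * g) t = w • (adq v c X x t * (G ^ t * g)) := by
    intro t
    induction t with
    | zero => exact ⟨1, by simp [adq]⟩
    | succ t ih =>
      obtain ⟨w, hw⟩ := ih
      have hgG : ∀ s : ℕ, g * G ^ s = G ^ s * g := fun s => (Commute.pow_right hGg s).eq
      have e1 : X * G * (adq v c X x t * (G ^ t * g)) =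
          (p ^ t * r) • (X * adq v c X x t * (G ^ (t + 1) * g)) := by
        calc X * G * (adq v c X x t * (G ^ t * g))
            = X * (G * adq v c X x t) * (G ^ t * g) := by simp only [mul_assoc]
          _ = _ := by
            rw [k1, mul_smul_comm, smul_mul_assoc, pow_succ']
            simp only [mul_assoc]
      have e2 : adq v c X x t * (G ^ t * g) * (X * G) =
          (p ^ t * r) • (adq v c X x t * X * (G ^ (t + 1) * g)) := by
        calc adq v c X x t * (G ^ t * g) * (X * G)
            = adq v c X x t * (G ^ t * (g * X)) * G := by simp only [mul_assoc]
          _ = r • (adq v c X x t * (G ^ t * X) * (g * G)) := by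
            rw [hgX]; simp only [mul_smul_comm, smul_mul_assoc, mul_assoc]
          _ = _ := by
            rw [k2, hGg, pow_succ]
            simp only [mul_smul_comm, smul_mul_assoc, mul_assoc, smul_smul, mul_comm r]
      refine ⟨w * (p ^ t * r), ?_⟩
      rw [adq, hw, mul_smul_comm, smul_mul_assoc, e1, e2, adq, sub_mul, smul_sub,
        smul_mul_assoc]
      simp only [smul_smul]
      congr 2
      ring
  obtain ⟨w, hw⟩ := k3 m
  rw [← adq_eq_serre h hc, hw, adq_eq_serre h hc, hX, zero_mul, smul_zero]

theorem serre_op (v : F) (m : ℕ) (x y : R) :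
    serre v m (MulOpposite.op x) (MulOpposite.op y) =
      MulOpposite.op ((-1) ^ m * serre v m x y) := by
  rw [serre, serre, ← Finset.sum_range_reflect, Finset.mul_sum,
    ← MulOpposite.opAddEquiv_apply, map_sum]
  refine Finset.sum_congr rfl fun k hk => ?_
  have hk' : k ≤ m := Nat.lt_succ_iff.1 (Finset.mem_range.1 hk)
  have e : m + 1 - 1 - k = m - k := by omega
  rw [e, Nat.sub_sub_self hk', qbinom_symm v hk']
  have e2 : ((-1 : R)) ^ m = algebraMap F R ((-1) ^ m) := by simp
  have e3 : ((-1 : F)) ^ m * ((-1) ^ k * qbinom v m k) = (-1) ^ (m - k) * qbinom v m k := by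
    obtain ⟨j, rfl⟩ := Nat.exists_eq_add_of_le hk'
    rw [Nat.add_sub_cancel_left, ← mul_assoc]
    congr 1
    rw [pow_add, mul_right_comm, ← pow_add, ← two_mul, pow_mul, neg_one_sq, one_pow, one_mul]
  rw [e2, ← Algebra.smul_def, smul_smul, e3, MulOpposite.opAddEquiv_apply,
    MulOpposite.op_smul]
  simp [mul_assoc]

end Twisted

end QNumbers

section GroundField

variable (k : Type*) [Field k]

/-- The field `k_q = ⋃ₘ k(q^{1/m})`, realised as the fraction field of the group algebra of the
additive group `ℚ`, the basis element of degree `r` being `q^r`. -/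
def Kq : Type _ := FractionRing (AddMonoidAlgebra k ℚ)

instance : Field (Kq k) := inferInstanceAs (Field (FractionRing (AddMonoidAlgebra k ℚ)))

instance : Algebra (AddMonoidAlgebra k ℚ) (Kq k) :=
  inferInstanceAs (Algebra (AddMonoidAlgebra k ℚ) (FractionRing (AddMonoidAlgebra k ℚ)))

instance : IsFractionRing (AddMonoidAlgebra k ℚ) (Kq k) :=
  inferInstanceAs (IsFractionRing (AddMonoidAlgebra k ℚ) (FractionRing (AddMonoidAlgebra k ℚ)))

/-- The element `q^r` of `k_q`, for a rational exponent `r`. -/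
def qpow (r : ℚ) : Kq k := algebraMap (AddMonoidAlgebra k ℚ) (Kq k) (AddMonoidAlgebra.single r 1)

theorem qpow_zero : qpow k 0 = 1 := by
  rw [qpow, ← AddMonoidAlgebra.one_def, map_one]

theorem qpow_add (r s : ℚ) : qpow k (r + s) = qpow k r * qpow k s := by
  rw [qpow, qpow, qpow, ← map_mul, AddMonoidAlgebra.single_mul_single, one_mul]

theorem qpow_injective : Function.Injective (qpow k) := by
  intro r s h
  have h1 := IsFractionRing.injective (AddMonoidAlgebra k ℚ) (Kq k) h
  exact AddMonoidAlgebra.single_left_injective (one_ne_zero : (1 : k) ≠ 0) h1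

theorem qpow_mul_neg (r : ℚ) : qpow k r * qpow k (-r) = 1 := by
  rw [← qpow_add, add_neg_cancel, qpow_zero]

theorem qpow_ne_zero (r : ℚ) : qpow k r ≠ 0 :=
  left_ne_zero_of_mul_eq_one (qpow_mul_neg k r)

theorem qpow_neg (r : ℚ) : qpow k (-r) = (qpow k r)⁻¹ :=
  eq_inv_of_mul_eq_one_right (qpow_mul_neg k r)

theorem qpow_pow (r : ℚ) (n : ℕ) : qpow k r ^ n = qpow k (n * r) := by
  induction n with
  | zero => simp [qpow_zero]
  | succ n ih => rw [pow_succ, ih, ← qpow_add]; congr 1; push_cast; ring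

theorem generic_qpow {r : ℚ} (hr : r ≠ 0) : Generic (qpow k r) := by
  refine ⟨qpow_ne_zero k r, fun n hn h => ?_⟩
  rw [qpow_pow, ← qpow_zero k] at h
  have h1 := qpow_injective k h
  have hn' : (n : ℚ) ≠ 0 := by exact_mod_cast hn.ne'
  simp [hr, hn'] at h1

end GroundField

/-- A symmetrizable generalized Cartan matrix `A = (a_{ij})` with a choice of positive
integers `d_i` such that `(d_i a_{ij})` is symmetric. -/
structure CartanDatum (ι : Type*) where
  A : Matrix ι ι ℤ
  d : ι → ℕ
  d_pos : ∀ i, 0 < d i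
  diag : ∀ i, A i i = 2
  nonpos : ∀ i j, i ≠ j → A i j ≤ 0
  zero_symm : ∀ i j, A i j = 0 → A j i = 0
  symm : ∀ i j, (d i : ℤ) * A i j = d j * A j i

section RootLattice

variable {ι : Type*} [Fintype ι] [DecidableEq ι]

/-- The simple root `α_i` in `ℚQ = ι → ℚ`. -/
def root (i : ι) : ι → ℚ := Pi.single i 1

/-- The root lattice `Q`. -/
def rootLattice (ι : Type*) [Fintype ι] [DecidableEq ι] : AddSubgroup (ι → ℚ) :=
  AddSubgroup.closure (Set.range root)

/-- A lattice in `ℚQ` that contains `Q`. -/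
def IsLattice (M : AddSubgroup (ι → ℚ)) : Prop := M.FG ∧ rootLattice ι ≤ M

namespace CartanDatum

variable (C : CartanDatum ι)

/-- The Cartan matrix with rational entries. -/
def AQ : Matrix ι ι ℚ := C.A.map (Int.cast)

/-- The symmetric bilinear form on `ℚQ` with `(α_i, α_j) = d_i a_{ij}`. -/
def form (x y : ι → ℚ) : ℚ := ∑ i, ∑ j, x i * (C.d i * C.AQ i j) * y j

/-- `ψ₊ : ℚQ → ℚQ`, with `ψ₊(α_ℓ) = ζ⁺_ℓ = ∑ₖ d_k⁻¹ (Ψ A)_{kℓ} α_k`. -/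
def psiPlus (Ψ : Matrix ι ι ℚ) : (ι → ℚ) →+ (ι → ℚ) :=
  (Matrix.mulVecLin (Matrix.diagonal (fun i => (C.d i : ℚ)⁻¹) * Ψ * C.AQ)).toAddMonoidHom

/-- `ψ₋ : ℚQ → ℚQ`, with `ψ₋(α_ℓ) = ζ⁻_ℓ = ∑ₖ d_k⁻¹ (Ψᵀ A)_{kℓ} α_k`. -/
def psiMinus (Ψ : Matrix ι ι ℚ) : (ι → ℚ) →+ (ι → ℚ) :=
  (Matrix.mulVecLin (Matrix.diagonal (fun i => (C.d i : ℚ)⁻¹) * Ψ.transpose * C.AQ)).toAddMonoidHom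

/-- The bilinear form `xᵀ Aᵀ Ψ A y` on `ℚQ`. -/
def twistForm (Ψ : Matrix ι ι ℚ) (x y : ι → ℚ) : ℚ :=
  dotProduct x ((C.AQ.transpose * Ψ * C.AQ).mulVec y)

/-- The lattice `M` contains `Q + ψ₊(Q) + ψ₋(Q)`. -/
def TwistAdmissible (Ψ : Matrix ι ι ℚ) (M : AddSubgroup (ι → ℚ)) : Prop :=
  rootLattice ι ⊔ (rootLattice ι).map (C.psiPlus Ψ) ⊔ (rootLattice ι).map (C.psiMinus Ψ) ≤ M

/-- The lattice `Γ' = (id + ψ₊)(Γ) - ψ₋(Δ) + Q` attached to two lattices `Γ` and `Δ`. -/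
def enlarge (Ψ : Matrix ι ι ℚ) (Γ Δ : AddSubgroup (ι → ℚ)) : AddSubgroup (ι → ℚ) :=
  Γ.map (AddMonoidHom.id _ + C.psiPlus Ψ) ⊔ Δ.map (-C.psiMinus Ψ) ⊔ rootLattice ι

theorem form_add_left (x y z : ι → ℚ) : C.form (x + y) z = C.form x z + C.form y z := by
  simp only [form, Pi.add_apply, add_mul, Finset.sum_add_distrib]

theorem form_neg_left (x z : ι → ℚ) : C.form (-x) z = -C.form x z := by
  simp only [form, Pi.neg_apply, neg_mul, Finset.sum_neg_distrib]

theorem form_zero_left (z : ι → ℚ) : C.form 0 z = 0 := by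
  simp [form]

theorem form_root_right (x : ι → ℚ) (j : ι) :
    C.form x (root j) = ∑ i, x i * (C.d i * C.AQ i j) := by
  simp [form, root, Pi.single_apply]

theorem form_root_root (i j : ι) : C.form (root i) (root j) = C.d i * C.AQ i j := by
  rw [form_root_right]
  simp [root, Pi.single_apply]

theorem form_root_symm (i j : ι) : C.form (root i) (root j) = C.form (root j) (root i) := by
  rw [form_root_root, form_root_root]
  have h := C.symm i j
  simp only [AQ, Matrix.map_apply]
  exact_mod_cast h

theorem psiPlus_root (Ψ : Matrix ι ι ℚ) (i l : ι) :
    C.psiPlus Ψ (root i) l = (C.d l : ℚ)⁻¹ * (Ψ * C.AQ) l i := by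
  have e : C.psiPlus Ψ (root i) = Matrix.mulVec _ (Pi.single i 1) := rfl
  rw [e, Matrix.mulVec_single_one, Matrix.col_apply, Matrix.mul_assoc, Matrix.diagonal_mul]

theorem psiMinus_root (Ψ : Matrix ι ι ℚ) (i l : ι) :
    C.psiMinus Ψ (root i) l = (C.d l : ℚ)⁻¹ * (Ψ.transpose * C.AQ) l i := by
  have e : C.psiMinus Ψ (root i) = Matrix.mulVec _ (Pi.single i 1) := rfl
  rw [e, Matrix.mulVec_single_one, Matrix.col_apply, Matrix.mul_assoc, Matrix.diagonal_mul]

theorem form_psiPlus (Ψ : Matrix ι ι ℚ) (i j : ι) :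
    C.form (C.psiPlus Ψ (root i)) (root j) = C.form (C.psiMinus Ψ (root j)) (root i) := by
  have e : (Ψ * C.AQ).transpose * C.AQ = C.AQ.transpose * (Ψ.transpose * C.AQ) := by
    rw [Matrix.transpose_mul, Matrix.mul_assoc]
  have e2 := congrFun (congrFun e i) j
  rw [Matrix.mul_apply, Matrix.mul_apply] at e2
  simp only [Matrix.transpose_apply] at e2
  rw [form_root_right, form_root_right]
  have hd : ∀ l, (C.d l : ℚ) ≠ 0 := fun l => by exact_mod_cast (C.d_pos l).ne'
  calc ∑ l, C.psiPlus Ψ (root i) l * (C.d l * C.AQ l j)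
      = ∑ l, (Ψ * C.AQ) l i * C.AQ l j := by
        refine Finset.sum_congr rfl fun l _ => ?_
        rw [psiPlus_root]
        have := hd l
        field_simp
    _ = _ := e2
    _ = ∑ l, C.psiMinus Ψ (root j) l * (C.d l * C.AQ l i) := by
        refine Finset.sum_congr rfl fun l _ => ?_
        rw [psiMinus_root]
        have := hd l
        field_simp

theorem root_mem {M : AddSubgroup (ι → ℚ)} (h : rootLattice ι ≤ M) (i : ι) : root i ∈ M :=
  h (AddSubgroup.subset_closure ⟨i, rfl⟩)

theorem TwistAdmissible.rootLattice_le {C : CartanDatum ι} {Ψ : Matrix ι ι ℚ}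
    {M : AddSubgroup (ι → ℚ)} (h : C.TwistAdmissible Ψ M) : rootLattice ι ≤ M :=
  le_sup_left.trans (le_sup_left.trans h)

theorem TwistAdmissible.psiPlus_mem {C : CartanDatum ι} {Ψ : Matrix ι ι ℚ}
    {M : AddSubgroup (ι → ℚ)} (h : C.TwistAdmissible Ψ M) (i : ι) : C.psiPlus Ψ (root i) ∈ M :=
  h ((le_sup_right.trans le_sup_left :
    (rootLattice ι).map (C.psiPlus Ψ) ≤ _) ⟨_, root_mem le_rfl i, rfl⟩)

theorem TwistAdmissible.psiMinus_mem {C : CartanDatum ι} {Ψ : Matrix ι ι ℚ}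
    {M : AddSubgroup (ι → ℚ)} (h : C.TwistAdmissible Ψ M) (i : ι) : C.psiMinus Ψ (root i) ∈ M :=
  h ((le_sup_right : (rootLattice ι).map (C.psiMinus Ψ) ≤ _) ⟨_, root_mem le_rfl i, rfl⟩)

end CartanDatum

end RootLattice

section Borel

variable (k : Type*) [Field k] {ι : Type*} [Fintype ι] [DecidableEq ι] (C : CartanDatum ι)
  (s : ℤˣ) (M : AddSubgroup (ι → ℚ))

/-- The defining relations of the quantum Borel algebra; `Sum.inl γ` stands for `K_γ` and
`Sum.inr i` for the root vector `X_i` (that is `E_i` if `s = 1` and `F_i` if `s = -1`). -/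
inductive BorelRel : FreeAlgebra (Kq k) (M ⊕ ι) → FreeAlgebra (Kq k) (M ⊕ ι) → Prop
  | zero : BorelRel (FreeAlgebra.ι _ (Sum.inl 0)) 1
  | add (γ δ : M) : BorelRel (FreeAlgebra.ι _ (Sum.inl (γ + δ)))
      (FreeAlgebra.ι _ (Sum.inl γ) * FreeAlgebra.ι _ (Sum.inl δ))
  | comm (γ : M) (j : ι) :
      BorelRel (FreeAlgebra.ι _ (Sum.inl γ) * FreeAlgebra.ι _ (Sum.inr j))
        (qpow k ((s : ℤ) * C.form γ (root j)) •
          (FreeAlgebra.ι _ (Sum.inr j) * FreeAlgebra.ι _ (Sum.inl γ)))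
  | serre (i j : ι) (hij : i ≠ j) :
      BorelRel (serre (qpow k (C.d i)) (1 - C.A i j).toNat
        (FreeAlgebra.ι _ (Sum.inr i)) (FreeAlgebra.ι _ (Sum.inr j))) 0

/-- The quantum Borel algebra with torus `M`: `U_{q,M}(𝔟₊)` for `s = 1` and `U_{q,M}(𝔟₋)` for
`s = -1`. -/
def Borel : Type _ := RingQuot (BorelRel k C s M)

instance : Ring (Borel k C s M) := inferInstanceAs (Ring (RingQuot (BorelRel k C s M)))

instance : Algebra (Kq k) (Borel k C s M) :=
  inferInstanceAs (Algebra (Kq k) (RingQuot (BorelRel k C s M)))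

namespace Borel

/-- The quotient map from the free algebra. -/
def mk : FreeAlgebra (Kq k) (M ⊕ ι) →ₐ[Kq k] Borel k C s M :=
  RingQuot.mkAlgHom (Kq k) (BorelRel k C s M)

/-- The toral element `K_γ`, for `γ ∈ M`. -/
def K (γ : M) : Borel k C s M := mk k C s M (FreeAlgebra.ι _ (Sum.inl γ))

/-- The root vector `E_i` (for `s = 1`) or `F_i` (for `s = -1`). -/
def X (i : ι) : Borel k C s M := mk k C s M (FreeAlgebra.ι _ (Sum.inr i))

theorem mk_rel {x y : FreeAlgebra (Kq k) (M ⊕ ι)} (h : BorelRel k C s M x y) :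
    mk k C s M x = mk k C s M y := RingQuot.mkAlgHom_rel _ h

theorem K_zero : K k C s M 0 = 1 := by
  rw [K, mk_rel k C s M BorelRel.zero, map_one]

theorem K_add (γ δ : M) : K k C s M (γ + δ) = K k C s M γ * K k C s M δ := by
  rw [K, mk_rel k C s M (BorelRel.add γ δ), map_mul]
  rfl

theorem K_mul_X (γ : M) (j : ι) : K k C s M γ * X k C s M j =
    qpow k ((s : ℤ) * C.form γ (root j)) • (X k C s M j * K k C s M γ) := by
  rw [K, X, ← map_mul, mk_rel k C s M (BorelRel.comm γ j), map_smul, map_mul]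

theorem serre_X {i j : ι} (hij : i ≠ j) :
    serre (qpow k (C.d i)) (1 - C.A i j).toNat (X k C s M i) (X k C s M j) = 0 := by
  rw [X, X, ← map_serre, mk_rel k C s M (BorelRel.serre i j hij), map_zero]

theorem K_comm (γ δ : M) : K k C s M γ * K k C s M δ = K k C s M δ * K k C s M γ := by
  rw [← K_add, ← K_add, add_comm]

variable {k C s M}

/-- The algebra map out of a quantum Borel algebra with prescribed values on generators. -/
def lift {B : Type*} [Ring B] [Algebra (Kq k) B] (fK : M → B) (fX : ι → B)
    (h0 : fK 0 = 1) (hadd : ∀ γ δ, fK (γ + δ) = fK γ * fK δ)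
    (hcomm : ∀ γ j, fK γ * fX j = qpow k ((s : ℤ) * C.form γ (root j)) • (fX j * fK γ))
    (hserre : ∀ i j, i ≠ j → serre (qpow k (C.d i)) (1 - C.A i j).toNat (fX i) (fX j) = 0) :
    Borel k C s M →ₐ[Kq k] B :=
  RingQuot.liftAlgHom (Kq k) ⟨FreeAlgebra.lift (Kq k) (Sum.elim fK fX), by
    intro x y h
    induction h with
    | zero => simp [h0]
    | add γ δ => simp [hadd]
    | comm γ j => simp [hcomm]
    | serre i j hij => simp [map_serre, hserre i j hij]⟩

section lift

variable {B : Type*} [Ring B] [Algebra (Kq k) B] {fK : M → B} {fX : ι → B}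
    (h0 : fK 0 = 1) (hadd : ∀ γ δ, fK (γ + δ) = fK γ * fK δ)
    (hcomm : ∀ γ j, fK γ * fX j = qpow k ((s : ℤ) * C.form γ (root j)) • (fX j * fK γ))
    (hserre : ∀ i j, i ≠ j → serre (qpow k (C.d i)) (1 - C.A i j).toNat (fX i) (fX j) = 0)

theorem lift_K (γ : M) : lift fK fX h0 hadd hcomm hserre (K k C s M γ) = fK γ := by
  refine (RingQuot.liftAlgHom_mkAlgHom_apply (Kq k) (s := BorelRel k C s M)
    (f := FreeAlgebra.lift (Kq k) (Sum.elim fK fX)) _ (FreeAlgebra.ι _ (Sum.inl γ))).trans ?_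
  simp

theorem lift_X (i : ι) : lift fK fX h0 hadd hcomm hserre (X k C s M i) = fX i := by
  refine (RingQuot.liftAlgHom_mkAlgHom_apply (Kq k) (s := BorelRel k C s M)
    (f := FreeAlgebra.lift (Kq k) (Sum.elim fK fX)) _ (FreeAlgebra.ι _ (Sum.inr i))).trans ?_
  simp

end lift

variable (k C s M)

/-- The counit: `ε(K_γ) = 1`, `ε(X_i) = 0`. -/
def counit : Borel k C s M →ₐ[Kq k] Kq k :=
  lift (fun _ => 1) (fun _ => 0) rfl (by simp) (by simp) (fun _ _ _ => serre_zero_right _ _ _)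

/-- The projection onto the torus: `p(K_γ) = K_γ`, `p(X_i) = 0`. -/
def toralProj : Borel k C s M →ₐ[Kq k] Borel k C s M :=
  lift (K k C s M) (fun _ => 0) (K_zero k C s M) (K_add k C s M) (by simp)
    (fun _ _ _ => serre_zero_right _ _ _)

/-- The compatibility that makes `Δ(X_i) = X_i ⊗ K_{a_i} + K_{b_i} ⊗ X_i` well defined. -/
def Compatible (C : CartanDatum ι) {M : AddSubgroup (ι → ℚ)} (a b : ι → M) : Prop :=
  ∀ i j, C.form (b i) (root j) - C.form (a j) (root i) = C.form (root i) (root j)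

variable {C M}

theorem toNat_spec {i j : ι} (hij : i ≠ j) :
    (((1 - C.A i j).toNat : ℕ) : ℚ) = 1 - C.AQ i j := by
  have h : (((1 - C.A i j).toNat : ℕ) : ℤ) = 1 - C.A i j :=
    Int.toNat_of_nonneg (by have := C.nonpos i j hij; omega)
  have h2 : ((((1 - C.A i j).toNat : ℕ) : ℤ) : ℚ) = ((1 - C.A i j : ℤ) : ℚ) := by rw [h]
  rw [Int.cast_natCast] at h2
  rw [h2, CartanDatum.AQ, Matrix.map_apply, Int.cast_sub, Int.cast_one]

theorem serre_comul {a b : ι → M} (h : Compatible C a b) {i j : ι} (hij : i ≠ j) :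
    serre (qpow k (C.d i)) (1 - C.A i j).toNat
      (X k C s M i ⊗ₜ[Kq k] K k C s M (a i) + K k C s M (b i) ⊗ₜ[Kq k] X k C s M i)
      (X k C s M j ⊗ₜ[Kq k] K k C s M (a j) + K k C s M (b j) ⊗ₜ[Kq k] X k C s M j) = 0 := by
  have hd : (C.d i : ℚ) ≠ 0 := by exact_mod_cast (C.d_pos i).ne'
  have hs : ((s : ℤ) : ℚ) ≠ 0 := by
    rcases Int.units_eq_one_or s with rfl | rfl <;> simp
  have hsv : ∀ {R : Type _} [Ring R] [Algebra (Kq k) R] (m : ℕ) (x y : R),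
      serre (qpow k (C.d i)) m x y = serre (qpow k ((s : ℤ) * C.d i)) m x y := by
    intro R _ _ m x y
    rcases Int.units_eq_one_or s with rfl | rfl
    · simp
    · simp [qpow_neg, serre_inv]
  have key : ∀ i j : ι, (K k C s M (b i) ⊗ₜ[Kq k] X k C s M i) *
      (X k C s M j ⊗ₜ[Kq k] K k C s M (a j)) = qpow k ((s : ℤ) * C.form (root i) (root j)) •
      ((X k C s M j ⊗ₜ[Kq k] K k C s M (a j)) * (K k C s M (b i) ⊗ₜ[Kq k] X k C s M i)) := by
    intro i j
    rw [Algebra.TensorProduct.tmul_mul_tmul, Algebra.TensorProduct.tmul_mul_tmul, K_mul_X,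
      K_mul_X k C s M (a j), TensorProduct.tmul_smul, ← TensorProduct.smul_tmul', smul_smul,
      ← qpow_add,
      ← h i j]
    congr 2
    ring
  have hone : C.AQ i i = 2 := by simp [CartanDatum.AQ, C.diag]
  have powL : ∀ (x y : Borel k C s M) (g e : M) (m : ℕ),
      serre (qpow k (C.d i)) m x y = 0 →
      serre (qpow k (C.d i)) m (x ⊗ₜ[Kq k] K k C s M g) (y ⊗ₜ[Kq k] K k C s M e) = 0 ∧
      serre (qpow k (C.d i)) m (K k C s M g ⊗ₜ[Kq k] x) (K k C s M e ⊗ₜ[Kq k] y) = 0 := by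
    intro x y g e m hx
    have e1 : ∀ l ∈ Finset.range (m + 1),
        K k C s M g ^ (m - l) * K k C s M e * K k C s M g ^ l = K k C s M g ^ m * K k C s M e := by
      intro l hl
      have hl' : l ≤ m := Nat.lt_succ_iff.1 (Finset.mem_range.1 hl)
      rw [mul_assoc, ← (Commute.pow_left (K_comm k C s M g e) l).eq, ← mul_assoc, ← pow_add,
        Nat.sub_add_cancel hl']
    constructor
    · have : serre (qpow k (C.d i)) m (x ⊗ₜ[Kq k] K k C s M g) (y ⊗ₜ[Kq k] K k C s M e) =
          serre (qpow k (C.d i)) m x y ⊗ₜ[Kq k] (K k C s M g ^ m * K k C s M e) := by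
        simp only [serre, TensorProduct.sum_tmul]
        refine Finset.sum_congr rfl fun l hl => ?_
        rw [Algebra.TensorProduct.tmul_pow, Algebra.TensorProduct.tmul_pow,
          Algebra.TensorProduct.tmul_mul_tmul, Algebra.TensorProduct.tmul_mul_tmul, e1 l hl,
          TensorProduct.smul_tmul']
      rw [this, hx, TensorProduct.zero_tmul]
    · have : serre (qpow k (C.d i)) m (K k C s M g ⊗ₜ[Kq k] x) (K k C s M e ⊗ₜ[Kq k] y) =
          (K k C s M g ^ m * K k C s M e) ⊗ₜ[Kq k] serre (qpow k (C.d i)) m x y := by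
        simp only [serre, TensorProduct.tmul_sum]
        refine Finset.sum_congr rfl fun l hl => ?_
        rw [Algebra.TensorProduct.tmul_pow, Algebra.TensorProduct.tmul_pow,
          Algebra.TensorProduct.tmul_mul_tmul, Algebra.TensorProduct.tmul_mul_tmul, e1 l hl,
          TensorProduct.tmul_smul]
      rw [this, hx, TensorProduct.tmul_zero]
  have hXX := serre_X k C s M hij
  obtain ⟨z1, -⟩ := powL _ _ (a i) (a j) _ hXX
  obtain ⟨-, z2⟩ := powL _ _ (b i) (b j) _ hXX
  rw [hsv] at z1 z2 ⊢
  refine serre_add (generic_qpow k (mul_ne_zero hs hd))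
    (c := qpow k ((s : ℤ) * C.form (root i) (root j))) (qpow_ne_zero k _) ?_ ?_ (key i j) ?_ z1 z2
  · rw [qpow_pow, ← qpow_add, C.form_root_root, toNat_spec hij]
    congr 1
    ring
  · rw [key i i, qpow_pow, C.form_root_root, hone]
    congr 2
    push_cast
    ring
  · rw [key j i, C.form_root_symm]

/-- The coproduct `Δ(K_γ) = K_γ ⊗ K_γ`, `Δ(X_i) = X_i ⊗ K_{a_i} + K_{b_i} ⊗ X_i`. -/
def comul (a b : ι → M) (h : Compatible C a b) :
    Borel k C s M →ₐ[Kq k] Borel k C s M ⊗[Kq k] Borel k C s M :=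
  lift (fun γ => K k C s M γ ⊗ₜ K k C s M γ)
    (fun i => X k C s M i ⊗ₜ K k C s M (a i) + K k C s M (b i) ⊗ₜ X k C s M i)
    (by rw [K_zero]; rfl)
    (fun γ δ => by rw [K_add, Algebra.TensorProduct.tmul_mul_tmul])
    (fun γ j => by
      simp only [mul_add, add_mul, smul_add, Algebra.TensorProduct.tmul_mul_tmul]
      rw [K_mul_X, K_comm k C s M γ (a j), K_comm k C s M γ (b j),
        TensorProduct.tmul_smul, ← TensorProduct.smul_tmul'])
    (fun i j hij => serre_comul k s h hij)

theorem antipode_X_eq (a b : ι → M) (i : ι) :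
    -(K k C s M (-b i) * X k C s M i * K k C s M (-a i)) =
      X k C s M i * ((-qpow k ((s : ℤ) * C.form (-b i : M) (root i))) •
        K k C s M (-b i + -a i)) := by
  rw [K_mul_X, smul_mul_assoc, mul_assoc, ← K_add, neg_smul, mul_neg, mul_smul_comm]

theorem serre_antipode {a b : ι → M} (h : Compatible C a b) {i j : ι} (hij : i ≠ j) :
    serre (qpow k (C.d i)) (1 - C.A i j).toNat
      (-(K k C s M (-b i) * X k C s M i * K k C s M (-a i)))
      (-(K k C s M (-b j) * X k C s M j * K k C s M (-a j))) = 0 := by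
  have hd : (C.d i : ℚ) ≠ 0 := by exact_mod_cast (C.d_pos i).ne'
  have h2 : C.form (-b i + -a i : M) (root j) = C.form (-b j + -a j : M) (root i) := by
    have h1 := h i j
    have h3 := h j i
    rw [C.form_root_symm j i] at h3
    simp only [AddSubgroup.coe_add, AddSubgroup.coe_neg, C.form_add_left, C.form_neg_left]
    linarith
  rw [antipode_X_eq, antipode_X_eq]
  refine serre_mul (generic_qpow k hd) _
    (p := qpow k ((s : ℤ) * C.form (-b i + -a i : M) (root i)))
    (r := qpow k ((s : ℤ) * C.form (-b i + -a i : M) (root j))) ?_ ?_ ?_ ?_ (serre_X k C s M hij)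
  · rw [smul_mul_assoc, K_mul_X, mul_smul_comm, smul_comm]
  · rw [smul_mul_assoc, K_mul_X, mul_smul_comm, smul_comm]
  · rw [smul_mul_assoc, K_mul_X, mul_smul_comm, smul_comm, h2]
  · rw [smul_mul_smul_comm, smul_mul_smul_comm, K_comm, mul_comm (-qpow k _)]

/-- The antipode as an algebra map into the opposite algebra:
`S(K_γ) = K_{-γ}`, `S(X_i) = - K_{-b_i} X_i K_{-a_i}`. -/
def antipodeOp (a b : ι → M) (h : Compatible C a b) :
    Borel k C s M →ₐ[Kq k] (Borel k C s M)ᵐᵒᵖ :=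
  lift (fun γ => MulOpposite.op (K k C s M (-γ)))
    (fun i => MulOpposite.op (-(K k C s M (-b i) * X k C s M i * K k C s M (-a i))))
    (by rw [neg_zero, K_zero, MulOpposite.op_one])
    (fun γ δ => by rw [neg_add_rev, K_add, MulOpposite.op_mul])
    (fun γ j => by
      rw [← MulOpposite.op_mul, ← MulOpposite.op_mul, ← MulOpposite.op_smul, antipode_X_eq]
      congr 1
      have e : K k C s M (-γ) * X k C s M j =
          (qpow k ((s : ℤ) * C.form γ (root j)))⁻¹ • (X k C s M j * K k C s M (-γ)) := by
        rw [K_mul_X, ← qpow_neg]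
        congr 2
        rw [AddSubgroup.coe_neg, C.form_neg_left]
        ring
      rw [← mul_assoc (K k C s M (-γ)), e, smul_mul_assoc, smul_smul,
        mul_inv_cancel₀ (qpow_ne_zero k _), one_smul, mul_assoc, mul_assoc, mul_smul_comm,
        smul_mul_assoc, K_comm])
    (fun i j hij => by
      rw [serre_op, serre_antipode k s h hij, mul_zero, MulOpposite.op_zero])

/-- The antipode as a linear map. -/
def antipode (a b : ι → M) (h : Compatible C a b) : Borel k C s M →ₗ[Kq k] Borel k C s M :=
  (MulOpposite.opLinearEquiv (Kq k)).symm.toLinearMap ∘ₗ (antipodeOp k s a b h).toLinearMap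

end Borel

end Borel

section HopfNotions

variable {R : Type*} [CommRing R] {H : Type*} [AddCommGroup H] [Module R H]

/-- The structure maps `m`, `1`, `Δ`, `ε`, `S` of a Hopf algebra on a given module. -/
structure HopfOps (R : Type*) [CommRing R] (H : Type*) [AddCommGroup H] [Module R H] where
  mul : H ⊗[R] H →ₗ[R] H
  one : H
  comul : H →ₗ[R] H ⊗[R] H
  counit : H →ₗ[R] R
  antipode : H →ₗ[R] H

namespace HopfOps

variable (O : HopfOps R H)

/-- The coproduct of the tensor square coalgebra: `x ⊗ y ↦ (x₁ ⊗ y₁) ⊗ (x₂ ⊗ y₂)`. -/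
def comul₂ : H ⊗[R] H →ₗ[R] (H ⊗[R] H) ⊗[R] (H ⊗[R] H) :=
  (TensorProduct.tensorTensorTensorComm R H H H H).toLinearMap ∘ₗ
    TensorProduct.map O.comul O.comul

/-- The counit of the tensor square coalgebra: `x ⊗ y ↦ ε(x) ε(y)`. -/
def counit₂ : H ⊗[R] H →ₗ[R] R :=
  LinearMap.mul' R R ∘ₗ TensorProduct.map O.counit O.counit

end HopfOps

/-- A normalized Hopf 2-cocycle `σ`, together with its convolution inverse. -/
structure TwoCocycle (O : HopfOps R H) where
  toFun : H ⊗[R] H →ₗ[R] R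
  inv : H ⊗[R] H →ₗ[R] R
  mul_inv : LinearMap.mul' R R ∘ₗ TensorProduct.map toFun inv ∘ₗ O.comul₂ = O.counit₂
  inv_mul : LinearMap.mul' R R ∘ₗ TensorProduct.map inv toFun ∘ₗ O.comul₂ = O.counit₂
  /-- `σ(b₁, c₁) σ(a, b₂ c₂) = σ(a₁, b₁) σ(a₂ b₂, c)` -/
  cocycle : ∀ a b c : H,
    LinearMap.mul' R R (TensorProduct.map toFun (TensorProduct.curry toFun a ∘ₗ O.mul)
      (O.comul₂ (b ⊗ₜ c))) =
    LinearMap.mul' R R (TensorProduct.map toFun ((TensorProduct.curry toFun).flip c ∘ₗ O.mul)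
      (O.comul₂ (a ⊗ₜ b)))
  apply_one : ∀ a : H, toFun (a ⊗ₜ O.one) = O.counit a
  one_apply : ∀ a : H, toFun (O.one ⊗ₜ a) = O.counit a

namespace HopfOps

variable (O : HopfOps R H)

/-- The cocycle deformation `H_σ`:
`x ·_σ y = σ(x₁, y₁) x₂ y₂ σ⁻¹(x₃, y₃)` and
`S_σ(x) = σ(x₁, S(x₂)) S(x₃) σ⁻¹(S(x₄), x₅)`,
with the unit, coproduct and counit of `H`. -/
def deform (σ : TwoCocycle O) : HopfOps R H where
  mul := (TensorProduct.lid R H).toLinearMap ∘ₗ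
    TensorProduct.map σ.toFun
      ((TensorProduct.rid R H).toLinearMap ∘ₗ TensorProduct.map O.mul σ.inv ∘ₗ O.comul₂) ∘ₗ
    O.comul₂
  one := O.one
  comul := O.comul
  counit := O.counit
  antipode := (TensorProduct.lid R H).toLinearMap ∘ₗ
    TensorProduct.map (σ.toFun ∘ₗ TensorProduct.map LinearMap.id O.antipode ∘ₗ O.comul)
      ((TensorProduct.rid R H).toLinearMap ∘ₗ
        TensorProduct.map O.antipode
          (σ.inv ∘ₗ TensorProduct.map O.antipode LinearMap.id ∘ₗ O.comul) ∘ₗ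
        O.comul) ∘ₗ
    O.comul

end HopfOps

variable {L : Type*} [AddCommGroup L] [Module R L]

/-- `η(h, k' k'') = η(h₁, k') η(h₂, k'')`: the coproduct of the first structure is dual to the
product of the second one. -/
def ComulDualMul (O₁ : HopfOps R H) (O₂ : HopfOps R L) (η : H →ₗ[R] L →ₗ[R] R) : Prop :=
  ∀ (h : H) (k' k'' : L), η h (O₂.mul (k' ⊗ₜ k'')) =
    LinearMap.mul' R R (TensorProduct.map (η.flip k') (η.flip k'') (O₁.comul h))

/-- `η(h' h'', k) = η(h', k₂) η(h'', k₁)`: the product of the first structure is dual to the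
opposite coproduct of the second one. -/
def MulDualComul (O₁ : HopfOps R H) (O₂ : HopfOps R L) (η : H →ₗ[R] L →ₗ[R] R) : Prop :=
  ∀ (h' h'' : H) (k : L), η (O₁.mul (h' ⊗ₜ h'')) k =
    LinearMap.mul' R R (TensorProduct.map (η h'') (η h') (O₂.comul k))

/-- Skew-Hopf pairings. The last two fields say `η(S(h), k) = η(h, S⁻¹(k))` and
`η(S⁻¹(h), k) = η(h, S(k))`, for the bijective antipodes of the two structures. -/
structure IsSkewHopfPairing (O₁ : HopfOps R H) (O₂ : HopfOps R L)
    (η : H →ₗ[R] L →ₗ[R] R) : Prop where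
  comul_mul : ComulDualMul O₁ O₂ η
  mul_comul : MulDualComul O₁ O₂ η
  one_right : ∀ h, η h O₂.one = O₁.counit h
  one_left : ∀ k, η O₁.one k = O₂.counit k
  bijective_left : Function.Bijective O₁.antipode
  bijective_right : Function.Bijective O₂.antipode
  antipode : ∀ h k k', O₂.antipode k' = k → η (O₁.antipode h) k = η h k'
  antipode_inv : ∀ h h' k, O₁.antipode h' = h → η h' k = η h (O₂.antipode k)

end HopfNotions

section Pairing

variable (k : Type*) [Field k] {ι : Type*} [Fintype ι] [DecidableEq ι] {C : CartanDatum ι}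

namespace Borel

/-- The Hopf structure on a quantum Borel algebra with
`Δ(K_γ) = K_γ ⊗ K_γ`, `Δ(X_i) = X_i ⊗ K_{a_i} + K_{b_i} ⊗ X_i`,
`S(K_γ) = K_{-γ}`, `S(X_i) = - K_{-b_i} X_i K_{-a_i}`, `ε(K_γ) = 1`, `ε(X_i) = 0`. -/
def ops (s : ℤˣ) {M : AddSubgroup (ι → ℚ)} (a b : ι → M) (h : Compatible C a b) :
    HopfOps (Kq k) (Borel k C s M) where
  mul := LinearMap.mul' (Kq k) (Borel k C s M)
  one := 1
  comul := (comul k s a b h).toLinearMap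
  counit := (counit k C s M).toLinearMap
  antipode := antipode k s a b h

end Borel

/-- The quantum Borel algebra `U_{q,M}(𝔟₊)`. -/
abbrev BPlus (C : CartanDatum ι) (M : AddSubgroup (ι → ℚ)) : Type _ := Borel k C 1 M

/-- The quantum Borel algebra `U_{q,M}(𝔟₋)`. -/
abbrev BMinus (C : CartanDatum ι) (M : AddSubgroup (ι → ℚ)) : Type _ := Borel k C (-1) M

variable {M : AddSubgroup (ι → ℚ)}

/-- The standard Hopf structure on `U_{q,M}(𝔟₊)`: `Δ(E_i) = E_i ⊗ 1 + K_{α_i} ⊗ E_i`. -/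
def stdPlus (C : CartanDatum ι) (hM : rootLattice ι ≤ M) : HopfOps (Kq k) (BPlus k C M) :=
  Borel.ops k 1 (fun _ => 0) (fun i => ⟨root i, CartanDatum.root_mem hM i⟩) (by
    intro i j
    simp [C.form_zero_left])

/-- The standard Hopf structure on `U_{q,M}(𝔟₋)`: `Δ(F_i) = F_i ⊗ K_{-α_i} + 1 ⊗ F_i`. -/
def stdMinus (C : CartanDatum ι) (hM : rootLattice ι ≤ M) : HopfOps (Kq k) (BMinus k C M) :=
  Borel.ops k (-1) (fun i => -⟨root i, CartanDatum.root_mem hM i⟩) (fun _ => 0) (by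
    intro i j
    simp [C.form_zero_left, C.form_neg_left, C.form_root_symm j i])

/-- The twisted Hopf structure on `U_{q,M}(𝔟₊)`:
`Δ(E_i) = E_i ⊗ K_{ζ⁻_i} + K_{α_i + ζ⁺_i} ⊗ E_i`. -/
def twistPlus {Ψ : Matrix ι ι ℚ} (hM : C.TwistAdmissible Ψ M) : HopfOps (Kq k) (BPlus k C M) :=
  Borel.ops k 1 (fun i => ⟨C.psiMinus Ψ (root i), hM.psiMinus_mem i⟩)
    (fun i => ⟨root i, CartanDatum.root_mem hM.rootLattice_le i⟩ +
      ⟨C.psiPlus Ψ (root i), hM.psiPlus_mem i⟩) (by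
    intro i j
    simp [C.form_add_left, C.form_psiPlus])

/-- The twisted Hopf structure on `U_{q,M}(𝔟₋)`:
`Δ(F_i) = F_i ⊗ K_{-α_i - ζ⁻_i} + K_{-ζ⁺_i} ⊗ F_i`. -/
def twistMinus {Ψ : Matrix ι ι ℚ} (hM : C.TwistAdmissible Ψ M) : HopfOps (Kq k) (BMinus k C M) :=
  Borel.ops k (-1) (fun i => -(⟨root i, CartanDatum.root_mem hM.rootLattice_le i⟩ +
      ⟨C.psiMinus Ψ (root i), hM.psiMinus_mem i⟩))
    (fun i => -⟨C.psiPlus Ψ (root i), hM.psiPlus_mem i⟩) (by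
    intro i j
    simp only [AddSubgroup.coe_neg, AddSubgroup.coe_add, C.form_neg_left, C.form_add_left,
      C.form_psiPlus, C.form_root_symm j i]
    ring)

/-- The standard skew-Hopf pairing between opposite quantum Borel algebras. -/
structure IsStandardPairing {P N : AddSubgroup (ι → ℚ)} (hP : rootLattice ι ≤ P)
    (hN : rootLattice ι ≤ N) (η : BPlus k C P →ₗ[Kq k] BMinus k C N →ₗ[Kq k] Kq k) : Prop where
  pairing : IsSkewHopfPairing (stdPlus k C hP) (stdMinus k C hN) η
  K_K : ∀ (γ : P) (δ : N), η (Borel.K k C 1 P γ) (Borel.K k C (-1) N δ) =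
    qpow k (-C.form γ δ)
  E_F : ∀ i j, η (Borel.X k C 1 P i) (Borel.X k C (-1) N j) =
    if i = j then (qpow k (-C.d i) - qpow k (C.d i))⁻¹ else 0
  E_K : ∀ (i : ι) (δ : N), η (Borel.X k C 1 P i) (Borel.K k C (-1) N δ) = 0
  K_F : ∀ (γ : P) (j : ι), η (Borel.K k C 1 P γ) (Borel.X k C (-1) N j) = 0

section Cocycles

variable {k} {s : ℤˣ} {O : HopfOps (Kq k) (Borel k C s M)}

/-- The value `σ(K_γ, K_δ)`. -/
def TwoCocycle.onTorus (σ : TwoCocycle O) (γ δ : M) : Kq k :=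
  σ.toFun (Borel.K k C s M γ ⊗ₜ Borel.K k C s M δ)

/-- `σ` factors through the projection of the quantum Borel algebra onto its torus. -/
def TwoCocycle.IsToral (σ : TwoCocycle O) : Prop :=
  ∀ x y : Borel k C s M,
    σ.toFun (Borel.toralProj k C s M x ⊗ₜ Borel.toralProj k C s M y) = σ.toFun (x ⊗ₜ y)

/-- `σ` is the toral cocycle given by a `q`-rational bicharacter
`(γ, δ) ↦ q^{γᵀ S δ}` of the torus. -/
def TwoCocycle.IsRationalToral (σ : TwoCocycle O) : Prop :=
  σ.IsToral ∧ ∃ S : Matrix ι ι ℚ, ∀ γ δ : M,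
    σ.onTorus γ δ = qpow k (dotProduct (γ : ι → ℚ) (S.mulVec δ))

/-- The correspondence `Ψ ↔ σ`: `σ` is toral and `σ(K_γ, K_δ) = q^{-γᵀ (Aᵀ Ψ A) δ}` for
`γ, δ ∈ M`, one of them in `Q`. -/
def TwoCocycle.Corresponds (σ : TwoCocycle O) (Ψ : Matrix ι ι ℚ) : Prop :=
  σ.IsToral ∧ ∀ γ δ : M, ((γ : ι → ℚ) ∈ rootLattice ι ∨ (δ : ι → ℚ) ∈ rootLattice ι) →
    σ.onTorus γ δ = qpow k (-C.twistForm Ψ γ δ)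

end Cocycles

end Pairing

end QBorel

end

/-! Read the pairing as a map x ↦ η(x, ·) from U(𝔟₊) into the dual of U(𝔟₋) with its convolution
product. It reverses products, sends K_γ to a character χ_γ, and sends E_l to a functional D_l with
D_l(xy) = D_l(x)ε(y) + χ_{α_l}(x)D_l(y). Functionals of these two kinds are determined by their
values on generators, which gives uniqueness of η. For existence, D_l is the corner entry of a
triangular 2×2 representation; the Serre expression in these functionals is again skew primitive and
vanishes on generators, hence is zero (`serre_skewDerivation`). Compatibility with antipodes follows
from uniqueness: η ∘ (S × S) satisfies the same axioms, so it equals η.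

Deforming by σ is conjugation by σ: in the convolution algebra of functionals on the tensor square,
f ∘ m_σ = σ * (f ∘ m) * σ⁻¹ (`pullMul_deform`). Duality between Δ^Ψ and m_σ therefore says σ * (η(x,
·) ∘ m) = (η ⊗ η)(Δ^Ψ x) * σ. The elements x for which this holds form a subalgebra
(`mul_pullMul_eq_iff`), so only generators matter: for K_γ, σ must commute with χ_γ ⊗ χ_γ; for E_l
the condition is `TwistedRule`.

Both conditions are evaluated on words in the generators. Projecting the left or right leg of the
coproduct of a word to the torus gives a single K, of left or right degree; the difference of the
two degrees is the sum of the simple roots of the root vectors in the word. Commutation with χ_{α_i}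
⊗ χ_{α_i} forces σ to vanish on a pair of words unless their total degree difference is orthogonal
to every α_i. If det A ≠ 0 this leaves only pairs without root vectors, so σ is toral
(`isToral_of_commute_char`). Convolution with a toral σ multiplies by a scalar on each pair of
words, and `TwistedRule` becomes σ(K_{α_l}, K_δ) = q^{-(ζ⁻_l, δ)} and σ(K_δ, K_{α_l}) = q^{(ζ⁻_l,
δ)}. Since (ζ⁻_l, δ) = α_lᵀ(AᵀΨA)δ and AᵀΨA is antisymmetric, this is Ψ ↔ σ for simple roots, and
the cocycle identity extends it to Q.

Neither the twist nor a corresponding deformation changes the antipode (`antipode_twistPlus`,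
`antipode_twistMinus`, `deform_antipode_eq`), so one duality already yields the full skew-Hopf
pairing. Flipping η exchanges the two sides, and `StdData` with a sign treats them together. -/

noncomputable section

set_option linter.unusedSectionVars false

namespace QBorel

/-! ### The root form, the twist form and the enlarged lattices. -/

section Lattices

variable {ι : Type*} [Fintype ι] [DecidableEq ι]

namespace CartanDatum

variable (C : CartanDatum ι)

theorem form_comm (x y : ι → ℚ) : C.form x y = C.form y x := by
  rw [form, form, Finset.sum_comm]
  refine Finset.sum_congr rfl fun i _ => Finset.sum_congr rfl fun j _ => ?_
  have h : (C.d j : ℚ) * C.AQ j i = C.d i * C.AQ i j := by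
    simp only [AQ, Matrix.map_apply]
    exact_mod_cast C.symm j i
  rw [h]
  ring

theorem form_add_right (x y z : ι → ℚ) : C.form x (y + z) = C.form x y + C.form x z := by
  rw [form_comm, form_add_left, C.form_comm y, C.form_comm z]

theorem form_neg_right (x y : ι → ℚ) : C.form x (-y) = -C.form x y := by
  rw [form_comm, form_neg_left, form_comm]

theorem form_zero_right (x : ι → ℚ) : C.form x 0 = 0 := by
  rw [form_comm, form_zero_left]

theorem form_eq_mulVec (x y : ι → ℚ) :
    C.form x y = ∑ i, x i * (C.d i * C.AQ.mulVec y i) := by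
  simp only [form, Matrix.mulVec, dotProduct, Finset.mul_sum, mul_assoc]

theorem form_root_left (i : ι) (y : ι → ℚ) :
    C.form (root i) y = C.d i * C.AQ.mulVec y i := by
  simp [form_eq_mulVec, root, Pi.single_apply]

/-- Since (α_i, y) = d_i (Ay)_i, a vector orthogonal to all simple roots lies in the kernel of A.
This is where det A ≠ 0 enters. -/
theorem exists_form_root_ne_zero (hA : C.A.det ≠ 0) {y : ι → ℚ} (hy : y ≠ 0) :
    ∃ i, C.form (root i) y ≠ 0 := by
  by_contra! h
  have hdet : C.AQ.det ≠ 0 := by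
    have e : C.AQ.det = ((C.A.det : ℤ) : ℚ) := (Int.cast_det C.A).symm
    rw [e]
    exact_mod_cast hA
  refine hy (Matrix.eq_zero_of_mulVec_eq_zero hdet ?_)
  funext i
  have hd : (C.d i : ℚ) ≠ 0 := by exact_mod_cast (C.d_pos i).ne'
  have := h i
  rw [form_root_left] at this
  simpa [hd] using this

theorem twistForm_add_left (Ψ : Matrix ι ι ℚ) (x y z : ι → ℚ) :
    C.twistForm Ψ (x + y) z = C.twistForm Ψ x z + C.twistForm Ψ y z := by
  simp [twistForm, add_dotProduct]

theorem twistForm_neg_left (Ψ : Matrix ι ι ℚ) (x z : ι → ℚ) :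
    C.twistForm Ψ (-x) z = -C.twistForm Ψ x z := by
  simp [twistForm]

theorem twistForm_comm {Ψ : Matrix ι ι ℚ} (hΨ : Ψ.transpose = -Ψ) (x y : ι → ℚ) :
    C.twistForm Ψ x y = -C.twistForm Ψ y x := by
  have e : (C.AQ.transpose * Ψ * C.AQ).transpose = -(C.AQ.transpose * Ψ * C.AQ) := by
    simp [Matrix.transpose_mul, hΨ, Matrix.mul_assoc]
  rw [twistForm, twistForm, Matrix.dotProduct_mulVec, ← Matrix.mulVec_transpose, e,
    Matrix.neg_mulVec, neg_dotProduct, dotProduct_comm]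

theorem twistForm_add_right (Ψ : Matrix ι ι ℚ) (x y z : ι → ℚ) :
    C.twistForm Ψ x (y + z) = C.twistForm Ψ x y + C.twistForm Ψ x z := by
  simp [twistForm, Matrix.mulVec_add, dotProduct_add]

theorem twistForm_neg_right (Ψ : Matrix ι ι ℚ) (x z : ι → ℚ) :
    C.twistForm Ψ x (-z) = -C.twistForm Ψ x z := by
  simp [twistForm, Matrix.mulVec_neg]

theorem twistForm_self {Ψ : Matrix ι ι ℚ} (hΨ : Ψ.transpose = -Ψ) (x : ι → ℚ) :
    C.twistForm Ψ x x = 0 := by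
  have := C.twistForm_comm hΨ x x
  linarith

theorem twistForm_root_root (Ψ : Matrix ι ι ℚ) (i j : ι) :
    C.twistForm Ψ (root i) (root j) = (C.AQ.transpose * Ψ * C.AQ) i j := by
  simp [twistForm, root]

/-- The factor d_i⁻¹ in ζ⁻ cancels the d_i of the form, leaving (ΨᵀA)ᵀA = AᵀΨA. This links the twist
of the coproduct to the exponent of the cocycle. -/
theorem form_psiMinus_root (Ψ : Matrix ι ι ℚ) (l : ι) (y : ι → ℚ) :
    C.form (C.psiMinus Ψ (root l)) y = C.twistForm Ψ (root l) y := by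
  have hd : ∀ l, (C.d l : ℚ) ≠ 0 := fun l => by exact_mod_cast (C.d_pos l).ne'
  have e : (C.AQ.transpose * Ψ * C.AQ) = (Ψ.transpose * C.AQ).transpose * C.AQ := by
    simp [Matrix.transpose_mul]
  rw [form_eq_mulVec, twistForm, e, ← Matrix.mulVec_mulVec, root, single_one_dotProduct]
  refine Finset.sum_congr rfl fun i _ => ?_
  have := psiMinus_root C Ψ l i
  rw [root] at this
  rw [this]
  have := hd i
  simp only [Matrix.transpose_apply]
  field_simp

theorem psiPlus_eq_neg {Ψ : Matrix ι ι ℚ} (hΨ : Ψ.transpose = -Ψ) (x : ι → ℚ) :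
    C.psiPlus Ψ x = -C.psiMinus Ψ x := by
  change Matrix.mulVec _ x = -Matrix.mulVec _ x
  rw [hΨ]
  simp [Matrix.neg_mulVec]

end CartanDatum

theorem isLattice_enlarge (C : CartanDatum ι) (Ψ : Matrix ι ι ℚ) {Γ Δ : AddSubgroup (ι → ℚ)}
    (hΓ : IsLattice Γ) (hΔ : IsLattice Δ) : IsLattice (C.enlarge Ψ Γ Δ) := by
  have hQ : (rootLattice ι).FG := ⟨(Set.finite_range root).toFinset, by simp [rootLattice]⟩
  have hmap : ∀ (Λ : AddSubgroup (ι → ℚ)) (f : (ι → ℚ) →+ (ι → ℚ)), Λ.FG → (Λ.map f).FG := by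
    rintro _ f ⟨S, rfl⟩
    exact ⟨S.image f, by rw [Finset.coe_image, AddMonoidHom.map_closure]⟩
  exact ⟨((hmap _ _ hΓ.1).sup (hmap _ _ hΔ.1)).sup hQ, le_sup_right⟩

/-- For x in Q both x + ψ₊(x) and -ψ₋(x) are among the generators, and the summand Q allows x to be
subtracted. -/
theorem twistAdmissible_enlarge (C : CartanDatum ι) (Ψ : Matrix ι ι ℚ)
    {Γ Δ : AddSubgroup (ι → ℚ)} (hΓ : rootLattice ι ≤ Γ) (hΔ : rootLattice ι ≤ Δ) :
    C.TwistAdmissible Ψ (C.enlarge Ψ Γ Δ) := by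
  have h1 : rootLattice ι ≤ C.enlarge Ψ Γ Δ := le_sup_right
  refine sup_le (sup_le h1 ?_) ?_
  · rintro _ ⟨x, hx, rfl⟩
    have h2 : x + C.psiPlus Ψ x ∈ C.enlarge Ψ Γ Δ :=
      (le_sup_left.trans le_sup_left : Γ.map (AddMonoidHom.id _ + C.psiPlus Ψ) ≤ _)
        ⟨x, hΓ hx, rfl⟩
    simpa using sub_mem h2 (h1 hx)
  · rintro _ ⟨x, hx, rfl⟩
    have h2 : -C.psiMinus Ψ x ∈ C.enlarge Ψ Γ Δ :=
      (le_sup_right.trans le_sup_left : Δ.map (-C.psiMinus Ψ) ≤ _) ⟨x, hΔ hx, rfl⟩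
    simpa using neg_mem h2

end Lattices

/-! ### Words spanning a quantum Borel algebra. -/

namespace Borel

variable {k : Type*} [Field k] {ι : Type*} [Fintype ι] [DecidableEq ι] {C : CartanDatum ι}
  {s : ℤˣ} {M : AddSubgroup (ι → ℚ)}

theorem mk_surjective : Function.Surjective (mk k C s M) :=
  RingQuot.mkAlgHom_surjective _ _

theorem algHom_ext {B : Type*} [Semiring B] [Algebra (Kq k) B] {f g : Borel k C s M →ₐ[Kq k] B}
    (hK : ∀ γ, f (K k C s M γ) = g (K k C s M γ)) (hX : ∀ i, f (X k C s M i) = g (X k C s M i)) :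
    f = g := by
  have e : f.comp (mk k C s M) = g.comp (mk k C s M) := by
    refine FreeAlgebra.hom_ext (funext fun x => ?_)
    rcases x with γ | i
    · exact hK γ
    · exact hX i
  refine AlgHom.ext fun x => ?_
  obtain ⟨y, rfl⟩ := mk_surjective x
  exact congrArg (fun φ => φ y) e

/-- Induction on the elements of a quantum Borel algebra. -/
theorem induction_on {p : Borel k C s M → Prop} (x : Borel k C s M)
    (hc : ∀ c : Kq k, p (algebraMap _ _ c)) (hK : ∀ γ, p (K k C s M γ))
    (hX : ∀ i, p (X k C s M i)) (hmul : ∀ x y, p x → p y → p (x * y))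
    (hadd : ∀ x y, p x → p y → p (x + y)) : p x := by
  obtain ⟨y, rfl⟩ := mk_surjective x
  induction y using FreeAlgebra.induction with
  | grade0 r => rw [AlgHom.commutes]; exact hc r
  | grade1 x =>
    rcases x with γ | i
    · exact hK γ
    · exact hX i
  | mul a b ha hb => rw [map_mul]; exact hmul _ _ ha hb
  | add a b ha hb => rw [map_add]; exact hadd _ _ ha hb

variable (k C s M)

/-- The generators `K_γ` and `X_i`. -/
def gen : M ⊕ ι → Borel k C s M := Sum.elim (K k C s M) (X k C s M)

/-- The product of a word in the generators. -/
def word (w : List (M ⊕ ι)) : Borel k C s M := (w.map (gen k C s M)).prod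

variable {k C s M}

theorem word_cons_inl (γ : M) (w : List (M ⊕ ι)) :
    word k C s M (Sum.inl γ :: w) = K k C s M γ * word k C s M w := rfl

theorem word_cons_inr (i : ι) (w : List (M ⊕ ι)) :
    word k C s M (Sum.inr i :: w) = X k C s M i * word k C s M w := rfl

theorem word_append (v w : List (M ⊕ ι)) :
    word k C s M (v ++ w) = word k C s M v * word k C s M w := by
  simp [word]

/-- Linear independence is never needed: linear maps are compared on words, and torus degrees are
attached to the words themselves. -/
theorem span_word : Submodule.span (Kq k) (Set.range (word k C s M)) = ⊤ := by
  rw [eq_top_iff]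
  intro x _
  set S := Submodule.span (Kq k) (Set.range (word k C s M)) with hS
  have h : ∀ l, word k C s M l ∈ S := fun l => Submodule.subset_span ⟨l, rfl⟩
  induction x using induction_on with
  | hc c =>
    rw [Algebra.algebraMap_eq_smul_one]
    exact S.smul_mem _ (h [])
  | hK γ => simpa [word, gen] using h [Sum.inl γ]
  | hX i => simpa [word, gen] using h [Sum.inr i]
  | hadd x y hx hy => exact S.add_mem (hx trivial) (hy trivial)
  | hmul x y hx hy =>
    have hx' := hx trivial
    have hy' := hy trivial
    have hmul : S * S ≤ S := by
      rw [hS, Submodule.span_mul_span]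
      refine Submodule.span_le.2 ?_
      rintro _ ⟨_, ⟨v, rfl⟩, _, ⟨w, rfl⟩, rfl⟩
      exact Submodule.subset_span ⟨v ++ w, word_append v w⟩
    exact hmul (Submodule.mul_mem_mul hx' hy')

theorem linearMap_ext {V : Type*} [AddCommMonoid V] [Module (Kq k) V]
    {f g : Borel k C s M →ₗ[Kq k] V} (h : ∀ w, f (word k C s M w) = g (word k C s M w)) :
    f = g := by
  refine LinearMap.ext_on span_word ?_
  rintro _ ⟨w, rfl⟩
  exact h w

theorem tensor_ext {V : Type*} [AddCommMonoid V] [Module (Kq k) V]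
    {f g : Borel k C s M ⊗[Kq k] Borel k C s M →ₗ[Kq k] V}
    (h : ∀ v w, f (word k C s M v ⊗ₜ word k C s M w) = g (word k C s M v ⊗ₜ word k C s M w)) :
    f = g :=
  TensorProduct.ext (linearMap_ext fun v => linearMap_ext fun w => h v w)

theorem K_neg_mul (γ : M) : K k C s M (-γ) * K k C s M γ = 1 := by
  rw [← K_add, neg_add_cancel, K_zero]

theorem K_mul_neg (γ : M) : K k C s M γ * K k C s M (-γ) = 1 := by
  rw [← K_add, add_neg_cancel, K_zero]

end Borel

end QBorel

/-! ### Bialgebra structure, torus degrees of words, and characters. -/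

namespace QBorel

/-- Group-like elements `a_i`, `b_i` with `b_i - a_i = α_i` that define a coproduct
`Δ(X_i) = X_i ⊗ K_{a_i} + K_{b_i} ⊗ X_i` on a quantum Borel algebra. -/
class StdData {ι : Type*} [Fintype ι] [DecidableEq ι] (C : CartanDatum ι) (s : ℤˣ)
    (M : AddSubgroup (ι → ℚ)) where
  a : ι → M
  b : ι → M
  compat : Borel.Compatible C a b
  sub_eq : ∀ i, (b i : ι → ℚ) - a i = root i

namespace Borel

variable {k : Type*} [Field k] {ι : Type*} [Fintype ι] [DecidableEq ι] {C : CartanDatum ι}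
  {s : ℤˣ} {M : AddSubgroup (ι → ℚ)}

section Structure

variable {a b : ι → M} (h : Compatible C a b)

@[simp]
theorem comul_K (γ : M) :
    comul k s a b h (K k C s M γ) = K k C s M γ ⊗ₜ K k C s M γ := lift_K _ _ _ _ _

@[simp]
theorem comul_X (i : ι) : comul k s a b h (X k C s M i) =
    X k C s M i ⊗ₜ K k C s M (a i) + K k C s M (b i) ⊗ₜ X k C s M i := lift_X _ _ _ _ _

@[simp]
theorem counit_K (γ : M) : counit k C s M (K k C s M γ) = 1 := lift_K _ _ _ _ _

@[simp]
theorem counit_X (i : ι) : counit k C s M (X k C s M i) = 0 := lift_X _ _ _ _ _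

@[simp]
theorem toralProj_K (γ : M) : toralProj k C s M (K k C s M γ) = K k C s M γ := lift_K _ _ _ _ _

@[simp]
theorem toralProj_X (i : ι) : toralProj k C s M (X k C s M i) = 0 := lift_X _ _ _ _ _

theorem comul_coassoc :
    (Algebra.TensorProduct.assoc (Kq k) (Kq k) (Kq k) _ _ _).toAlgHom.comp
      ((Algebra.TensorProduct.map (comul k s a b h) (.id (Kq k) (Borel k C s M))).comp
        (comul k s a b h)) =
      (Algebra.TensorProduct.map (.id (Kq k) (Borel k C s M)) (comul k s a b h)).comp
        (comul k s a b h) := by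
  refine algHom_ext (fun γ => ?_) fun i => ?_
  · simp
  · simp [TensorProduct.add_tmul, TensorProduct.tmul_add, add_assoc]

theorem counit_comul_left :
    (Algebra.TensorProduct.map (counit k C s M) (.id (Kq k) (Borel k C s M))).comp
      (comul k s a b h) = (Algebra.TensorProduct.lid (Kq k) (Borel k C s M)).symm := by
  refine algHom_ext (fun γ => ?_) fun i => ?_
  · simp
  · simp

theorem counit_comul_right :
    (Algebra.TensorProduct.map (.id (Kq k) (Borel k C s M)) (counit k C s M)).comp
      (comul k s a b h) =
      (Algebra.TensorProduct.rid (Kq k) (Kq k) (Borel k C s M)).symm := by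
  refine algHom_ext (fun γ => ?_) fun i => ?_
  · simp
  · simp

end Structure

instance [StdData C s M] : Bialgebra (Kq k) (Borel k C s M) :=
  Bialgebra.ofAlgHom (comul k s (StdData.a C s) (StdData.b C s) StdData.compat) (counit k C s M)
    (comul_coassoc _) (counit_comul_left _) (counit_comul_right _)

variable (k C s M) in
/-- The Hopf structure given by `StdData`. -/
def stdOps [StdData C s M] : HopfOps (Kq k) (Borel k C s M) :=
  ops k s (StdData.a C s) (StdData.b C s) StdData.compat

section Degrees

variable [StdData C s M]

variable (C s) in
/-- The left torus degree of a word. -/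
def left (w : List (M ⊕ ι)) : M := (w.map (Sum.elim id (StdData.b C s))).sum

variable (C s) in
/-- The right torus degree of a word. -/
def right (w : List (M ⊕ ι)) : M := (w.map (Sum.elim id (StdData.a C s))).sum

end Degrees

/-- The number of root vectors in a word. -/
def rootCount (w : List (M ⊕ ι)) : ℕ := w.countP Sum.isRight

section Words

/-- The counit of a word is 1 if it contains no root vector and 0 otherwise, so it serves as the
indicator of toral words. -/
theorem toralProj_word (w : List (M ⊕ ι)) [StdData C s M] :
    toralProj k C s M (word k C s M w) =
      counit k C s M (word k C s M w) • K k C s M (left C s w) := by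
  induction w with
  | nil => simp [word, left, K_zero]
  | cons x w ih =>
    rcases x with γ | i
    · simp [word_cons_inl, left, K_add, ih]
    · simp [word_cons_inr]

/-- Killing root vectors in the left leg keeps only K_{b_i} ⊗ X_i of Δ(X_i), and multiplicativity
carries this to words. In the right leg the surviving term is X_i ⊗ K_{a_i}. -/
theorem map_toralProj_left_comul (w : List (M ⊕ ι)) [StdData C s M] :
    Algebra.TensorProduct.map (toralProj k C s M) (.id (Kq k) _)
      (comul k s (StdData.a C s) (StdData.b C s) StdData.compat (word k C s M w)) =
    K k C s M (left C s w) ⊗ₜ word k C s M w := by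
  induction w with
  | nil => simp [word, left, K_zero, Algebra.TensorProduct.one_def]
  | cons x w ih =>
    rcases x with γ | i
    · simp [word_cons_inl, left, K_add, ih]
    · simp [word_cons_inr, left, K_add, ih]

theorem map_toralProj_right_comul (w : List (M ⊕ ι)) [StdData C s M] :
    Algebra.TensorProduct.map (.id (Kq k) _) (toralProj k C s M)
      (comul k s (StdData.a C s) (StdData.b C s) StdData.compat (word k C s M w)) =
    word k C s M w ⊗ₜ K k C s M (right C s w) := by
  induction w with
  | nil => simp [word, right, K_zero, Algebra.TensorProduct.one_def]
  | cons x w ih =>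
    rcases x with γ | i
    · simp [word_cons_inl, right, K_add, ih]
    · simp [word_cons_inr, right, K_add, ih]

theorem left_cons_inl (γ : M) (w : List (M ⊕ ι)) [StdData C s M] :
    left C s (Sum.inl γ :: w) = γ + left C s w := rfl

theorem left_cons_inr (i : ι) (w : List (M ⊕ ι)) [StdData C s M] :
    left C s (Sum.inr i :: w) = StdData.b C s i + left C s w := rfl

theorem right_cons_inl (γ : M) (w : List (M ⊕ ι)) [StdData C s M] :
    right C s (Sum.inl γ :: w) = γ + right C s w := rfl

theorem right_cons_inr (i : ι) (w : List (M ⊕ ι)) [StdData C s M] :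
    right C s (Sum.inr i :: w) = StdData.a C s i + right C s w := rfl

theorem left_eq_right_of_counit_ne_zero [StdData C s M] {w : List (M ⊕ ι)}
    (hw : counit k C s M (word k C s M w) ≠ 0) : left C s w = right C s w := by
  induction w with
  | nil => rfl
  | cons x w ih =>
    rcases x with γ | i
    · rw [word_cons_inl, map_mul, counit_K, one_mul] at hw
      rw [left_cons_inl, right_cons_inl, ih hw]
    · simp [word_cons_inr] at hw

/-- Each X_i contributes b_i - a_i = α_i, of coordinate sum 1. Because these heights are positive,
the degrees of two words cannot cancel each other. -/
theorem sum_left_sub_right [StdData C s M] (w : List (M ⊕ ι)) :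
    ∑ i, ((left C s w : ι → ℚ) i - (right C s w : ι → ℚ) i) = rootCount w := by
  induction w with
  | nil => simp [left, right, rootCount]
  | cons x w ih =>
    rcases x with γ | i
    · simpa [left_cons_inl, right_cons_inl, rootCount] using ih
    · have h1 : ∀ j, (StdData.b C s i : ι → ℚ) j =
          (StdData.a C s i : ι → ℚ) j + root i j := fun j => by
        rw [← StdData.sub_eq (C := C) (s := s) (M := M) i, Pi.sub_apply, add_sub_cancel]
      have h2 : ∑ j, (root i : ι → ℚ) j = 1 := by simp [root]
      have h3 : rootCount (Sum.inr i :: w : List (M ⊕ ι)) = rootCount w + 1 :=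
        List.countP_cons_of_pos rfl
      rw [h3]
      push_cast
      rw [← ih, ← h2, ← Finset.sum_add_distrib]
      refine Finset.sum_congr rfl fun j _ => ?_
      simp only [left_cons_inr, right_cons_inr, AddSubgroup.coe_add, Pi.add_apply, h1]
      ring

theorem toralProj_word_of_rootCount_eq_zero {w : List (M ⊕ ι)} (hw : rootCount w = 0) :
    toralProj k C s M (word k C s M w) = word k C s M w := by
  induction w with
  | nil => simp [word]
  | cons x w ih =>
    rcases x with γ | i
    · rw [word_cons_inl, map_mul, toralProj_K, ih (by simpa [rootCount] using hw)]
    · simp [rootCount] at hw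

theorem toralProj_word_of_rootCount_ne_zero {w : List (M ⊕ ι)} (hw : rootCount w ≠ 0) :
    toralProj k C s M (word k C s M w) = 0 := by
  induction w with
  | nil => simp [rootCount] at hw
  | cons x w ih =>
    rcases x with γ | i
    · rw [word_cons_inl, map_mul, ih (by simpa [rootCount] using hw), mul_zero]
    · rw [word_cons_inr, map_mul, toralProj_X, zero_mul]

end Words

section Characters

variable (k C s M)

/-- The character `K_δ ↦ q^{-(μ, δ)}`, `X_i ↦ 0`. -/
def char (μ : ι → ℚ) : Borel k C s M →ₐ[Kq k] Kq k :=
  lift (fun δ => qpow k (-C.form μ δ)) (fun _ => 0)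
    (by rw [AddSubgroup.coe_zero, C.form_zero_right, neg_zero, qpow_zero])
    (fun γ δ => by rw [AddSubgroup.coe_add, C.form_add_right, neg_add, qpow_add])
    (by simp) (fun _ _ _ => serre_zero_right _ _ _)

@[simp]
theorem char_K (μ : ι → ℚ) (δ : M) : char k C s M μ (K k C s M δ) = qpow k (-C.form μ δ) :=
  lift_K _ _ _ _ _

@[simp]
theorem char_X (μ : ι → ℚ) (i : ι) : char k C s M μ (X k C s M i) = 0 :=
  lift_X _ _ _ _ _

theorem char_zero : char k C s M 0 = counit k C s M :=
  algHom_ext (by simp [C.form_zero_left, qpow_zero]) (by simp)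

theorem char_toralProj (μ : ι → ℚ) (x : Borel k C s M) :
    char k C s M μ (toralProj k C s M x) = char k C s M μ x := by
  have e : (char k C s M μ).comp (toralProj k C s M) = char k C s M μ :=
    algHom_ext (by simp) (by simp)
  exact congrArg (fun φ => φ x) e

variable {k C s M}

theorem char_word [StdData C s M] (μ : ι → ℚ) (w : List (M ⊕ ι)) :
    char k C s M μ (word k C s M w) =
      qpow k (-C.form μ (left C s w)) * counit k C s M (word k C s M w) := by
  rw [← char_toralProj, toralProj_word, map_smul, char_K, smul_eq_mul, mul_comm]

end Characters

end Borel

end QBorel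

/-! ### The antipode: its square, its coproduct, and its invariance under twists. -/

namespace QBorel

theorem serre_smul_smul {F R : Type*} [Field F] [Ring R] [Algebra F R] (v : F) (m : ℕ) (t u : F)
    (x y : R) : serre v m (t • x) (u • y) = (t ^ m * u) • serre v m x y := by
  rw [serre, serre, Finset.smul_sum]
  refine Finset.sum_congr rfl fun l hl => ?_
  have hl' : l ≤ m := Nat.lt_succ_iff.1 (Finset.mem_range.1 hl)
  rw [smul_pow, smul_pow, smul_mul_smul_comm, smul_mul_smul_comm, smul_smul, smul_smul]
  congr 1
  obtain ⟨j, rfl⟩ := Nat.exists_eq_add_of_le hl'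
  rw [Nat.add_sub_cancel_left]
  ring

namespace Borel

variable {k : Type*} [Field k] {ι : Type*} [Fintype ι] [DecidableEq ι] {C : CartanDatum ι}
  {s : ℤˣ} {M : AddSubgroup (ι → ℚ)}

variable (k C s M) in
/-- The endomorphism `K_γ ↦ K_γ`, `X_i ↦ t_i X_i`. -/
def scale (t : ι → Kq k) : Borel k C s M →ₐ[Kq k] Borel k C s M :=
  lift (K k C s M) (fun i => t i • X k C s M i) (K_zero k C s M) (K_add k C s M)
    (fun γ j => by rw [mul_smul_comm, K_mul_X, smul_mul_assoc, smul_comm])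
    (fun i j hij => by rw [serre_smul_smul, serre_X k C s M hij, smul_zero])

@[simp]
theorem scale_K (t : ι → Kq k) (γ : M) : scale k C s M t (K k C s M γ) = K k C s M γ :=
  lift_K _ _ _ _ _

@[simp]
theorem scale_X (t : ι → Kq k) (i : ι) :
    scale k C s M t (X k C s M i) = t i • X k C s M i :=
  lift_X _ _ _ _ _

theorem scale_bijective {t : ι → Kq k} (ht : ∀ i, t i ≠ 0) :
    Function.Bijective (scale k C s M t) := by
  have key : ∀ t u : ι → Kq k, (∀ i, t i * u i = 1) →
      Function.LeftInverse (scale k C s M t) (scale k C s M u) := by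
    intro t u htu x
    have e : (scale k C s M t).comp (scale k C s M u) = AlgHom.id _ _ :=
      algHom_ext (by simp) (fun i => by simp [smul_smul, mul_comm (u i), htu i])
    exact congrArg (fun φ => φ x) e
  exact Function.bijective_iff_has_inverse.2 ⟨scale k C s M fun i => (t i)⁻¹,
    key _ _ fun i => inv_mul_cancel₀ (ht i), key _ _ fun i => mul_inv_cancel₀ (ht i)⟩

section Antipode

variable {a b : ι → M} (h : Compatible C a b)

@[simp]
theorem antipode_K (γ : M) : antipode k s a b h (K k C s M γ) = K k C s M (-γ) := by
  change MulOpposite.unop (antipodeOp k s a b h (K k C s M γ)) = _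
  rw [antipodeOp, lift_K, MulOpposite.unop_op]

theorem antipode_X (i : ι) : antipode k s a b h (X k C s M i) =
    -(K k C s M (-b i) * X k C s M i * K k C s M (-a i)) := by
  change MulOpposite.unop (antipodeOp k s a b h (X k C s M i)) = _
  rw [antipodeOp, lift_X, MulOpposite.unop_op]

theorem antipode_mul (x y : Borel k C s M) :
    antipode k s a b h (x * y) = antipode k s a b h y * antipode k s a b h x := by
  change MulOpposite.unop (antipodeOp k s a b h (x * y)) = _
  rw [map_mul, MulOpposite.unop_mul]
  rfl

theorem antipode_algebraMap (c : Kq k) :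
    antipode k s a b h (algebraMap _ _ c) = algebraMap _ _ c := by
  change MulOpposite.unop (antipodeOp k s a b h (algebraMap _ _ c)) = _
  rw [AlgHom.commutes]
  rfl

theorem antipode_one : antipode k s a b h 1 = 1 := by
  simpa using antipode_algebraMap h 1

theorem counit_antipode (x : Borel k C s M) :
    counit k C s M (antipode k s a b h x) = counit k C s M x := by
  induction x using induction_on with
  | hc c => rw [antipode_algebraMap]
  | hK γ => simp
  | hX i => simp [antipode_X]
  | hmul x y hx hy => rw [antipode_mul, map_mul, map_mul, hx, hy, mul_comm]
  | hadd x y hx hy => rw [map_add, map_add, map_add, hx, hy]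

/-- Applying S twice conjugates X_i by K_{a_i - b_i}, which only rescales it. Hence S² is bijective,
and so is S. -/
theorem antipode_antipode (x : Borel k C s M) :
    antipode k s a b h (antipode k s a b h x) =
      scale k C s M (fun i => qpow k ((s : ℤ) * C.form ((a i - b i : M)) (root i))) x := by
  induction x using induction_on with
  | hc c => rw [antipode_algebraMap, antipode_algebraMap, AlgHom.commutes]
  | hK γ => simp
  | hX i =>
    rw [antipode_X, map_neg, antipode_mul, antipode_mul, antipode_K, antipode_K, antipode_X,
      neg_neg, neg_neg, neg_mul, mul_neg, neg_neg, scale_X]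
    have e : K k C s M (a i) * (K k C s M (-b i) * X k C s M i * K k C s M (-a i) *
        K k C s M (b i)) = K k C s M (a i - b i) * X k C s M i * K k C s M (-(a i - b i)) := by
      rw [sub_eq_add_neg, K_add, neg_add, neg_neg, K_add]
      simp only [mul_assoc]
    rw [e, K_mul_X, smul_mul_assoc, mul_assoc, K_mul_neg, mul_one]
  | hmul x y hx hy => rw [antipode_mul, antipode_mul, hx, hy, map_mul]
  | hadd x y hx hy => rw [map_add, map_add, map_add, hx, hy]

theorem antipode_bijective : Function.Bijective (antipode k s a b h) := by
  have hb : Function.Bijective (antipode k s a b h ∘ antipode k s a b h) := by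
    have e : antipode k s a b h ∘ antipode k s a b h = scale k C s M _ :=
      funext (antipode_antipode h)
    rw [e]
    exact scale_bijective fun i => qpow_ne_zero k _
  exact ⟨hb.1.of_comp, hb.2.of_comp⟩

theorem map_antipode_mul (u v : Borel k C s M ⊗[Kq k] Borel k C s M) :
    TensorProduct.map (antipode k s a b h) (antipode k s a b h) (u * v) =
      TensorProduct.map (antipode k s a b h) (antipode k s a b h) v *
        TensorProduct.map (antipode k s a b h) (antipode k s a b h) u := by
  induction u with
  | zero => simp
  | add u u' hu hu' => rw [add_mul, map_add, map_add, hu, hu', mul_add]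
  | tmul x y =>
    induction v with
    | zero => simp
    | add v v' hv hv' => rw [mul_add, map_add, map_add, hv, hv', add_mul]
    | tmul x' y' => simp [antipode_mul]

theorem comul_antipode (x : Borel k C s M) :
    comul k s a b h (antipode k s a b h x) =
      Algebra.TensorProduct.comm (Kq k) _ _ (TensorProduct.map (antipode k s a b h)
        (antipode k s a b h) (comul k s a b h x)) := by
  induction x using induction_on with
  | hc c =>
    rw [antipode_algebraMap, AlgHom.commutes, Algebra.TensorProduct.algebraMap_apply]
    simp [antipode_one, Algebra.algebraMap_eq_smul_one, TensorProduct.smul_tmul']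
  | hK γ => simp
  | hX i =>
    have e : K k C s M (-b i) * K k C s M (b i) = 1 := K_neg_mul _
    have e' : K k C s M (a i) * K k C s M (-a i) = 1 := K_mul_neg _
    simp only [antipode_X, map_neg, map_mul, comul_K, comul_X, map_add, TensorProduct.map_tmul,
      antipode_K, Algebra.TensorProduct.comm_tmul, mul_add, add_mul,
      Algebra.TensorProduct.tmul_mul_tmul, e, one_mul, TensorProduct.neg_tmul,
      TensorProduct.tmul_neg, neg_add]
    rw [mul_assoc (K k C s M (-b i)) (K k C s M (a i)), e', mul_one, add_comm]
  | hmul x y hx hy => rw [antipode_mul, map_mul, map_mul, map_antipode_mul, map_mul, hx, hy]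
  | hadd x y hx hy => simp only [map_add, hx, hy]

/-- Passing to (a + z, b - z) replaces X_i inside S(X_i) by its conjugate under K_{z_i}, and (z_i,
α_i) = 0 makes the two commute. The twist by Ψ is of this form with z = ±ζ⁻. -/
theorem antipode_congr {a' b' : ι → M} (h' : Compatible C a' b') (z : ι → M)
    (ha : ∀ i, a' i = a i + z i) (hb : ∀ i, b' i = b i - z i)
    (hz : ∀ i, C.form (z i) (root i) = 0) :
    antipode k s a' b' h' = antipode k s a b h := by
  refine LinearMap.ext fun x => ?_
  induction x using induction_on with
  | hc c => rw [antipode_algebraMap, antipode_algebraMap]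
  | hK γ => rw [antipode_K, antipode_K]
  | hX i =>
    have e : K k C s M (z i) * X k C s M i * K k C s M (-z i) = X k C s M i := by
      rw [K_mul_X, hz, mul_zero, qpow_zero, one_smul, mul_assoc, K_mul_neg, mul_one]
    have e1 : K k C s M (-b' i) = K k C s M (-b i) * K k C s M (z i) := by
      rw [hb, ← K_add]; congr 1; abel
    have e2 : K k C s M (-a' i) = K k C s M (-z i) * K k C s M (-a i) := by
      rw [ha, ← K_add]; congr 1; abel
    rw [antipode_X, antipode_X, e1, e2]
    nth_rewrite 2 [← e]
    simp only [mul_assoc]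
  | hmul x y hx hy => rw [antipode_mul, antipode_mul, hx, hy]
  | hadd x y hx hy => rw [map_add, map_add, hx, hy]

theorem antipode_toralProj (x : Borel k C s M) :
    antipode k s a b h (toralProj k C s M x) = toralProj k C s M (antipode k s a b h x) := by
  induction x using induction_on with
  | hc c => simp only [antipode_algebraMap, AlgHom.commutes]
  | hK γ => simp
  | hX i => simp [antipode_X]
  | hmul x y hx hy => rw [map_mul, antipode_mul, antipode_mul, map_mul, hx, hy]
  | hadd x y hx hy => simp only [map_add, hx, hy]

theorem comul_toralProj (x : Borel k C s M) :
    comul k s a b h (toralProj k C s M x) =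
      TensorProduct.map (toralProj k C s M).toLinearMap (toralProj k C s M).toLinearMap
        (comul k s a b h x) := by
  have e : (comul k s a b h).comp (toralProj k C s M) =
      (Algebra.TensorProduct.map (toralProj k C s M) (toralProj k C s M)).comp
        (comul k s a b h) := algHom_ext (by simp) (by simp)
  exact congrArg (fun φ => φ x) e

end Antipode

end Borel

end QBorel

/-! ### Convolution algebras, and deformation as conjugation. -/

namespace QBorel

open WithConv

section Convolution

variable {R : Type*} [CommRing R] {A : Type*} [Ring A] [Bialgebra R A]

/-- The functional `x ⊗ y ↦ f(x) g(y)`. -/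
def tens (f g : WithConv (A →ₗ[R] R)) : WithConv (A ⊗[R] A →ₗ[R] R) :=
  toConv (LinearMap.mul' R R ∘ₗ TensorProduct.map f.ofConv g.ofConv)

@[simp]
theorem tens_tmul (f g : WithConv (A →ₗ[R] R)) (x y : A) :
    tens f g (x ⊗ₜ y) = f x * g y := rfl

theorem tens_mul (f g f' g' : WithConv (A →ₗ[R] R)) :
    tens f g * tens f' g' = tens (f * f') (g * g') := by
  have h := LinearMap.algHom_comp_convMul_distrib (Algebra.TensorProduct.lmul' R (S := R))
    (toConv (TensorProduct.map f.ofConv g.ofConv)) (toConv (TensorProduct.map f'.ofConv g'.ofConv))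
  rw [TensorProduct.map_convMul_map] at h
  exact (WithConv.ext h).symm

theorem tens_add_left (f f' g : WithConv (A →ₗ[R] R)) :
    tens (f + f') g = tens f g + tens f' g := by
  apply WithConv.ext
  ext
  simp [tens, add_mul]

theorem tens_add_right (f g g' : WithConv (A →ₗ[R] R)) :
    tens f (g + g') = tens f g + tens f g' := by
  apply WithConv.ext
  ext
  simp [tens, mul_add]

theorem tens_smul_left (c : R) (f g : WithConv (A →ₗ[R] R)) :
    tens (c • f) g = c • tens f g := by
  apply WithConv.ext
  ext
  simp [tens, mul_assoc]

theorem tens_smul_right (c : R) (f g : WithConv (A →ₗ[R] R)) :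
    tens f (c • g) = c • tens f g := by
  apply WithConv.ext
  ext
  simp [tens, mul_left_comm]

theorem tens_one_one : tens (1 : WithConv (A →ₗ[R] R)) 1 = 1 := by
  apply WithConv.ext
  ext
  simp [tens, mul_comm]

variable (R A) in
/-- Composition with the product of a bialgebra, as a map between convolution algebras. -/
def pullMul : WithConv (A →ₗ[R] R) →ₐ[R] WithConv (A ⊗[R] A →ₗ[R] R) :=
  AlgHom.ofLinearMap
    { toFun := fun f => toConv (f.ofConv ∘ₗ LinearMap.mul' R A)
      map_add' := fun _ _ => rfl
      map_smul' := fun _ _ => rfl }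
    (by
      apply WithConv.ext
      ext x y
      change algebraMap R R (Coalgebra.counit (x * y)) = _
      simp [mul_comm])
    (fun f g => WithConv.ext (LinearMap.convMul_comp_coalgHom_distrib f g
      (Bialgebra.mulCoalgHom R A)))

@[simp]
theorem pullMul_tmul (f : WithConv (A →ₗ[R] R)) (x y : A) :
    pullMul R A f (x ⊗ₜ y) = f (x * y) := rfl

/-- The functional τ sees the first legs of the coproducts only through p, which collapses them to
the single elements g and h; one term of the convolution sum remains. -/
theorem mul_tmul_of_comp_map_left {p : A →ₗ[R] A} {τ G : WithConv (A ⊗[R] A →ₗ[R] R)}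
    (hτ : τ.ofConv ∘ₗ TensorProduct.map p p = τ.ofConv) {x y g h : A}
    (hx : TensorProduct.map p LinearMap.id (Coalgebra.comul (R := R) x) = g ⊗ₜ x)
    (hy : TensorProduct.map p LinearMap.id (Coalgebra.comul (R := R) y) = h ⊗ₜ y) :
    (τ * G) (x ⊗ₜ y) = τ (g ⊗ₜ h) * G (x ⊗ₜ y) := by
  have key : ∀ u v : A ⊗[R] A, LinearMap.mul' R R (TensorProduct.map τ.ofConv G.ofConv
      (TensorProduct.tensorTensorTensorComm R A A A A (u ⊗ₜ v))) =
      LinearMap.mul' R R (TensorProduct.map τ.ofConv G.ofConv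
      (TensorProduct.tensorTensorTensorComm R A A A A
        (TensorProduct.map p LinearMap.id u ⊗ₜ TensorProduct.map p LinearMap.id v))) := by
    intro u v
    induction u with
    | zero => simp
    | add u u' hu hu' => simp only [TensorProduct.add_tmul, map_add, hu, hu']
    | tmul a b =>
      induction v with
      | zero => simp
      | add v v' hv hv' => simp only [TensorProduct.tmul_add, map_add, hv, hv']
      | tmul c d =>
        have := LinearMap.congr_fun hτ (a ⊗ₜ c)
        rw [LinearMap.comp_apply, TensorProduct.map_tmul] at this
        simp [this]
  refine (key (Coalgebra.comul x) (Coalgebra.comul y)).trans ?_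
  rw [hx, hy]
  simp

theorem mul_tmul_of_comp_map_right {p : A →ₗ[R] A} {τ G : WithConv (A ⊗[R] A →ₗ[R] R)}
    (hτ : τ.ofConv ∘ₗ TensorProduct.map p p = τ.ofConv) {x y g h : A}
    (hx : TensorProduct.map LinearMap.id p (Coalgebra.comul (R := R) x) = x ⊗ₜ g)
    (hy : TensorProduct.map LinearMap.id p (Coalgebra.comul (R := R) y) = y ⊗ₜ h) :
    (G * τ) (x ⊗ₜ y) = G (x ⊗ₜ y) * τ (g ⊗ₜ h) := by
  have key : ∀ u v : A ⊗[R] A, LinearMap.mul' R R (TensorProduct.map G.ofConv τ.ofConv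
      (TensorProduct.tensorTensorTensorComm R A A A A (u ⊗ₜ v))) =
      LinearMap.mul' R R (TensorProduct.map G.ofConv τ.ofConv
      (TensorProduct.tensorTensorTensorComm R A A A A
        (TensorProduct.map LinearMap.id p u ⊗ₜ TensorProduct.map LinearMap.id p v))) := by
    intro u v
    induction u with
    | zero => simp
    | add u u' hu hu' => simp only [TensorProduct.add_tmul, map_add, hu, hu']
    | tmul a b =>
      induction v with
      | zero => simp
      | add v v' hv hv' => simp only [TensorProduct.tmul_add, map_add, hv, hv']
      | tmul c d =>
        have := LinearMap.congr_fun hτ (b ⊗ₜ d)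
        rw [LinearMap.comp_apply, TensorProduct.map_tmul] at this
        simp [this]
  refine (key (Coalgebra.comul x) (Coalgebra.comul y)).trans ?_
  rw [hx, hy]
  simp

/-- The sum defining the deformed product, followed by f, is a triple convolution product for the
coalgebra A ⊗ A. Together with σ * σ⁻¹ = 1 it turns questions on the deformed product into
commutation relations with σ. -/
theorem pullMul_deform {O : HopfOps R A} (hmul : O.mul = LinearMap.mul' R A)
    (hcomul : O.comul = Coalgebra.comul) (σ : TwoCocycle O) (f : WithConv (A →ₗ[R] R)) :
    toConv (f.ofConv ∘ₗ (O.deform σ).mul) =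
      toConv σ.toFun * (pullMul R A f * toConv σ.inv) := by
  -- The functional f moves past the scalar factors on either side, so that it acts on the
  -- undeformed product in the middle.
  have h1 : ∀ (τ : A ⊗[R] A →ₗ[R] R) (g : A ⊗[R] A →ₗ[R] A),
      f.ofConv ∘ₗ (TensorProduct.lid R A).toLinearMap ∘ₗ TensorProduct.map τ g =
        LinearMap.mul' R R ∘ₗ TensorProduct.map τ (f.ofConv ∘ₗ g) := fun τ g => by
    refine TensorProduct.ext' fun x y => ?_
    simp
  have h2 : ∀ (τ : A ⊗[R] A →ₗ[R] R) (g : A ⊗[R] A →ₗ[R] A),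
      f.ofConv ∘ₗ (TensorProduct.rid R A).toLinearMap ∘ₗ TensorProduct.map g τ =
        LinearMap.mul' R R ∘ₗ TensorProduct.map (f.ofConv ∘ₗ g) τ := fun τ g => by
    refine TensorProduct.ext' fun x y => ?_
    simp [mul_comm]
  have hΔ : O.comul₂ = Coalgebra.comul := by
    rw [HopfOps.comul₂, hcomul]
    rfl
  apply WithConv.ext
  rw [HopfOps.deform, hmul, hΔ]
  change f.ofConv ∘ₗ (TensorProduct.lid R A).toLinearMap ∘ₗ TensorProduct.map σ.toFun _ ∘ₗ _ = _
  rw [← LinearMap.comp_assoc _ _ (TensorProduct.lid R A).toLinearMap, ← LinearMap.comp_assoc, h1,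
    ← LinearMap.comp_assoc _ _ (TensorProduct.rid R A).toLinearMap, ← LinearMap.comp_assoc, h2]
  rfl

theorem cocycle_mul_inv {O : HopfOps R A} (hcounit : O.counit = Coalgebra.counit)
    (hcomul : O.comul = Coalgebra.comul) (σ : TwoCocycle O) :
    toConv σ.toFun * toConv σ.inv = 1 := by
  have h := σ.mul_inv
  rw [HopfOps.comul₂, hcomul, HopfOps.counit₂, hcounit] at h
  refine (congrArg toConv h).trans (WithConv.ext (TensorProduct.ext' fun x y => ?_))
  simp [mul_comm]

theorem cocycle_inv_mul {O : HopfOps R A} (hcounit : O.counit = Coalgebra.counit)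
    (hcomul : O.comul = Coalgebra.comul) (σ : TwoCocycle O) :
    toConv σ.inv * toConv σ.toFun = 1 := by
  have h := σ.inv_mul
  rw [HopfOps.comul₂, hcomul, HopfOps.counit₂, hcounit] at h
  refine (congrArg toConv h).trans (WithConv.ext (TensorProduct.ext' fun x y => ?_))
  simp [mul_comm]

end Convolution
end QBorel

/-! ### Two-cocycles on the torus, and toral cocycles. -/

namespace QBorel

open WithConv Borel

variable {k : Type*} [Field k] {ι : Type*} [Fintype ι] [DecidableEq ι] {C : CartanDatum ι}
  {s : ℤˣ} {M : AddSubgroup (ι → ℚ)} [StdData C s M]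

theorem left_sub_right_mem (w : List (M ⊕ ι)) :
    ((left C s w - right C s w : M) : ι → ℚ) ∈ rootLattice ι := by
  induction w with
  | nil => simp [left, right]
  | cons x w ih =>
    rcases x with γ | i
    · rwa [left_cons_inl, right_cons_inl, add_sub_add_left_eq_sub]
    · rw [left_cons_inr, right_cons_inr, add_sub_add_comm, AddSubgroup.coe_add,
        AddSubgroup.coe_sub, StdData.sub_eq]
      exact add_mem (CartanDatum.root_mem le_rfl i) ih

section Torus

variable (σ : TwoCocycle (stdOps k C s M))

/-- On group-like elements the Hopf cocycle condition is the 2-cocycle condition of the abelian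
group M. Bilinearity of σ on M is not implied. -/
theorem onTorus_cocycle (a b c : M) :
    σ.onTorus b c * σ.onTorus a (b + c) = σ.onTorus a b * σ.onTorus (a + b) c := by
  have h := σ.cocycle (K k C s M a) (K k C s M b) (K k C s M c)
  simpa [stdOps, ops, HopfOps.comul₂, TwoCocycle.onTorus, K_add] using h

theorem onTorus_zero_left (c : M) : σ.onTorus 0 c = 1 := by
  have h := σ.one_apply (K k C s M c)
  simpa [stdOps, ops, TwoCocycle.onTorus, K_zero] using h

theorem onTorus_zero_right (c : M) : σ.onTorus c 0 = 1 := by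
  have h := σ.apply_one (K k C s M c)
  simpa [stdOps, ops, TwoCocycle.onTorus, K_zero] using h

theorem onTorus_mul_inv (a b : M) :
    σ.onTorus a b * σ.inv (K k C s M a ⊗ₜ K k C s M b) = 1 := by
  have h := LinearMap.congr_fun σ.mul_inv (K k C s M a ⊗ₜ K k C s M b)
  simpa [stdOps, ops, HopfOps.comul₂, HopfOps.counit₂, TwoCocycle.onTorus] using h

theorem onTorus_ne_zero (a b : M) : σ.onTorus a b ≠ 0 :=
  left_ne_zero_of_mul_eq_one (onTorus_mul_inv σ a b)

theorem onTorus_neg_self (a : M) : σ.onTorus (-a) a = σ.onTorus a (-a) := by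
  have h := onTorus_cocycle σ a (-a) a
  rwa [neg_add_cancel, add_neg_cancel, onTorus_zero_left, onTorus_zero_right, mul_one,
    mul_one] at h

end Torus

section Corresponds

variable {σ : TwoCocycle (stdOps k C s M)} {Ψ : Matrix ι ι ℚ}

/-- In the cocycle identity for (β, b, c) the two values with β in the first slot are exponentials
of a bilinear form, and the part depending on (β, b) cancels. So shifts by Q act bilinearly even
though σ need not be bilinear on M. -/
theorem TwoCocycle.Corresponds.onTorus_add_left (h : σ.Corresponds Ψ) {β : M}
    (hβ : (β : ι → ℚ) ∈ rootLattice ι) (b c : M) :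
    σ.onTorus (β + b) c = qpow k (-C.twistForm Ψ β c) * σ.onTorus b c := by
  have h1 := onTorus_cocycle σ β b c
  rw [h.2 β _ (Or.inl hβ), h.2 β _ (Or.inl hβ), AddSubgroup.coe_add, C.twistForm_add_right,
    neg_add, qpow_add, ← mul_assoc, mul_comm (σ.onTorus b c), mul_assoc] at h1
  rw [mul_comm, mul_comm (σ.onTorus b c)] at h1
  rw [← mul_left_cancel₀ (qpow_ne_zero k _) ((mul_comm _ _).trans h1)]

theorem TwoCocycle.Corresponds.onTorus_add_right (h : σ.Corresponds Ψ) {β : M}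
    (hβ : (β : ι → ℚ) ∈ rootLattice ι) (a b : M) :
    σ.onTorus a (b + β) = qpow k (-C.twistForm Ψ a β) * σ.onTorus a b := by
  have h1 := onTorus_cocycle σ a b β
  rw [h.2 b _ (Or.inr hβ), h.2 (a + b) _ (Or.inr hβ), AddSubgroup.coe_add,
    C.twistForm_add_left, neg_add, qpow_add] at h1
  refine mul_left_cancel₀ (qpow_ne_zero k (-C.twistForm Ψ b β)) (h1.trans ?_)
  ring

theorem corresponds_of_roots (ht : σ.IsToral) (ρ : ι → M) (hρ : ∀ l, (ρ l : ι → ℚ) = root l)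
    (h1 : ∀ l δ, σ.onTorus (ρ l) δ = qpow k (-C.twistForm Ψ (ρ l) δ))
    (h2 : ∀ l δ, σ.onTorus δ (ρ l) = qpow k (-C.twistForm Ψ δ (ρ l))) :
    σ.Corresponds Ψ := by
  -- By the cocycle identity, the γ for which σ(γ, δ) has the prescribed value for all δ in M form a
  -- subgroup. Letting δ range over M, not only Q, allows the identity to be used with shifted
  -- second arguments. `T` is the same for the other slot.
  let S : AddSubgroup M :=
    { carrier := {γ | ∀ δ, σ.onTorus γ δ = qpow k (-C.twistForm Ψ γ δ)}
      zero_mem' := fun δ => by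
        simp [onTorus_zero_left, CartanDatum.twistForm, qpow_zero]
      add_mem' := fun {a b} ha hb δ => by
        have h := onTorus_cocycle σ a b δ
        rw [ha, ha, hb] at h
        refine mul_left_cancel₀ (qpow_ne_zero k (-C.twistForm Ψ a b)) (h.symm.trans ?_)
        simp only [← qpow_add, AddSubgroup.coe_add, C.twistForm_add_right, C.twistForm_add_left]
        congr 1
        ring
      neg_mem' := fun {a} ha δ => by
        have h := onTorus_cocycle σ a (-a) δ
        rw [ha, ha, add_neg_cancel, onTorus_zero_left, mul_one] at h
        refine mul_right_cancel₀ (qpow_ne_zero k _) (h.trans ?_)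
        simp only [← qpow_add, AddSubgroup.coe_add, AddSubgroup.coe_neg, C.twistForm_add_right,
          C.twistForm_neg_left, C.twistForm_neg_right]
        congr 1
        ring }
  let T : AddSubgroup M :=
    { carrier := {γ | ∀ δ, σ.onTorus δ γ = qpow k (-C.twistForm Ψ δ γ)}
      zero_mem' := fun δ => by
        simp [onTorus_zero_right, CartanDatum.twistForm, qpow_zero]
      add_mem' := fun {a b} ha hb δ => by
        have h := onTorus_cocycle σ δ a b
        rw [ha, hb, hb] at h
        refine mul_left_cancel₀ (qpow_ne_zero k (-C.twistForm Ψ a b)) (h.trans ?_)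
        simp only [← qpow_add, AddSubgroup.coe_add, C.twistForm_add_right, C.twistForm_add_left]
        congr 1
        ring
      neg_mem' := fun {a} ha δ => by
        have h := onTorus_cocycle σ δ (-a) a
        rw [ha, ha, neg_add_cancel, onTorus_zero_right, mul_one] at h
        refine mul_right_cancel₀ (qpow_ne_zero k _) (h.symm.trans ?_)
        simp only [← qpow_add, AddSubgroup.coe_add, AddSubgroup.coe_neg, C.twistForm_add_left,
          C.twistForm_neg_left, C.twistForm_neg_right]
        congr 1
        ring }
  have key : ∀ U : AddSubgroup M, (∀ l, ρ l ∈ U) →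
      ∀ γ : M, (γ : ι → ℚ) ∈ rootLattice ι → γ ∈ U := by
    intro U hU γ hγ
    have hle : rootLattice ι ≤ U.map M.subtype := by
      refine (AddSubgroup.closure_le _).2 ?_
      rintro _ ⟨l, rfl⟩
      exact ⟨ρ l, hU l, hρ l⟩
    obtain ⟨γ', h', e⟩ := hle hγ
    rwa [← Subtype.ext e]
  refine ⟨ht, fun γ δ hγδ => ?_⟩
  rcases hγδ with hγ | hδ
  · exact key S h1 γ hγ δ
  · exact key T h2 δ hδ γ

end Corresponds

section Toral

variable {σ : TwoCocycle (stdOps k C s M)} {Ψ : Matrix ι ι ℚ}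

theorem isToral_iff : σ.IsToral ↔ σ.toFun ∘ₗ TensorProduct.map (toralProj k C s M).toLinearMap
    (toralProj k C s M).toLinearMap = σ.toFun :=
  ⟨fun h => TensorProduct.ext' h, fun h x y => LinearMap.congr_fun h (x ⊗ₜ y)⟩

/-- The character `char μ` as an element of the convolution algebra. -/
def charConv (k : Type*) [Field k] (C : CartanDatum ι) (s : ℤˣ) (M : AddSubgroup (ι → ℚ))
    (μ : ι → ℚ) : WithConv (Borel k C s M →ₗ[Kq k] Kq k) :=
  toConv (char k C s M μ).toLinearMap

@[simp]
theorem charConv_apply (μ : ι → ℚ) (x : Borel k C s M) :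
    charConv k C s M μ x = char k C s M μ x := rfl

theorem charConv_zero : charConv k C s M 0 = 1 := by
  rw [charConv, char_zero]
  rfl

theorem pullMul_charConv (μ : ι → ℚ) : pullMul (Kq k) (Borel k C s M) (charConv k C s M μ) =
    tens (charConv k C s M μ) (charConv k C s M μ) := by
  apply WithConv.ext
  refine TensorProduct.ext' fun x y => ?_
  change char k C s M μ (x * y) = char k C s M μ x * char k C s M μ y
  rw [map_mul]

variable {τ G : WithConv (Borel k C s M ⊗[Kq k] Borel k C s M →ₗ[Kq k] Kq k)}

theorem toral_mul_word (hτ : τ.ofConv ∘ₗ TensorProduct.map (toralProj k C s M).toLinearMap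
      (toralProj k C s M).toLinearMap = τ.ofConv) (v w : List (M ⊕ ι)) :
    (τ * G) (word k C s M v ⊗ₜ word k C s M w) =
      τ (K k C s M (left C s v) ⊗ₜ K k C s M (left C s w)) *
        G (word k C s M v ⊗ₜ word k C s M w) :=
  mul_tmul_of_comp_map_left hτ (map_toralProj_left_comul v) (map_toralProj_left_comul w)

theorem mul_toral_word (hτ : τ.ofConv ∘ₗ TensorProduct.map (toralProj k C s M).toLinearMap
      (toralProj k C s M).toLinearMap = τ.ofConv) (v w : List (M ⊕ ι)) :
    (G * τ) (word k C s M v ⊗ₜ word k C s M w) =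
      G (word k C s M v ⊗ₜ word k C s M w) *
        τ (K k C s M (right C s v) ⊗ₜ K k C s M (right C s w)) :=
  mul_tmul_of_comp_map_right hτ (map_toralProj_right_comul v) (map_toralProj_right_comul w)

theorem tens_charConv_toral (μ : ι → ℚ) :
    (tens (charConv k C s M μ) (charConv k C s M μ)).ofConv ∘ₗ
      TensorProduct.map (toralProj k C s M).toLinearMap (toralProj k C s M).toLinearMap =
    (tens (charConv k C s M μ) (charConv k C s M μ)).ofConv := by
  refine TensorProduct.ext' fun x y => ?_
  change char k C s M μ (toralProj k C s M x) * char k C s M μ (toralProj k C s M y) =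
    char k C s M μ x * char k C s M μ y
  rw [char_toralProj, char_toralProj]

/-- At v ⊗ w both sides of the commutation relation are σ(v ⊗ w) times a power of q, with exponent
given by pairing α_i with the right degrees on one side and the left degrees on the other. Where σ
is nonzero these exponents agree for every i. -/
theorem isToral_of_commute_char (hA : C.A.det ≠ 0)
    (h : ∀ i, toConv σ.toFun * tens (charConv k C s M (root i)) (charConv k C s M (root i)) =
      tens (charConv k C s M (root i)) (charConv k C s M (root i)) * toConv σ.toFun) :
    σ.IsToral := by
  rw [isToral_iff]
  refine tensor_ext fun v w => ?_
  rw [LinearMap.comp_apply, TensorProduct.map_tmul]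
  simp only [AlgHom.toLinearMap_apply]
  by_cases hvw : rootCount v = 0 ∧ rootCount w = 0
  · rw [toralProj_word_of_rootCount_eq_zero hvw.1, toralProj_word_of_rootCount_eq_zero hvw.2]
  · have h0 : toralProj k C s M (word k C s M v) ⊗ₜ[Kq k] toralProj k C s M (word k C s M w) =
        0 := by
      by_cases hv : rootCount v = 0
      · rw [toralProj_word_of_rootCount_ne_zero (fun hw => hvw ⟨hv, hw⟩), TensorProduct.tmul_zero]
      · rw [toralProj_word_of_rootCount_ne_zero hv, TensorProduct.zero_tmul]
    rw [h0, map_zero]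
    by_contra hne
    -- The coordinate sum of this vector is the total number of root vectors in v and w, which is
    -- positive here.
    have hy : ((left C s v - right C s v + (left C s w - right C s w) : M) : ι → ℚ) ≠ 0 := by
      intro h0
      have h1 := sum_left_sub_right (C := C) (s := s) v
      have h2 := sum_left_sub_right (C := C) (s := s) w
      have h3 : (rootCount v : ℚ) + rootCount w = 0 := by
        rw [← h1, ← h2, ← Finset.sum_add_distrib]
        exact Finset.sum_eq_zero fun i _ => congrFun h0 i
      have h4 : rootCount v + rootCount w = 0 := by exact_mod_cast h3
      exact hvw (by omega)
    obtain ⟨i, hi⟩ := C.exists_form_root_ne_zero hA hy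
    have h1 := congrArg (fun φ => φ (word k C s M v ⊗ₜ word k C s M w)) (h i)
    simp only [mul_toral_word (tens_charConv_toral _), toral_mul_word (tens_charConv_toral _),
      tens_tmul, charConv_apply, char_K, ← qpow_add] at h1
    rw [mul_comm] at h1
    have h2 := qpow_injective k (mul_right_cancel₀ (Ne.symm hne) h1)
    apply hi
    simp only [AddSubgroup.coe_add, AddSubgroup.coe_neg, sub_eq_add_neg, C.form_add_right,
      C.form_neg_right] at h2 ⊢
    linarith

/-- Both products vanish unless v and w are toral words, and for those left and right degrees
coincide. -/
theorem commute_char_of_isToral (ht : σ.IsToral) (μ : ι → ℚ) :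
    toConv σ.toFun * tens (charConv k C s M μ) (charConv k C s M μ) =
      tens (charConv k C s M μ) (charConv k C s M μ) * toConv σ.toFun := by
  apply WithConv.ext
  refine tensor_ext fun v w => ?_
  refine (toral_mul_word (isToral_iff.1 ht) v w).trans
    (Eq.trans ?_ (mul_toral_word (isToral_iff.1 ht) v w).symm)
  rw [tens_tmul, charConv_apply, charConv_apply, char_word, char_word, mul_comm]
  by_cases hv : counit k C s M (word k C s M v) = 0
  · simp [hv]
  by_cases hw : counit k C s M (word k C s M w) = 0
  · simp [hw]
  rw [left_eq_right_of_counit_ne_zero hv, left_eq_right_of_counit_ne_zero hw]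

theorem inv_mul_onTorus (ht : σ.IsToral) (v w : List (M ⊕ ι)) :
    σ.inv (word k C s M v ⊗ₜ word k C s M w) * σ.onTorus (right C s v) (right C s w) =
      counit k C s M (word k C s M v) * counit k C s M (word k C s M w) := by
  have h := cocycle_inv_mul (O := stdOps k C s M) rfl rfl σ
  rw [← tens_one_one] at h
  have h1 := congrArg (fun φ => φ (word k C s M v ⊗ₜ word k C s M w)) h
  exact (mul_toral_word (isToral_iff.1 ht) v w).symm.trans h1

/-- Evaluating σ⁻¹ * σ = ε ⊗ ε on words determines σ⁻¹ there, because the toral factor σ contributes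
a nonzero scalar: σ⁻¹ vanishes unless both words are toral. -/
theorem inv_toral (ht : σ.IsToral) : σ.inv ∘ₗ TensorProduct.map (toralProj k C s M).toLinearMap
    (toralProj k C s M).toLinearMap = σ.inv := by
  refine tensor_ext fun v w => ?_
  have h1 := inv_mul_onTorus ht v w
  have h2 := onTorus_mul_inv σ (left C s v) (left C s w)
  rw [LinearMap.comp_apply, TensorProduct.map_tmul]
  simp only [AlgHom.toLinearMap_apply, toralProj_word, TensorProduct.smul_tmul_smul, map_smul,
    smul_eq_mul]
  refine mul_right_cancel₀ (onTorus_ne_zero σ (right C s v) (right C s w)) ?_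
  rw [h1]
  by_cases hv : counit k C s M (word k C s M v) = 0
  · simp [hv]
  by_cases hw : counit k C s M (word k C s M w) = 0
  · simp [hw]
  rw [left_eq_right_of_counit_ne_zero hv, left_eq_right_of_counit_ne_zero hw] at h2 ⊢
  rw [mul_assoc, mul_comm (σ.inv _), h2, mul_one]

end Toral

end QBorel

/-! ### Skew derivations and the twisted rule. -/

namespace QBorel

open WithConv Borel

variable {k : Type*} [Field k] {ι : Type*} [Fintype ι] [DecidableEq ι] {C : CartanDatum ι}
  {s : ℤˣ} {M : AddSubgroup (ι → ℚ)} [StdData C s M]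

/-- A functional `D` dual to the root vector `X_l`, with
`D(xy) = D(x) ε(y) + κ(x) D(y)` for the character `κ` attached to `μ`. -/
structure IsSkewDerivation (μ : ι → ℚ) (l : ι)
    (D : WithConv (Borel k C s M →ₗ[Kq k] Kq k)) : Prop where
  mul : pullMul (Kq k) (Borel k C s M) D = tens D 1 + tens (charConv k C s M μ) D
  apply_K : ∀ γ, D (K k C s M γ) = 0
  apply_X_of_ne : ∀ j, j ≠ l → D (X k C s M j) = 0
  apply_X_ne_zero : D (X k C s M l) ≠ 0

namespace IsSkewDerivation

variable {μ : ι → ℚ} {l : ι} {D : WithConv (Borel k C s M →ₗ[Kq k] Kq k)}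

theorem apply_mul (h : IsSkewDerivation μ l D) (x y : Borel k C s M) :
    D (x * y) = D x * counit k C s M y + char k C s M μ x * D y :=
  congrArg (fun φ => φ (x ⊗ₜ y)) h.mul

/-- Leading toral letters pass through D as scalars. The first root vector must be X_l, and since
the character kills it, the remaining letters are seen through the counit and must be toral. -/
theorem degree (h : IsSkewDerivation μ l D) {w : List (M ⊕ ι)} (hw : D (word k C s M w) ≠ 0) :
    ((left C s w - right C s w : M) : ι → ℚ) = root l := by
  induction w with
  | nil =>
    refine absurd ?_ hw
    have := h.apply_K 0
    rwa [K_zero] at this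
  | cons x w ih =>
    rcases x with γ | i
    · rw [word_cons_inl, h.apply_mul, h.apply_K, zero_mul, zero_add] at hw
      rw [left_cons_inl, right_cons_inl, add_sub_add_left_eq_sub]
      exact ih (right_ne_zero_of_mul hw)
    · rw [word_cons_inr, h.apply_mul, char_X, zero_mul, add_zero] at hw
      have hil : i = l := by
        by_contra hil
        exact left_ne_zero_of_mul hw (h.apply_X_of_ne i hil)
      rw [left_cons_inr, right_cons_inr,
        left_eq_right_of_counit_ne_zero (right_ne_zero_of_mul hw), add_sub_add_right_eq_sub,
        AddSubgroup.coe_sub, StdData.sub_eq, hil]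

end IsSkewDerivation

/-- The relation between a 2-cocycle and the twisted skew derivation rule. -/
def TwistedRule (σ : TwoCocycle (stdOps k C s M)) (μ ζ : ι → ℚ)
    (D : WithConv (Borel k C s M →ₗ[Kq k] Kq k)) : Prop :=
  toConv σ.toFun * pullMul (Kq k) (Borel k C s M) D =
    (tens D (charConv k C s M ζ) + tens (charConv k C s M (μ - ζ)) D) * toConv σ.toFun

section TwistedRule

variable {σ : TwoCocycle (stdOps k C s M)} {Ψ : Matrix ι ι ℚ} {μ : ι → ι → ℚ}
  {D : ι → WithConv (Borel k C s M →ₗ[Kq k] Kq k)}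

/-- A toral σ acts on a pair of words by its value at the left degrees when it stands on the left,
and at the right degrees when it stands on the right. The rule thus becomes a family of scalar
identities. -/
theorem twistedRule_apply (ht : σ.IsToral) {μ ζ : ι → ℚ} {l : ι}
    {D : WithConv (Borel k C s M →ₗ[Kq k] Kq k)} (hD : IsSkewDerivation μ l D) :
    TwistedRule σ μ ζ D ↔ ∀ v w : List (M ⊕ ι),
      σ.onTorus (left C s v) (left C s w) *
        (D (word k C s M v) * counit k C s M (word k C s M w) +
          qpow k (-C.form μ (left C s v)) * counit k C s M (word k C s M v) *
            D (word k C s M w)) =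
      (D (word k C s M v) * (qpow k (-C.form ζ (left C s w)) *
          counit k C s M (word k C s M w)) +
        qpow k (-C.form (μ - ζ) (left C s v)) * counit k C s M (word k C s M v) *
          D (word k C s M w)) *
        σ.onTorus (right C s v) (right C s w) := by
  have key : ∀ v w : List (M ⊕ ι),
      ((toConv σ.toFun * pullMul (Kq k) (Borel k C s M) D)
          (word k C s M v ⊗ₜ word k C s M w) =
        ((tens D (charConv k C s M ζ) + tens (charConv k C s M (μ - ζ)) D) * toConv σ.toFun)
          (word k C s M v ⊗ₜ word k C s M w)) ↔ _ := fun v w => by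
    rw [toral_mul_word (isToral_iff.1 ht) v w, mul_toral_word (isToral_iff.1 ht) v w,
      pullMul_tmul, hD.apply_mul, ofConv_add, LinearMap.add_apply, tens_tmul, tens_tmul,
      charConv_apply, charConv_apply, char_word, char_word, char_word]
  constructor
  · intro h v w
    exact (key v w).1 (by rw [h])
  · intro h
    exact WithConv.ext (tensor_ext fun v w => (key v w).2 (h v w))

/-- In each of the two summands one word has degree α_l and the other is toral. Extracting α_l from
the corresponding slot of σ produces exactly the character value of ζ⁻_l, with opposite signs in the
two slots by antisymmetry. -/
theorem twistedRule_of_corresponds (hΨ : Ψ.transpose = -Ψ) (hσ : σ.Corresponds Ψ)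
    {μ : ι → ℚ} {l : ι} {D : WithConv (Borel k C s M →ₗ[Kq k] Kq k)}
    (hD : IsSkewDerivation μ l D) : TwistedRule σ μ (C.psiMinus Ψ (root l)) D := by
  rw [twistedRule_apply hσ.1 hD]
  intro v w
  have h1 : D (word k C s M v) * counit k C s M (word k C s M w) *
      σ.onTorus (left C s v) (left C s w) = D (word k C s M v) * counit k C s M (word k C s M w) *
      (qpow k (-C.form (C.psiMinus Ψ (root l)) (left C s w)) *
        σ.onTorus (right C s v) (right C s w)) := by
    by_cases hv : D (word k C s M v) = 0
    · simp [hv]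
    by_cases hw : counit k C s M (word k C s M w) = 0
    · simp [hw]
    have hd := hD.degree hv
    have e : left C s v = (left C s v - right C s v) + right C s v := by abel
    rw [left_eq_right_of_counit_ne_zero hw]
    nth_rewrite 1 [e]
    rw [hσ.onTorus_add_left (left_sub_right_mem v), hd, C.form_psiMinus_root]
  have h2 : counit k C s M (word k C s M v) * D (word k C s M w) *
      σ.onTorus (left C s v) (left C s w) = counit k C s M (word k C s M v) * D (word k C s M w) *
      (qpow k (C.form (C.psiMinus Ψ (root l)) (left C s v)) *
        σ.onTorus (right C s v) (right C s w)) := by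
    by_cases hv : D (word k C s M w) = 0
    · simp [hv]
    by_cases hw : counit k C s M (word k C s M v) = 0
    · simp [hw]
    have hd := hD.degree hv
    have e : left C s w = right C s w + (left C s w - right C s w) := by abel
    rw [left_eq_right_of_counit_ne_zero hw]
    nth_rewrite 1 [e]
    rw [hσ.onTorus_add_right (left_sub_right_mem w), hd, C.form_psiMinus_root,
      C.twistForm_comm hΨ (root l)]
  have e3 : qpow k (-C.form (μ - C.psiMinus Ψ (root l)) (left C s v)) =
      qpow k (-C.form μ (left C s v)) * qpow k (C.form (C.psiMinus Ψ (root l)) (left C s v)) := by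
    rw [← qpow_add, sub_eq_add_neg, C.form_add_left, C.form_neg_left]
    congr 1
    ring
  rw [e3]
  linear_combination h1 + qpow k (-C.form μ (left C s v)) * h2

theorem corresponds_of_twistedRule (hΨ : Ψ.transpose = -Ψ) (ht : σ.IsToral)
    (hD : ∀ l, IsSkewDerivation (μ l) l (D l))
    (h : ∀ l, TwistedRule σ (μ l) (C.psiMinus Ψ (root l)) (D l)) : σ.Corresponds Ψ := by
  let ρ : ι → M := fun l => StdData.b C s l - StdData.a C s l
  have hρ : ∀ l, (ρ l : ι → ℚ) = root l := fun l => by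
    rw [AddSubgroup.coe_sub, StdData.sub_eq]
  -- The word K_{-a_l} X_l has left degree α_l and right degree 0, so that against K_δ the σ-value
  -- on the right-hand side is 1 and σ(K_{α_l}, K_δ) is isolated.
  let v : ι → List (M ⊕ ι) := fun l => [Sum.inl (-StdData.a C s l), Sum.inr l]
  have hl : ∀ l, left C s (v l) = ρ l := fun l => by
    simp only [v, ρ, left_cons_inl, left_cons_inr]
    simp [left, sub_eq_neg_add]
  have hr : ∀ l, right C s (v l) = 0 := fun l => by
    simp only [v, right_cons_inl, right_cons_inr]
    simp [right]
  have hDv : ∀ l, D l (word k C s M (v l)) ≠ 0 := fun l => by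
    have e : word k C s M (v l) = K k C s M (-StdData.a C s l) * X k C s M l := by
      simp [v, word, gen]
    rw [e, (hD l).apply_mul, (hD l).apply_K, zero_mul, zero_add, char_K]
    exact mul_ne_zero (qpow_ne_zero k _) (hD l).apply_X_ne_zero
  have hK : ∀ δ : M, word k C s M [Sum.inl δ] = K k C s M δ := fun δ => by simp [word, gen]
  have hlK : ∀ δ : M, left C s [Sum.inl δ] = δ := fun δ => by simp [left]
  have hrK : ∀ δ : M, right C s [Sum.inl δ] = δ := fun δ => by simp [right]
  refine corresponds_of_roots ht ρ hρ (fun l δ => ?_) fun l δ => ?_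
  · have h1 := (twistedRule_apply ht (hD l)).1 (h l) (v l) [Sum.inl δ]
    rw [hl, hr, hK, hlK, hrK, (hD l).apply_K, onTorus_zero_left, counit_K, mul_zero, mul_zero,
      add_zero, add_zero, mul_one, mul_one, mul_one, mul_comm] at h1
    rw [mul_left_cancel₀ (hDv l) h1, C.form_psiMinus_root, hρ]
  · have h1 := (twistedRule_apply ht (hD l)).1 (h l) [Sum.inl δ] (v l)
    rw [hl, hr, hK, hlK, hrK, (hD l).apply_K, onTorus_zero_right, counit_K, zero_mul, zero_mul,
      zero_add, zero_add, mul_one, mul_one, mul_one, ← mul_assoc] at h1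
    have h2 := mul_right_cancel₀ (hDv l) h1
    refine mul_right_cancel₀ (qpow_ne_zero k (-C.form (μ l) δ)) (h2.trans ?_)
    rw [← qpow_add, sub_eq_add_neg, C.form_add_left, C.form_neg_left, C.form_psiMinus_root,
      hρ, C.twistForm_comm hΨ δ]
    congr 1
    ring

theorem rules_iff_corresponds (hΨ : Ψ.transpose = -Ψ) (hd : C.A.det ≠ 0 ∨ σ.IsToral)
    (hD : ∀ l, IsSkewDerivation (μ l) l (D l)) {P : AddSubgroup (ι → ℚ)}
    (hP : rootLattice ι ≤ P) :
    ((∀ γ : P, toConv σ.toFun * tens (charConv k C s M γ) (charConv k C s M γ) =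
        tens (charConv k C s M γ) (charConv k C s M γ) * toConv σ.toFun) ∧
      ∀ l, TwistedRule σ (μ l) (C.psiMinus Ψ (root l)) (D l)) ↔ σ.Corresponds Ψ := by
  constructor
  · rintro ⟨h1, h2⟩
    refine corresponds_of_twistedRule hΨ ?_ hD h2
    exact hd.elim (fun hA => isToral_of_commute_char hA fun i =>
      h1 ⟨root i, CartanDatum.root_mem hP i⟩) id
  · intro h
    exact ⟨fun γ => commute_char_of_isToral h.1 γ, fun l => twistedRule_of_corresponds hΨ h (hD l)⟩

end TwistedRule

/-! ### Rational toral cocycles. -/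

section RationalToral

variable {σ : TwoCocycle (stdOps k C s M)} {Ψ : Matrix ι ι ℚ}

/-- Since r ↦ q^r is injective, the values at simple roots recover every entry of the matrix S,
which then gives the required values on all of M. -/
theorem corresponds_iff_of_isRationalToral (hσ : σ.IsRationalToral) (hM : rootLattice ι ≤ M) :
    σ.Corresponds Ψ ↔ ∀ i j : ι, σ.onTorus ⟨root i, CartanDatum.root_mem hM i⟩
      ⟨root j, CartanDatum.root_mem hM j⟩ = qpow k (-(C.AQ.transpose * Ψ * C.AQ) i j) := by
  constructor
  · intro h i j
    rw [h.2 _ _ (Or.inl (CartanDatum.root_mem le_rfl i)), C.twistForm_root_root]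
  · intro h
    obtain ⟨ht, S, hS⟩ := hσ
    have e : S = -(C.AQ.transpose * Ψ * C.AQ) := by
      ext i j
      have h1 := h i j
      rw [hS] at h1
      simpa [root] using qpow_injective k h1
    refine ⟨ht, fun γ δ _ => ?_⟩
    rw [hS, e, CartanDatum.twistForm, Matrix.neg_mulVec, dotProduct_neg]

end RationalToral

/-! ### The antipode of a toral deformation. -/

section Antipode

variable {σ : TwoCocycle (stdOps k C s M)} {Ψ : Matrix ι ι ℚ}

theorem map_comul_word_left {V : Type*} [AddCommGroup V] [Module (Kq k) V]
    {u : Borel k C s M →ₗ[Kq k] Kq k} (hu : u ∘ₗ (toralProj k C s M).toLinearMap = u)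
    (f : Borel k C s M →ₗ[Kq k] V) (w : List (M ⊕ ι)) :
    TensorProduct.map u f ((stdOps k C s M).comul (word k C s M w)) =
      u (K k C s M (left C s w)) ⊗ₜ f (word k C s M w) := by
  rw [← TensorProduct.map_tmul]
  erw [← map_toralProj_left_comul w]
  nth_rewrite 1 [← hu]
  rw [← LinearMap.comp_id f, TensorProduct.map_comp, LinearMap.comp_id]
  rfl

theorem map_comul_word_right {V : Type*} [AddCommGroup V] [Module (Kq k) V]
    {u : Borel k C s M →ₗ[Kq k] Kq k} (hu : u ∘ₗ (toralProj k C s M).toLinearMap = u)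
    (f : Borel k C s M →ₗ[Kq k] V) (w : List (M ⊕ ι)) :
    TensorProduct.map f u ((stdOps k C s M).comul (word k C s M w)) =
      f (word k C s M w) ⊗ₜ u (K k C s M (right C s w)) := by
  rw [← TensorProduct.map_tmul]
  erw [← map_toralProj_right_comul w]
  nth_rewrite 1 [← hu]
  rw [← LinearMap.comp_id f, TensorProduct.map_comp, LinearMap.comp_id]
  rfl

theorem map_map_comul_comp_toralProj {τ : Borel k C s M ⊗[Kq k] Borel k C s M →ₗ[Kq k] Kq k}
    (hτ : τ ∘ₗ TensorProduct.map (toralProj k C s M).toLinearMap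
      (toralProj k C s M).toLinearMap = τ) {f g : Borel k C s M →ₗ[Kq k] Borel k C s M}
    (hf : f ∘ₗ (toralProj k C s M).toLinearMap = (toralProj k C s M).toLinearMap ∘ₗ f)
    (hg : g ∘ₗ (toralProj k C s M).toLinearMap = (toralProj k C s M).toLinearMap ∘ₗ g) :
    (τ ∘ₗ TensorProduct.map f g ∘ₗ (stdOps k C s M).comul) ∘ₗ
      (toralProj k C s M).toLinearMap =
    τ ∘ₗ TensorProduct.map f g ∘ₗ (stdOps k C s M).comul := by
  have h1 : (stdOps k C s M).comul ∘ₗ (toralProj k C s M).toLinearMap =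
      TensorProduct.map (toralProj k C s M).toLinearMap (toralProj k C s M).toLinearMap ∘ₗ
        (stdOps k C s M).comul := LinearMap.ext (comul_toralProj _)
  rw [LinearMap.comp_assoc, LinearMap.comp_assoc, h1, ← LinearMap.comp_assoc _ _
    (TensorProduct.map f g), ← TensorProduct.map_comp, hf, hg, TensorProduct.map_comp]
  nth_rewrite 2 [← hτ]
  rfl

/-- The functionals σ ∘ (id ⊗ S) ∘ Δ and σ⁻¹ ∘ (S ⊗ id) ∘ Δ factor through the torus, because S
commutes with the projection. Hence S_σ only rescales S on each word. -/
theorem deform_antipode_word (ht : σ.IsToral) (w : List (M ⊕ ι)) :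
    ((stdOps k C s M).deform σ).antipode (word k C s M w) =
      (σ.onTorus (left C s w) (-left C s w) *
        σ.inv (K k C s M (-right C s w) ⊗ₜ K k C s M (right C s w))) •
      (stdOps k C s M).antipode (word k C s M w) := by
  have hS : (stdOps k C s M).antipode ∘ₗ (toralProj k C s M).toLinearMap =
      (toralProj k C s M).toLinearMap ∘ₗ (stdOps k C s M).antipode :=
    LinearMap.ext (antipode_toralProj _)
  have hu := map_map_comul_comp_toralProj (isToral_iff.1 ht) (f := LinearMap.id) rfl hS
  have hv := map_map_comul_comp_toralProj (inv_toral ht) (g := LinearMap.id) hS rfl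
  have hK : ∀ γ, (stdOps k C s M).antipode (K k C s M γ) = K k C s M (-γ) := antipode_K _
  have hΔ : ∀ γ, (stdOps k C s M).comul (K k C s M γ) = K k C s M γ ⊗ₜ K k C s M γ := comul_K _
  simp only [HopfOps.deform, LinearMap.comp_apply, LinearEquiv.coe_coe]
  rw [map_comul_word_left hu]
  simp only [LinearMap.comp_apply, LinearEquiv.coe_coe]
  rw [map_comul_word_right hv]
  simp only [LinearMap.comp_apply, hΔ, TensorProduct.map_tmul, hK, LinearMap.id_apply,
    TensorProduct.lid_tmul, TensorProduct.rid_tmul, smul_smul]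
  rfl

theorem deform_antipode_eq (hΨ : Ψ.transpose = -Ψ) (hσ : σ.Corresponds Ψ) :
    ((stdOps k C s M).deform σ).antipode = (stdOps k C s M).antipode := by
  refine linearMap_ext fun w => ?_
  rw [deform_antipode_word hσ.1]
  have e : left C s w = (left C s w - right C s w) + right C s w := by abel
  have e' : -left C s w = -right C s w + -(left C s w - right C s w) := by abel
  have hβ := left_sub_right_mem (C := C) (s := s) w
  have h1 : σ.onTorus (left C s w) (-left C s w) =
      σ.onTorus (-right C s w) (right C s w) := by
    rw [onTorus_neg_self]
    nth_rewrite 1 [e]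
    rw [hσ.onTorus_add_left hβ, e', hσ.onTorus_add_right (by simpa using neg_mem hβ), ← mul_assoc,
      ← qpow_add]
    -- With β = left - right in Q, the exponent is the form at (β, right) plus (β, β) plus (right,
    -- β), and antisymmetry makes it zero.
    have e0 : -C.twistForm Ψ ((left C s w - right C s w : M) : ι → ℚ)
        ((-right C s w + -(left C s w - right C s w) : M) : ι → ℚ) +
        -C.twistForm Ψ (right C s w) ((-(left C s w - right C s w) : M) : ι → ℚ) = 0 := by
      rw [AddSubgroup.coe_add, C.twistForm_add_right]
      simp only [AddSubgroup.coe_neg, C.twistForm_neg_right]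
      rw [C.twistForm_self hΨ, C.twistForm_comm hΨ (right C s w)]
      ring
    rw [e0, qpow_zero, one_mul]
  rw [h1, onTorus_mul_inv, one_smul]

end Antipode

end QBorel

/-! ### Duality as an identity in a convolution algebra, checked on generators. -/

namespace QBorel

open WithConv Borel

section Abstract

variable {R : Type*} [CommRing R] {A : Type*} [Ring A] [Bialgebra R A]

section Module

variable {H : Type*} [AddCommGroup H] [Module R H]

/-- The linear extension of `x ⊗ y ↦ tens (f x) (f y)`. -/
def tensMap (f : H →ₗ[R] WithConv (A →ₗ[R] R)) :
    H ⊗[R] H →ₗ[R] WithConv (A ⊗[R] A →ₗ[R] R) :=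
  TensorProduct.lift (LinearMap.mk₂ R (fun x y => tens (f x) (f y))
    (fun x x' y => by rw [map_add, tens_add_left])
    (fun c x y => by rw [map_smul, tens_smul_left])
    (fun x y y' => by rw [map_add, tens_add_right])
    (fun c x y => by rw [map_smul, tens_smul_right]))

@[simp]
theorem tensMap_tmul (f : H →ₗ[R] WithConv (A →ₗ[R] R)) (x y : H) :
    tensMap f (x ⊗ₜ y) = tens (f x) (f y) := rfl

/-- A bilinear form as a map into the convolution algebra of the second factor. -/
def toDual (η : H →ₗ[R] A →ₗ[R] R) : H →ₗ[R] WithConv (A →ₗ[R] R) :=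
  (WithConv.linearEquiv R (A →ₗ[R] R)).symm.toLinearMap ∘ₗ η

@[simp]
theorem toDual_apply (η : H →ₗ[R] A →ₗ[R] R) (h : H) (x : A) : toDual η h x = η h x := rfl

theorem tensMap_toDual_tmul (η : H →ₗ[R] A →ₗ[R] R) (u : H ⊗[R] H) (x y : A) :
    tensMap (toDual η) u (x ⊗ₜ y) =
      LinearMap.mul' R R (TensorProduct.map (η.flip x) (η.flip y) u) := by
  induction u with
  | zero => simp
  | tmul a b => simp
  | add u v hu hv => simp only [map_add, ofConv_add, LinearMap.add_apply, hu, hv]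

theorem comulDualMul_iff {O₁ : HopfOps R H} {O₂ : HopfOps R A} {η : H →ₗ[R] A →ₗ[R] R} :
    ComulDualMul O₁ O₂ η ↔
      ∀ h, toConv ((toDual η h).ofConv ∘ₗ O₂.mul) = tensMap (toDual η) (O₁.comul h) := by
  refine forall_congr' fun h => ⟨fun H => ?_, fun H x y => ?_⟩
  · refine WithConv.ext (TensorProduct.ext' fun x y => ?_)
    rw [tensMap_toDual_tmul]
    exact H x y
  · rw [← tensMap_toDual_tmul, ← H]
    rfl

/-- After flipping η this duality has the shape of the other one, with the coproduct replaced by its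
opposite; both sides of the theorem then reduce to the same computation. -/
theorem mulDualComul_iff {O₁ : HopfOps R A} {O₂ : HopfOps R H} {η : A →ₗ[R] H →ₗ[R] R} :
    MulDualComul O₁ O₂ η ↔
      ∀ h, toConv ((toDual η.flip h).ofConv ∘ₗ O₁.mul) =
        tensMap (toDual η.flip) (TensorProduct.comm R H H (O₂.comul h)) := by
  have key : ∀ (u : H ⊗[R] H) (x y : A), tensMap (toDual η.flip) (TensorProduct.comm R H H u)
      (x ⊗ₜ y) = LinearMap.mul' R R (TensorProduct.map (η y) (η x) u) := by
    intro u x y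
    rw [tensMap_toDual_tmul, LinearMap.flip_flip]
    induction u with
    | zero => simp
    | tmul a b => simp [mul_comm]
    | add u v hu hv => simp only [map_add, hu, hv]
  constructor
  · intro H h
    refine WithConv.ext (TensorProduct.ext' fun x y => ?_)
    rw [key]
    exact H x y h
  · intro H x y h
    rw [← key, ← H]
    rfl

theorem toDual_mul_of_mulDualComul {B : Type*} [Ring B] [Algebra R B] {O₁ : HopfOps R B}
    {O₂ : HopfOps R A} {η : B →ₗ[R] A →ₗ[R] R} (h : MulDualComul O₁ O₂ η)
    (hm : O₁.mul = LinearMap.mul' R B) (hc : O₂.comul = Coalgebra.comul) (x y : B) :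
    toDual η (x * y) = toDual η y * toDual η x := by
  refine WithConv.ext (LinearMap.ext fun z => ?_)
  have h1 := h x y z
  rw [hm, hc] at h1
  exact h1

theorem toDual_mul_of_comulDualMul {B : Type*} [Ring B] [Algebra R B] {O₁ : HopfOps R A}
    {O₂ : HopfOps R B} {η : A →ₗ[R] B →ₗ[R] R} (h : ComulDualMul O₁ O₂ η)
    (hm : O₂.mul = LinearMap.mul' R B) (hc : O₁.comul = Coalgebra.comul) (x y : B) :
    toDual η.flip (x * y) = toDual η.flip x * toDual η.flip y := by
  refine WithConv.ext (LinearMap.ext fun z => ?_)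
  have h1 := h z x y
  rw [hm, hc] at h1
  exact h1

end Module

theorem tensMap_mul {B : Type*} [Ring B] [Algebra R B] {f : B →ₗ[R] WithConv (A →ₗ[R] R)}
    (hf : ∀ x y, f (x * y) = f x * f y) (u v : B ⊗[R] B) :
    tensMap f (u * v) = tensMap f u * tensMap f v := by
  induction u with
  | zero => simp
  | add u u' hu hu' => rw [add_mul, map_add, map_add, hu, hu', add_mul]
  | tmul x y =>
    induction v with
    | zero => simp
    | add v v' hv hv' => rw [mul_add, map_add, map_add, hv, hv', mul_add]
    | tmul x' y' => simp [hf, tens_mul]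

theorem tensMap_mul_rev {B : Type*} [Ring B] [Algebra R B] {f : B →ₗ[R] WithConv (A →ₗ[R] R)}
    (hf : ∀ x y, f (x * y) = f y * f x) (u v : B ⊗[R] B) :
    tensMap f (u * v) = tensMap f v * tensMap f u := by
  induction u with
  | zero => simp
  | add u u' hu hu' => rw [add_mul, map_add, map_add, hu, hu', mul_add]
  | tmul x y =>
    induction v with
    | zero => simp
    | add v v' hv hv' => rw [mul_add, map_add, map_add, hv, hv', add_mul]
    | tmul x' y' => simp [hf, tens_mul]

end Abstract

variable {k : Type*} [Field k] {ι : Type*} [Fintype ι] [DecidableEq ι] {C : CartanDatum ι}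
  {s : ℤˣ} {M : AddSubgroup (ι → ℚ)} [StdData C s M]
  {s' : ℤˣ} {P : AddSubgroup (ι → ℚ)}

/-- Pulling back along the product and applying f ⊗ f to Δ are both multiplicative, or both
antimultiplicative, in the argument. So the elements on which u intertwines them form a subalgebra.
-/
theorem mul_pullMul_eq_iff {f : Borel k C s' P →ₗ[Kq k] WithConv (Borel k C s M →ₗ[Kq k] Kq k)}
    (h1 : f 1 = 1) (hf : (∀ x y, f (x * y) = f x * f y) ∨ ∀ x y, f (x * y) = f y * f x)
    (Δ : Borel k C s' P →ₐ[Kq k] Borel k C s' P ⊗[Kq k] Borel k C s' P)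
    (u : WithConv (Borel k C s M ⊗[Kq k] Borel k C s M →ₗ[Kq k] Kq k)) :
    (∀ h, u * pullMul (Kq k) (Borel k C s M) (f h) = tensMap f (Δ h) * u) ↔
      (∀ γ, u * pullMul (Kq k) (Borel k C s M) (f (K k C s' P γ)) =
        tensMap f (Δ (K k C s' P γ)) * u) ∧
      ∀ l, u * pullMul (Kq k) (Borel k C s M) (f (X k C s' P l)) =
        tensMap f (Δ (X k C s' P l)) * u := by
  refine ⟨fun h => ⟨fun γ => h _, fun l => h _⟩, fun h x => ?_⟩
  induction x using induction_on with
  | hc c =>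
    rw [Algebra.algebraMap_eq_smul_one, map_smul, map_smul, map_smul, map_smul, h1, map_one,
      map_one, Algebra.TensorProduct.one_def, tensMap_tmul, h1, tens_one_one, smul_mul_assoc,
      mul_smul_comm, one_mul, mul_one]
  | hK γ => exact h.1 γ
  | hX i => exact h.2 i
  | hmul x y hx hy =>
    rcases hf with hf | hf
    · rw [hf, map_mul, map_mul, tensMap_mul hf, ← mul_assoc, hx, mul_assoc, hy, mul_assoc]
    · rw [hf, map_mul, map_mul, tensMap_mul_rev hf, ← mul_assoc, hy, mul_assoc, hx, mul_assoc]
  | hadd x y hx hy => rw [map_add, map_add, map_add, map_add, mul_add, add_mul, hx, hy]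

theorem dual_deform_iff (σ : TwoCocycle (stdOps k C s M))
    {f : Borel k C s' P →ₗ[Kq k] WithConv (Borel k C s M →ₗ[Kq k] Kq k)} (h1 : f 1 = 1)
    (hf : (∀ x y, f (x * y) = f x * f y) ∨ ∀ x y, f (x * y) = f y * f x)
    (Δ : Borel k C s' P →ₐ[Kq k] Borel k C s' P ⊗[Kq k] Borel k C s' P) :
    (∀ h, toConv ((f h).ofConv ∘ₗ ((stdOps k C s M).deform σ).mul) = tensMap f (Δ h)) ↔
      (∀ γ, toConv σ.toFun * pullMul (Kq k) (Borel k C s M) (f (K k C s' P γ)) =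
        tensMap f (Δ (K k C s' P γ)) * toConv σ.toFun) ∧
      ∀ l, toConv σ.toFun * pullMul (Kq k) (Borel k C s M) (f (X k C s' P l)) =
        tensMap f (Δ (X k C s' P l)) * toConv σ.toFun := by
  have hu : toConv σ.toFun * toConv σ.inv = 1 := cocycle_mul_inv rfl rfl σ
  have hu' : toConv σ.inv * toConv σ.toFun = 1 := cocycle_inv_mul rfl rfl σ
  rw [← mul_pullMul_eq_iff h1 hf]
  refine forall_congr' fun h => ?_
  rw [pullMul_deform rfl rfl]
  constructor
  · intro e
    rw [← e, ← mul_assoc, mul_assoc, hu', mul_one]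
  · intro e
    rw [← mul_assoc, e, mul_assoc, hu, mul_one]

/-- Common core of the two cases: f is η(x, ·), which reverses products, or η(·, y), which preserves
them. The K_γ give commutation of σ with characters and the X_l give `TwistedRule`. -/
theorem dual_deform_iff_corresponds {σ : TwoCocycle (stdOps k C s M)} {Ψ : Matrix ι ι ℚ}
    (hΨ : Ψ.transpose = -Ψ) (hd : C.A.det ≠ 0 ∨ σ.IsToral)
    {f : Borel k C s' P →ₗ[Kq k] WithConv (Borel k C s M →ₗ[Kq k] Kq k)}
    (hf : (∀ x y, f (x * y) = f x * f y) ∨ ∀ x y, f (x * y) = f y * f x)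
    (hP : rootLattice ι ≤ P) {μ : ι → ι → ℚ} (hK : ∀ γ, f (K k C s' P γ) = charConv k C s M γ)
    (hX : ∀ l, IsSkewDerivation (μ l) l (f (X k C s' P l)))
    (Δ : Borel k C s' P →ₐ[Kq k] Borel k C s' P ⊗[Kq k] Borel k C s' P)
    (hΔK : ∀ γ, Δ (K k C s' P γ) = K k C s' P γ ⊗ₜ K k C s' P γ) {a b : ι → P}
    (hΔX : ∀ l, Δ (X k C s' P l) = X k C s' P l ⊗ₜ K k C s' P (a l) +
      K k C s' P (b l) ⊗ₜ X k C s' P l)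
    (ha : ∀ l, (a l : ι → ℚ) = C.psiMinus Ψ (root l))
    (hb : ∀ l, (b l : ι → ℚ) = μ l - C.psiMinus Ψ (root l)) :
    (∀ h, toConv ((f h).ofConv ∘ₗ ((stdOps k C s M).deform σ).mul) = tensMap f (Δ h)) ↔
      σ.Corresponds Ψ := by
  have h1 : f 1 = 1 := by
    rw [← K_zero, hK, AddSubgroup.coe_zero, charConv_zero]
  rw [dual_deform_iff σ h1 hf, ← rules_iff_corresponds hΨ hd hX hP]
  refine and_congr (forall_congr' fun γ => ?_) (forall_congr' fun l => ?_)
  · rw [hΔK, tensMap_tmul, hK, pullMul_charConv]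
  · rw [hΔX, map_add, tensMap_tmul, tensMap_tmul, hK, hK, TwistedRule, ha, hb]

theorem eq_charConv {f : WithConv (Borel k C s M →ₗ[Kq k] Kq k)} {γ : ι → ℚ}
    (hmul : pullMul (Kq k) (Borel k C s M) f = tens f f) (h1 : f 1 = 1)
    (hK : ∀ δ, f (K k C s M δ) = qpow k (-C.form γ δ)) (hX : ∀ i, f (X k C s M i) = 0) :
    f = charConv k C s M γ := by
  have e : AlgHom.ofLinearMap f.ofConv h1 (fun x y => congrArg (fun φ => φ (x ⊗ₜ y)) hmul) =
      char k C s M γ :=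
    algHom_ext (fun δ => (hK δ).trans (char_K k C s M γ δ).symm)
      (fun i => (hX i).trans (char_X k C s M γ i).symm)
  exact WithConv.ext (congrArg AlgHom.toLinearMap e)

end QBorel

/-! ### Construction of the skew derivations and their Serre relations. -/

namespace QBorel

open WithConv Borel

section Serre

variable {F : Type*} [Field F] {R : Type*} [Ring R] [Algebra F R]

/-- Write the Serre expression as an iterated q-commutator. Acting on x, the element Y q-commutes at
each step with exactly the factor used there and drops out; acting on y, the same happens to X once
v and c are inverted. No mixed terms remain. -/
theorem serre_add_add {v : F} (h : Generic v) {c : F} (hc0 : c ≠ 0) {m : ℕ} (hc : c * v ^ m = v)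
    {X Y x y : R} (hYX : Y * X = v ^ 2 • (X * Y)) (hYx : Y * x = c • (x * Y))
    (hyX : y * X = c • (X * y)) :
    serre v m (X + Y) (x + y) = serre v m X x + serre v m Y y := by
  have add : serre v m (X + Y) (x + y) = serre v m (X + Y) x + serre v m (X + Y) y := by
    simp [serre, mul_add, add_mul, smul_add, Finset.sum_add_distrib]
  have k1 : ∀ t, Y * adq v c X x t = (c * v ^ (2 * t)) • (adq v c X x t * Y) := by
    intro t
    rw [mul_adq v c hYX hYx t, ← pow_mul, mul_comm c]
  have k2 : ∀ t, adq v c (X + Y) x t = adq v c X x t := by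
    intro t
    induction t with
    | zero => rfl
    | succ t ih =>
      rw [adq, ih, adq, add_mul, mul_add, k1 t, smul_add]
      abel
  have k3 : ∀ t, adq v⁻¹ c⁻¹ Y y t * X = (c * v ^ (2 * t)) • (X * adq v⁻¹ c⁻¹ Y y t) := by
    intro t
    rw [adq_mul v⁻¹ c⁻¹ hYX hyX t, ← pow_mul, mul_comm c]
  have k4 : ∀ t, adq v⁻¹ c⁻¹ (X + Y) y t = adq v⁻¹ c⁻¹ Y y t := by
    intro t
    induction t with
    | zero => rfl
    | succ t ih =>
      have e : c⁻¹ * v⁻¹ ^ (2 * t) * (c * v ^ (2 * t)) = 1 := by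
        have := h.1
        simp only [inv_pow]
        field_simp
      rw [adq, ih, adq, add_mul, mul_add, k3 t, smul_add, smul_smul, e, one_smul]
      abel
  have hc' : c⁻¹ * v⁻¹ ^ m = v⁻¹ := by
    rw [inv_pow, ← mul_inv, hc]
  rw [add, ← adq_eq_serre h hc, k2, adq_eq_serre h hc, ← serre_inv v m (X + Y) y,
    ← adq_eq_serre h.inv hc', k4, adq_eq_serre h.inv hc', serre_inv]

theorem serre_mul_left (v : F) (m : ℕ) {G H x y : R} (hGH : Commute G H) (hGx : Commute G x)
    (hGy : Commute G y) (hHx : Commute H x) :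
    serre v m (G * x) (H * y) = G ^ m * H * serre v m x y := by
  rw [serre, serre, Finset.mul_sum]
  refine Finset.sum_congr rfl fun l hl => ?_
  rw [mul_smul_comm]
  congr 1
  obtain ⟨j, rfl⟩ := Nat.exists_eq_add_of_le (Nat.lt_succ_iff.1 (Finset.mem_range.1 hl))
  rw [Nat.add_sub_cancel_left, hGx.mul_pow, hGx.mul_pow, add_comm l j, pow_add]
  have h1 : y * G ^ l = G ^ l * y := (hGy.pow_left l).eq.symm
  have h2 : x ^ j * G ^ l = G ^ l * x ^ j := (hGx.pow_pow l j).eq.symm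
  have h3 : x ^ j * H = H * x ^ j := (hHx.pow_right j).eq.symm
  have h4 : H * G ^ l = G ^ l * H := (hGH.pow_left l).eq.symm
  calc G ^ j * x ^ j * (H * y) * (G ^ l * x ^ l)
      = G ^ j * (x ^ j * H) * (y * G ^ l) * x ^ l := by simp only [mul_assoc]
    _ = G ^ j * H * (x ^ j * G ^ l) * y * x ^ l := by rw [h1, h3]; simp only [mul_assoc]
    _ = G ^ j * (H * G ^ l) * x ^ j * y * x ^ l := by rw [h2]; simp only [mul_assoc]
    _ = G ^ j * G ^ l * H * (x ^ j * y * x ^ l) := by rw [h4]; simp only [mul_assoc]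

theorem serre_eq_zero_of_mul_eq_zero (v : F) {m : ℕ} (hm : 0 < m) {x y : R} (hxy : x * y = 0)
    (hyx : y * x = 0) : serre v m x y = 0 := by
  refine Finset.sum_eq_zero fun l _ => ?_
  rcases l with _ | l
  · obtain ⟨n, rfl⟩ := Nat.exists_eq_succ_of_ne_zero hm.ne'
    rw [Nat.sub_zero, pow_succ, mul_assoc (x ^ n), hxy, mul_zero, zero_mul, smul_zero]
  · rw [pow_succ' x l, mul_assoc, ← mul_assoc y, hyx, zero_mul, mul_zero, smul_zero]

end Serre

section Derivation

variable (k : Type*) [Field k] {ι : Type*} [Fintype ι] [DecidableEq ι] (C : CartanDatum ι)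
  (s : ℤˣ) (M : AddSubgroup (ι → ℚ))

theorem cartan_toNat_pos {i j : ι} (hij : i ≠ j) : 0 < (1 - C.A i j).toNat := by
  have := C.nonpos i j hij
  omega

theorem strictUpper_mul_strictUpper {F : Type*} [Field F] (a b : F) :
    !![0, a; 0, 0] * !![0, b; 0, 0] = (0 : Matrix (Fin 2) (Fin 2) F) := by
  simp [← Matrix.ext_iff, Fin.forall_fin_two]

/-- The representation by upper triangular matrices with diagonal characters
`K_δ ↦ q^{s(α_l, δ)}` and `ε`. -/
def triangular (l : ι) (c : Kq k) : Borel k C s M →ₐ[Kq k] Matrix (Fin 2) (Fin 2) (Kq k) :=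
  lift (fun δ => !![qpow k (-C.form (-((s : ℤ) : ℚ) • root l) δ), 0; 0, 1])
    (fun j => !![0, if j = l then c else 0; 0, 0])
    (by
      rw [AddSubgroup.coe_zero, C.form_zero_right, neg_zero, qpow_zero, Matrix.one_fin_two])
    (fun γ δ => by
      rw [AddSubgroup.coe_add, C.form_add_right, neg_add, qpow_add, Matrix.mul_fin_two]
      simp)
    (fun γ j => by
      rw [Matrix.mul_fin_two, Matrix.mul_fin_two]
      by_cases h : j = l
      · subst h
        -- Characters carry the exponent -(μ, γ), so μ = -s α_j reproduces the exponent s(γ, α_j) of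
        -- the commutation relation for both signs.
        have e : -C.form (-((s : ℤ) : ℚ) • root j) γ = (s : ℤ) * C.form γ (root j) := by
          rcases Int.units_eq_one_or s with rfl | rfl
          · simp [C.form_neg_left, C.form_comm γ]
          · simp [C.form_comm γ]
        rw [e]
        simp [Matrix.smul_of]
      · simp [h])
    (fun i j hij => serre_eq_zero_of_mul_eq_zero _ (cartan_toNat_pos C hij)
      (strictUpper_mul_strictUpper _ _) (strictUpper_mul_strictUpper _ _))

variable {k C s M}

theorem triangular_K (l : ι) (c : Kq k) (δ : M) : triangular k C s M l c (K k C s M δ) =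
    !![qpow k (-C.form (-((s : ℤ) : ℚ) • root l) δ), 0; 0, 1] := lift_K _ _ _ _ _

theorem triangular_X (l : ι) (c : Kq k) (j : ι) : triangular k C s M l c (X k C s M j) =
    !![0, if j = l then c else 0; 0, 0] := lift_X _ _ _ _ _

theorem triangular_diag (l : ι) (c : Kq k) (x : Borel k C s M) :
    triangular k C s M l c x 0 0 = char k C s M (-((s : ℤ) : ℚ) • root l) x ∧
      triangular k C s M l c x 1 0 = 0 ∧ triangular k C s M l c x 1 1 = counit k C s M x := by
  induction x using induction_on with
  | hc c => simp [Matrix.algebraMap_matrix_apply]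
  | hK γ => simp [triangular_K]
  | hX i => simp [triangular_X]
  | hmul x y hx hy => simp [Matrix.mul_apply, hx, hy]
  | hadd x y hx hy => simp [hx, hy]

variable (k C s M) in
/-- The skew derivation dual to the root vector `X_l`. -/
def skewDer (l : ι) (c : Kq k) : WithConv (Borel k C s M →ₗ[Kq k] Kq k) :=
  toConv (Matrix.entryLinearMap (Kq k) (Kq k) 0 1 ∘ₗ (triangular k C s M l c).toLinearMap)

theorem skewDer_apply (l : ι) (c : Kq k) (x : Borel k C s M) :
    skewDer k C s M l c x = triangular k C s M l c x 0 1 := rfl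

theorem skewDer_X (l : ι) (c : Kq k) (j : ι) :
    skewDer k C s M l c (X k C s M j) = if j = l then c else 0 := by
  simp [skewDer_apply, triangular_X]

theorem skewDer_K (l : ι) (c : Kq k) (γ : M) : skewDer k C s M l c (K k C s M γ) = 0 := by
  simp [skewDer_apply, triangular_K]

variable [StdData C s M]

/-- The corner entry of a product of upper triangular matrices obeys this rule with respect to the
two diagonal characters. -/
theorem isSkewDerivation_skewDer (l : ι) {c : Kq k} (hc : c ≠ 0) :
    IsSkewDerivation (-((s : ℤ) : ℚ) • root l) l (skewDer k C s M l c) where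
  mul := by
    refine WithConv.ext (TensorProduct.ext' fun x y => ?_)
    rw [pullMul_tmul, ofConv_add, LinearMap.add_apply, tens_tmul, tens_tmul, charConv_apply,
      skewDer_apply, skewDer_apply, skewDer_apply, map_mul, Matrix.mul_apply, Fin.sum_univ_two,
      (triangular_diag l c x).1, (triangular_diag l c y).2.2, add_comm]
    rfl
  apply_K := skewDer_K l c
  apply_X_of_ne j hj := by rw [skewDer_X, if_neg hj]
  apply_X_ne_zero := by rwa [skewDer_X, if_pos rfl]

end Derivation

section Commutation

variable {k : Type*} [Field k] {ι : Type*} [Fintype ι] [DecidableEq ι] {C : CartanDatum ι}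
  {s : ℤˣ} {M : AddSubgroup (ι → ℚ)} [StdData C s M]

theorem char_comp_toralProj (μ : ι → ℚ) :
    (char k C s M μ).toLinearMap ∘ₗ (toralProj k C s M).toLinearMap =
      (char k C s M μ).toLinearMap := LinearMap.ext (char_toralProj k C s M μ)

theorem charConv_mul_word (μ : ι → ℚ) (f : WithConv (Borel k C s M →ₗ[Kq k] Kq k))
    (w : List (M ⊕ ι)) : (charConv k C s M μ * f) (word k C s M w) =
      qpow k (-C.form μ (left C s w)) * f (word k C s M w) := by
  have h := map_comul_word_left (char_comp_toralProj μ) f.ofConv w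
  refine (congrArg (LinearMap.mul' (Kq k) (Kq k)) h).trans ?_
  simp

theorem mul_charConv_word (μ : ι → ℚ) (f : WithConv (Borel k C s M →ₗ[Kq k] Kq k))
    (w : List (M ⊕ ι)) : (f * charConv k C s M μ) (word k C s M w) =
      f (word k C s M w) * qpow k (-C.form μ (right C s w)) := by
  have h := map_comul_word_right (char_comp_toralProj μ) f.ofConv w
  refine (congrArg (LinearMap.mul' (Kq k) (Kq k)) h).trans ?_
  simp

theorem charConv_add (μ ν : ι → ℚ) :
    charConv k C s M (μ + ν) = charConv k C s M μ * charConv k C s M ν := by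
  refine WithConv.ext (linearMap_ext fun w => ?_)
  rw [charConv_mul_word, charConv_apply, charConv_apply, char_word, char_word, C.form_add_left,
    neg_add, qpow_add, mul_assoc]

/-- D is supported on words whose left degree exceeds the right one by α_l, and χ_ν reads the left
degree on one side and the right degree on the other. -/
theorem IsSkewDerivation.charConv_mul {μ : ι → ℚ} {l : ι}
    {D : WithConv (Borel k C s M →ₗ[Kq k] Kq k)} (hD : IsSkewDerivation μ l D) (ν : ι → ℚ) :
    charConv k C s M ν * D = qpow k (-C.form ν (root l)) • (D * charConv k C s M ν) := by
  refine WithConv.ext (linearMap_ext fun w => ?_)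
  rw [charConv_mul_word, ofConv_smul, LinearMap.smul_apply, mul_charConv_word, smul_eq_mul]
  by_cases hw : D (word k C s M w) = 0
  · simp [hw]
  have e : ((left C s w : M) : ι → ℚ) = root l + right C s w := by
    rw [← hD.degree hw, AddSubgroup.coe_sub, sub_add_cancel]
  rw [e, C.form_add_right, neg_add, qpow_add]
  ring

theorem convMul_K (f g : WithConv (Borel k C s M →ₗ[Kq k] Kq k)) (γ : M) :
    (f * g) (K k C s M γ) = f (K k C s M γ) * g (K k C s M γ) := by
  have h : (Coalgebra.comul (K k C s M γ) : _ ⊗[Kq k] _) = _ := comul_K _ γ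
  rw [LinearMap.convMul_apply, h]
  simp

theorem convMul_X (f g : WithConv (Borel k C s M →ₗ[Kq k] Kq k)) (i : ι) :
    (f * g) (X k C s M i) = f (X k C s M i) * g (K k C s M (StdData.a C s i)) +
      f (K k C s M (StdData.b C s i)) * g (X k C s M i) := by
  have h : (Coalgebra.comul (X k C s M i) : _ ⊗[Kq k] _) = _ := comul_X _ i
  rw [LinearMap.convMul_apply, h]
  simp

variable (k C s M) in
/-- Evaluation at a toral element, as a character of the convolution algebra. -/
def evalK (γ : M) : WithConv (Borel k C s M →ₗ[Kq k] Kq k) →ₐ[Kq k] Kq k :=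
  AlgHom.ofLinearMap
    { toFun := fun f => f (K k C s M γ)
      map_add' := fun _ _ => rfl
      map_smul' := fun _ _ => rfl }
    (counit_K γ) (fun f g => convMul_K f g γ)

theorem evalK_apply (γ : M) (f : WithConv (Borel k C s M →ₗ[Kq k] Kq k)) :
    evalK k C s M γ f = f (K k C s M γ) := rfl

variable (k C s M) in
/-- Evaluation at the matrix coalgebra of a root vector. -/
def evalX (i : ι) : WithConv (Borel k C s M →ₗ[Kq k] Kq k) →ₐ[Kq k]
    Matrix (Fin 2) (Fin 2) (Kq k) :=
  AlgHom.ofLinearMap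
    { toFun := fun f => !![f (K k C s M (StdData.b C s i)), f (X k C s M i); 0,
        f (K k C s M (StdData.a C s i))]
      map_add' := fun _ _ => by
        ext i j
        fin_cases i <;> fin_cases j <;> simp
      map_smul' := fun _ _ => by
        ext i j
        fin_cases i <;> fin_cases j <;> simp }
    (by
      have h : ∀ γ, (1 : WithConv (Borel k C s M →ₗ[Kq k] Kq k)) (K k C s M γ) = 1 := counit_K
      have h' : ∀ i, (1 : WithConv (Borel k C s M →ₗ[Kq k] Kq k)) (X k C s M i) = 0 := counit_X
      change !![_, _; 0, _] = (1 : Matrix (Fin 2) (Fin 2) (Kq k))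
      rw [h, h, h', Matrix.one_fin_two])
    (fun f g => by
      change !![_, _; 0, _] = !![_, _; 0, _] * !![_, _; 0, _]
      rw [convMul_K, convMul_K, convMul_X, Matrix.mul_fin_two]
      simp [add_comm])

theorem evalX_apply (i : ι) (f : WithConv (Borel k C s M →ₗ[Kq k] Kq k)) :
    evalX k C s M i f = !![f (K k C s M (StdData.b C s i)), f (X k C s M i); 0,
        f (K k C s M (StdData.a C s i))] := rfl

variable (k C s M) in
/-- The algebra map `f ↦ f ⊗ 1` of convolution algebras. -/
def tensLeft : WithConv (Borel k C s M →ₗ[Kq k] Kq k) →ₐ[Kq k]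
    WithConv (Borel k C s M ⊗[Kq k] Borel k C s M →ₗ[Kq k] Kq k) :=
  AlgHom.ofLinearMap
    { toFun := fun f => tens f 1
      map_add' := fun _ _ => tens_add_left _ _ _
      map_smul' := fun _ _ => tens_smul_left _ _ _ }
    tens_one_one (fun f g => by
      rw [LinearMap.coe_mk, AddHom.coe_mk, tens_mul, one_mul])

variable (k C s M) in
/-- The algebra map `f ↦ 1 ⊗ f` of convolution algebras. -/
def tensRight : WithConv (Borel k C s M →ₗ[Kq k] Kq k) →ₐ[Kq k]
    WithConv (Borel k C s M ⊗[Kq k] Borel k C s M →ₗ[Kq k] Kq k) :=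
  AlgHom.ofLinearMap
    { toFun := fun f => tens 1 f
      map_add' := fun _ _ => tens_add_right _ _ _
      map_smul' := fun _ _ => tens_smul_right _ _ _ }
    tens_one_one (fun f g => by
      rw [LinearMap.coe_mk, AddHom.coe_mk, tens_mul, one_mul])

theorem tensLeft_apply (f : WithConv (Borel k C s M →ₗ[Kq k] Kq k)) :
    tensLeft k C s M f = tens f 1 := rfl

theorem tensRight_apply (f : WithConv (Borel k C s M →ₗ[Kq k] Kq k)) :
    tensRight k C s M f = tens 1 f := rfl

theorem commute_tensLeft_tensRight (f g : WithConv (Borel k C s M →ₗ[Kq k] Kq k)) :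
    Commute (tensLeft k C s M f) (tensRight k C s M g) := by
  change tens f 1 * tens 1 g = tens 1 g * tens f 1
  rw [tens_mul, tens_mul, one_mul, one_mul, mul_one, mul_one]

theorem tens_eq_mul (f g : WithConv (Borel k C s M →ₗ[Kq k] Kq k)) :
    tens f g = tensLeft k C s M f * tensRight k C s M g := by
  rw [tensLeft_apply, tensRight_apply, tens_mul, one_mul, mul_one]

/-- A skew primitive functional that vanishes on the generators is zero. -/
theorem eq_zero_of_pullMul {u φ : WithConv (Borel k C s M →ₗ[Kq k] Kq k)}
    (h : pullMul (Kq k) (Borel k C s M) u = tens u 1 + tens φ u)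
    (hK : ∀ γ, u (K k C s M γ) = 0) (hX : ∀ i, u (X k C s M i) = 0) : u = 0 := by
  refine WithConv.ext (LinearMap.ext fun x => ?_)
  induction x using induction_on with
  | hc c =>
    rw [Algebra.algebraMap_eq_smul_one, map_smul, ← K_zero, hK, smul_zero]
    rfl
  | hK γ => exact hK γ
  | hX i => exact hX i
  | hmul x y hx hy =>
    have h1 := congrArg (fun φ => φ (x ⊗ₜ y)) h
    simp only [pullMul_tmul, ofConv_add, LinearMap.add_apply, tens_tmul] at h1
    rw [hx, hy] at h1
    simpa using h1
  | hadd x y hx hy =>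
    rw [map_add, hx, hy]
    simp

/-- The pullbacks of D and E along the product are sums of two q-commuting terms, so `serre_add_add`
makes the Serre expression skew primitive; it vanishes on generators and is therefore zero. -/
theorem serre_skewDerivation {i j : ι} (hij : i ≠ j)
    {D E : WithConv (Borel k C s M →ₗ[Kq k] Kq k)}
    (hD : IsSkewDerivation (root i) i D) (hE : IsSkewDerivation (root j) j E) :
    serre (qpow k (C.d i)) (1 - C.A i j).toNat D E = 0 := by
  have hd : (C.d i : ℚ) ≠ 0 := by exact_mod_cast (C.d_pos i).ne'
  -- The characters introduce q to the power minus the form, so the commutation factors are powers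
  -- of q_i⁻¹; the Serre expression itself is unchanged under inversion of v.
  set v := (qpow k (C.d i))⁻¹ with hv
  set m := (1 - C.A i j).toNat with hm
  have hvg : Generic v := (generic_qpow k hd).inv
  have hvq : v = qpow k (-C.d i) := by rw [hv, qpow_neg]
  set c := qpow k (-C.form (root i) (root j)) with hc
  rw [← serre_inv]
  have hone : C.AQ i i = 2 := by simp [CartanDatum.AQ, C.diag]
  have key := serre_add_add hvg (c := c) (m := m) (qpow_ne_zero k _)
    (by
      rw [hvq, hc, qpow_pow, ← qpow_add, C.form_root_root, toNat_spec hij]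
      congr 1
      ring)
    (X := tens D 1) (Y := tens (charConv k C s M (root i)) D) (x := tens E 1)
    (y := tens (charConv k C s M (root j)) E)
    (by
      rw [tens_mul, tens_mul, hD.charConv_mul, mul_one, one_mul, tens_smul_left, hvq, qpow_pow,
        C.form_root_root, hone]
      congr 2
      push_cast
      ring)
    (by rw [tens_mul, tens_mul, hE.charConv_mul, mul_one, one_mul, tens_smul_left])
    (by
      rw [tens_mul, tens_mul, hD.charConv_mul, mul_one, one_mul, tens_smul_left,
        C.form_root_symm])
  have e1 : serre v m (tens D 1) (tens E 1) = tens (serre v m D E) 1 :=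
    (map_serre (tensLeft k C s M) v m D E).symm
  have hcc : ∀ μ ν, Commute (charConv k C s M μ) (charConv k C s M ν) := fun μ ν => by
    rw [commute_iff_eq, ← charConv_add, ← charConv_add, add_comm]
  have e2 : serre v m (tens (charConv k C s M (root i)) D) (tens (charConv k C s M (root j)) E) =
      tens (charConv k C s M (root i) ^ m * charConv k C s M (root j)) (serre v m D E) := by
    rw [tens_eq_mul, tens_eq_mul, serre_mul_left v m ((hcc _ _).map _)
      (commute_tensLeft_tensRight _ _) (commute_tensLeft_tensRight _ _)
      (commute_tensLeft_tensRight _ _), ← map_serre, ← map_pow, ← map_mul, ← tens_eq_mul]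
  have hmp : 0 < m := cartan_toNat_pos C hij
  refine eq_zero_of_pullMul (φ := charConv k C s M (root i) ^ m * charConv k C s M (root j))
    ?_ (fun γ => ?_) fun l => ?_
  · rw [map_serre, hD.mul, hE.mul, key, e1, e2]
  · rw [← evalK_apply, map_serre, evalK_apply, evalK_apply, hE.apply_K, serre_zero_right]
  -- The span of X_l and its two group-likes is a subcoalgebra, giving a representation of the
  -- convolution algebra by 2×2 matrices. D and E become strictly upper triangular, so all their
  -- products vanish.
  · have h1 := map_serre (evalX k C s M l) v m D E
    rw [evalX_apply l D, evalX_apply l E, hD.apply_K, hD.apply_K, hE.apply_K, hE.apply_K,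
      serre_eq_zero_of_mul_eq_zero _ hmp
        (strictUpper_mul_strictUpper (D (X k C s M l)) (E (X k C s M l)))
        (strictUpper_mul_strictUpper _ _), evalX_apply] at h1
    exact congrFun (congrFun h1 0) 1

end Commutation

end QBorel

/-! ### The standard pairing: uniqueness, antipodes, existence. -/

namespace QBorel

open WithConv Borel

section

variable {ι : Type*} [Fintype ι] [DecidableEq ι] {C : CartanDatum ι} {M : AddSubgroup (ι → ℚ)}

instance stdDataPlus [h : Fact (rootLattice ι ≤ M)] : StdData C 1 M where
  a := fun _ => 0
  b := fun i => ⟨root i, CartanDatum.root_mem h.out i⟩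
  compat := by
    intro i j
    simp [C.form_zero_left]
  sub_eq := by simp

instance stdDataMinus [h : Fact (rootLattice ι ≤ M)] : StdData C (-1) M where
  a := fun i => -⟨root i, CartanDatum.root_mem h.out i⟩
  b := fun _ => 0
  compat := by
    intro i j
    simp [C.form_zero_left, C.form_neg_left, C.form_root_symm j i]
  sub_eq := by simp

end

variable {k : Type*} [Field k] {ι : Type*} [Fintype ι] [DecidableEq ι] {C : CartanDatum ι}
  {P N : AddSubgroup (ι → ℚ)} [hP : Fact (rootLattice ι ≤ P)] [hN : Fact (rootLattice ι ≤ N)]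

theorem mul'_map_comm_map {R V : Type*} [CommRing R] [AddCommGroup V] [Module R V]
    (f g : V →ₗ[R] R) (S : V →ₗ[R] V) (u : V ⊗[R] V) :
    LinearMap.mul' R R (TensorProduct.map f g (TensorProduct.comm R V V
      (TensorProduct.map S S u))) =
    LinearMap.mul' R R (TensorProduct.map (g ∘ₗ S) (f ∘ₗ S) u) := by
  induction u with
  | zero => simp
  | tmul a b => simp [mul_comm]
  | add u v hu hv => simp only [map_add, hu, hv]

/-- The conditions on the standard pairing that do not involve the antipodes. -/
structure IsDualPairing (η : BPlus k C P →ₗ[Kq k] BMinus k C N →ₗ[Kq k] Kq k) : Prop where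
  comul_mul : ComulDualMul (stdOps k C 1 P) (stdOps k C (-1) N) η
  mul_comul : MulDualComul (stdOps k C 1 P) (stdOps k C (-1) N) η
  one_right : ∀ h, η h 1 = counit k C 1 P h
  one_left : ∀ h, η 1 h = counit k C (-1) N h
  K_K : ∀ (γ : P) (δ : N), η (Borel.K k C 1 P γ) (Borel.K k C (-1) N δ) =
    qpow k (-C.form γ δ)
  E_F : ∀ i j, η (Borel.X k C 1 P i) (Borel.X k C (-1) N j) =
    if i = j then (qpow k (-C.d i) - qpow k (C.d i))⁻¹ else 0
  E_K : ∀ (i : ι) (δ : N), η (Borel.X k C 1 P i) (Borel.K k C (-1) N δ) = 0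
  K_F : ∀ (γ : P) (j : ι), η (Borel.K k C 1 P γ) (Borel.X k C (-1) N j) = 0

theorem qpow_neg_sub_ne_zero (C : CartanDatum ι) (i : ι) :
    (qpow k (-C.d i) - qpow k (C.d i))⁻¹ ≠ 0 := by
  have hd : (-C.d i : ℚ) ≠ 0 := neg_ne_zero.2 (by exact_mod_cast (C.d_pos i).ne')
  have h := (generic_qpow k hd).sub_ne 1 one_pos
  rw [pow_one, pow_one, ← qpow_neg, neg_neg] at h
  exact inv_ne_zero h

namespace IsDualPairing

variable {η : BPlus k C P →ₗ[Kq k] BMinus k C N →ₗ[Kq k] Kq k}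

theorem toDual_mul (h : IsDualPairing η) (x y : BPlus k C P) :
    toDual η (x * y) = toDual η y * toDual η x :=
  toDual_mul_of_mulDualComul h.mul_comul rfl rfl x y

theorem toDual_flip_mul (h : IsDualPairing η) (x y : BMinus k C N) :
    toDual η.flip (x * y) = toDual η.flip x * toDual η.flip y :=
  toDual_mul_of_comulDualMul h.comul_mul rfl rfl x y

theorem pullMul_toDual (h : IsDualPairing η) (x : BPlus k C P) :
    pullMul (Kq k) (BMinus k C N) (toDual η x) = tensMap (toDual η) ((stdOps k C 1 P).comul x) :=
  comulDualMul_iff.1 h.comul_mul x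

theorem pullMul_toDual_flip (h : IsDualPairing η) (x : BMinus k C N) :
    pullMul (Kq k) (BPlus k C P) (toDual η.flip x) =
      tensMap (toDual η.flip) (TensorProduct.comm _ _ _ ((stdOps k C (-1) N).comul x)) :=
  mulDualComul_iff.1 h.mul_comul x

theorem toDual_one (h : IsDualPairing η) : toDual η 1 = 1 :=
  WithConv.ext (LinearMap.ext h.one_left)

theorem toDual_K (h : IsDualPairing η) (γ : P) :
    toDual η (K k C 1 P γ) = charConv k C (-1) N γ := by
  refine eq_charConv ?_ ?_ (h.K_K γ) (h.K_F γ)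
  · rw [h.pullMul_toDual]
    exact congrArg (tensMap (toDual η)) (comul_K _ γ)
  · exact (h.one_right _).trans (counit_K γ)

theorem toDual_flip_K (h : IsDualPairing η) (δ : N) :
    toDual η.flip (K k C (-1) N δ) = charConv k C 1 P δ := by
  refine eq_charConv ?_ ?_ (fun γ => (h.K_K γ δ).trans (by rw [C.form_comm]))
    (fun i => h.E_K i δ)
  · rw [h.pullMul_toDual_flip]
    have e : (stdOps k C (-1) N).comul (K k C (-1) N δ) = _ := comul_K _ δ
    rw [e, TensorProduct.comm_tmul, tensMap_tmul]
  · exact (h.one_left _).trans (counit_K δ)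

theorem isSkewDerivation_E (h : IsDualPairing η) (l : ι) :
    IsSkewDerivation (root l) l (toDual η (X k C 1 P l)) where
  mul := by
    have e : (stdOps k C 1 P).comul (X k C 1 P l) = _ := comul_X _ l
    rw [h.pullMul_toDual, e, map_add, tensMap_tmul, tensMap_tmul, h.toDual_K, h.toDual_K]
    congr 2
    exact charConv_zero
  apply_K := h.E_K l
  apply_X_of_ne j hj := (h.E_F l j).trans (if_neg hj.symm)
  apply_X_ne_zero := by
    rw [toDual_apply, h.E_F, if_pos rfl]
    exact qpow_neg_sub_ne_zero C l

theorem isSkewDerivation_F (h : IsDualPairing η) (l : ι) :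
    IsSkewDerivation (-root l) l (toDual η.flip (X k C (-1) N l)) where
  mul := by
    have e : (stdOps k C (-1) N).comul (X k C (-1) N l) = _ := comul_X _ l
    rw [h.pullMul_toDual_flip, e, map_add, TensorProduct.comm_tmul, TensorProduct.comm_tmul,
      map_add, tensMap_tmul, tensMap_tmul, h.toDual_flip_K, h.toDual_flip_K, add_comm]
    congr 2
    exact charConv_zero
  apply_K γ := h.K_F γ l
  apply_X_of_ne j hj := (h.E_F j l).trans (if_neg hj)
  apply_X_ne_zero := by
    rw [toDual_apply, LinearMap.flip_apply, h.E_F, if_pos rfl]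
    exact qpow_neg_sub_ne_zero C l

/-- The functionals η(E_i, ·) and η'(E_i, ·) are skew primitive for the same character and agree on
generators, so their difference is zero; products propagate the equality. -/
theorem eq (h : IsDualPairing η) {η' : BPlus k C P →ₗ[Kq k] BMinus k C N →ₗ[Kq k] Kq k}
    (h' : IsDualPairing η') : η = η' := by
  have key : ∀ x, toDual η x = toDual η' x := by
    intro x
    induction x using induction_on with
    | hc c =>
      rw [Algebra.algebraMap_eq_smul_one, map_smul, map_smul, h.toDual_one, h'.toDual_one]
    | hK γ => rw [h.toDual_K, h'.toDual_K]
    | hX i =>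
      have hD := h.isSkewDerivation_E i
      have hD' := h'.isSkewDerivation_E i
      rw [← sub_eq_zero]
      refine eq_zero_of_pullMul (φ := charConv k C (-1) N (root i)) ?_ (fun γ => ?_) fun j => ?_
      · have e1 : ∀ f f' g : WithConv (BMinus k C N →ₗ[Kq k] Kq k),
            tens (f - f') g = tens f g - tens f' g := fun f f' g =>
          eq_sub_of_add_eq (by rw [← tens_add_left, sub_add_cancel])
        have e2 : ∀ f g g' : WithConv (BMinus k C N →ₗ[Kq k] Kq k),
            tens f (g - g') = tens f g - tens f g' := fun f g g' =>
          eq_sub_of_add_eq (by rw [← tens_add_right, sub_add_cancel])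
        rw [map_sub, hD.mul, hD'.mul, e1, e2]
        abel
      · rw [ofConv_sub, LinearMap.sub_apply, hD.apply_K, hD'.apply_K, sub_zero]
      · rw [ofConv_sub, LinearMap.sub_apply, toDual_apply, toDual_apply, h.E_F, h'.E_F, sub_self]
    | hmul x y hx hy => rw [h.toDual_mul, h'.toDual_mul, hx, hy]
    | hadd x y hx hy => rw [map_add, map_add, hx, hy]
  exact LinearMap.ext fun x => congrArg ofConv (key x)

/-- In each duality S reverses a product on one side and a coproduct on the other, and the two
reversals cancel. By uniqueness this forces η ∘ (S × S) = η. -/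
theorem comp_antipode (h : IsDualPairing η) :
    IsDualPairing (η.compl₁₂ (stdOps k C 1 P).antipode (stdOps k C (-1) N).antipode) where
  comul_mul x y z := by
    have e : (stdOps k C (-1) N).antipode ((stdOps k C (-1) N).mul (y ⊗ₜ z)) =
        (stdOps k C (-1) N).mul ((stdOps k C (-1) N).antipode z ⊗ₜ
          (stdOps k C (-1) N).antipode y) := antipode_mul _ y z
    have e' : (stdOps k C 1 P).comul ((stdOps k C 1 P).antipode x) = TensorProduct.comm _ _ _
        (TensorProduct.map (stdOps k C 1 P).antipode (stdOps k C 1 P).antipode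
          ((stdOps k C 1 P).comul x)) := comul_antipode _ x
    rw [LinearMap.compl₁₂_apply, e, h.comul_mul, e', mul'_map_comm_map]
    rfl
  mul_comul x y z := by
    have e : (stdOps k C 1 P).antipode ((stdOps k C 1 P).mul (x ⊗ₜ y)) =
        (stdOps k C 1 P).mul ((stdOps k C 1 P).antipode y ⊗ₜ
          (stdOps k C 1 P).antipode x) := antipode_mul _ x y
    have e' : (stdOps k C (-1) N).comul ((stdOps k C (-1) N).antipode z) =
        TensorProduct.comm _ _ _ (TensorProduct.map (stdOps k C (-1) N).antipode
          (stdOps k C (-1) N).antipode ((stdOps k C (-1) N).comul z)) := comul_antipode _ z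
    rw [LinearMap.compl₁₂_apply, e, h.mul_comul, e', mul'_map_comm_map]
    rfl
  one_right x := by
    have e : (stdOps k C (-1) N).antipode 1 = 1 := antipode_one _
    rw [LinearMap.compl₁₂_apply, e, h.one_right]
    exact counit_antipode _ x
  one_left x := by
    have e : (stdOps k C 1 P).antipode 1 = 1 := antipode_one _
    rw [LinearMap.compl₁₂_apply, e, h.one_left]
    exact counit_antipode _ x
  K_K γ δ := by
    have e : (stdOps k C 1 P).antipode (K k C 1 P γ) = _ := antipode_K _ γ
    have e' : (stdOps k C (-1) N).antipode (K k C (-1) N δ) = _ := antipode_K _ δ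
    rw [LinearMap.compl₁₂_apply, e, e', h.K_K, AddSubgroup.coe_neg, AddSubgroup.coe_neg,
      C.form_neg_left, C.form_neg_right, neg_neg]
  E_F i j := by
    have e : (stdOps k C 1 P).antipode (X k C 1 P i) = _ := antipode_X _ i
    have e' : (stdOps k C (-1) N).antipode (X k C (-1) N j) = _ := antipode_X _ j
    -- Up to sign this word is S(F_j). Its right degree is 0, so the character coming from S(E_i)
    -- contributes the factor 1, and the two signs cancel.
    let w : List (N ⊕ ι) :=
      [Sum.inl (-StdData.b C (-1) j), Sum.inr j, Sum.inl (-StdData.a C (-1) j)]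
    have hw : word k C (-1) N w = K k C (-1) N (-StdData.b C (-1) j) * X k C (-1) N j *
        K k C (-1) N (-StdData.a C (-1) j) := by
      simp [w, word, gen, mul_assoc]
    have hr : right C (-1) w = 0 := by
      simp only [w, right_cons_inl, right_cons_inr]
      simp [right, StdData.b]
    have hD := h.isSkewDerivation_E i
    have h0 : ((-StdData.a C 1 i : P) : ι → ℚ) = 0 := by simp [StdData.a]
    have h0' : ((-StdData.b C (-1) j : N) : ι → ℚ) = 0 := by simp [StdData.b]
    rw [LinearMap.compl₁₂_apply, e, e', map_neg, map_neg, LinearMap.neg_apply, neg_neg, ← hw,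
      ← toDual_apply, h.toDual_mul, h.toDual_mul, h.toDual_K, h.toDual_K, charConv_mul_word,
      mul_charConv_word, hr, h0, C.form_zero_left, AddSubgroup.coe_zero, C.form_zero_right,
      neg_zero, qpow_zero, one_mul, mul_one, hw, hD.apply_mul, hD.apply_K, hD.apply_mul,
      hD.apply_K, zero_mul, zero_add, mul_zero, add_zero, counit_K, mul_one, char_K, h0',
      C.form_zero_right, neg_zero, qpow_zero, one_mul]
    exact h.E_F i j
  E_K i δ := by
    have e : (stdOps k C 1 P).antipode (X k C 1 P i) = _ := antipode_X _ i
    have e' : (stdOps k C (-1) N).antipode (K k C (-1) N δ) = _ := antipode_K _ δ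
    rw [LinearMap.compl₁₂_apply, e, e', ← LinearMap.flip_apply, ← toDual_apply, h.toDual_flip_K,
      charConv_apply]
    simp
  K_F γ j := by
    have e : (stdOps k C 1 P).antipode (K k C 1 P γ) = _ := antipode_K _ γ
    have e' : (stdOps k C (-1) N).antipode (X k C (-1) N j) = _ := antipode_X _ j
    rw [LinearMap.compl₁₂_apply, e, e', ← toDual_apply, h.toDual_K, charConv_apply]
    simp

theorem antipode_antipode (h : IsDualPairing η) (x : BPlus k C P) (y : BMinus k C N) :
    η ((stdOps k C 1 P).antipode x) ((stdOps k C (-1) N).antipode y) = η x y :=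
  LinearMap.congr_fun₂ (h.comp_antipode.eq h) x y

theorem isStandardPairing (h : IsDualPairing η) : IsStandardPairing k hP.out hN.out η where
  pairing :=
    { comul_mul := h.comul_mul
      mul_comul := h.mul_comul
      one_right := h.one_right
      one_left := h.one_left
      bijective_left := antipode_bijective _
      bijective_right := antipode_bijective _
      antipode := fun x y y' hy => by
        rw [← hy]
        exact h.antipode_antipode x y'
      antipode_inv := fun x x' y hx => by
        rw [← hx]
        exact (h.antipode_antipode x' y).symm }
  K_K := h.K_K
  E_F := h.E_F
  E_K := h.E_K
  K_F := h.K_F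

end IsDualPairing

theorem IsStandardPairing.isDualPairing
    {η : BPlus k C P →ₗ[Kq k] BMinus k C N →ₗ[Kq k] Kq k}
    (h : IsStandardPairing k hP.out hN.out η) : IsDualPairing η where
  comul_mul := h.pairing.comul_mul
  mul_comul := h.pairing.mul_comul
  one_right := h.pairing.one_right
  one_left := h.pairing.one_left
  K_K := h.K_K
  E_F := h.E_F
  E_K := h.E_K
  K_F := h.K_F

theorem isSkewDerivation_skewDer_minus (i : ι) : IsSkewDerivation (root i) i
    (skewDer k C (-1) N i (qpow k (-C.d i) - qpow k (C.d i))⁻¹) := by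
  simpa using isSkewDerivation_skewDer (s := -1) (M := N) i (qpow_neg_sub_ne_zero (k := k) C i)

variable (k C P N) in
/-- The representation of `U_q(𝔟₊)` by functionals on `U_q(𝔟₋)`. -/
def dualHom : BPlus k C P →ₐ[Kq k] (WithConv (BMinus k C N →ₗ[Kq k] Kq k))ᵐᵒᵖ :=
  lift (fun γ => MulOpposite.op (charConv k C (-1) N γ))
    (fun i => MulOpposite.op (skewDer k C (-1) N i (qpow k (-C.d i) - qpow k (C.d i))⁻¹))
    (by rw [AddSubgroup.coe_zero, charConv_zero, MulOpposite.op_one])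
    (fun γ δ => by rw [← MulOpposite.op_mul, ← charConv_add, AddSubgroup.coe_add, add_comm])
    (fun γ j => by
      rw [← MulOpposite.op_mul, ← MulOpposite.op_mul, ← MulOpposite.op_smul,
        (isSkewDerivation_skewDer_minus j).charConv_mul, smul_smul, ← qpow_add]
      simp [qpow_zero])
    (fun i j hij => by
      rw [serre_op, serre_skewDerivation hij (isSkewDerivation_skewDer_minus i)
        (isSkewDerivation_skewDer_minus j), mul_zero, MulOpposite.op_zero])

theorem dualHom_K (γ : P) :
    dualHom k C P N (K k C 1 P γ) = MulOpposite.op (charConv k C (-1) N γ) := lift_K _ _ _ _ _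

theorem dualHom_X (i : ι) : dualHom k C P N (X k C 1 P i) =
    MulOpposite.op (skewDer k C (-1) N i (qpow k (-C.d i) - qpow k (C.d i))⁻¹) :=
  lift_X _ _ _ _ _

variable (k C P N) in
/-- The standard pairing. -/
def stdPairing : BPlus k C P →ₗ[Kq k] BMinus k C N →ₗ[Kq k] Kq k :=
  (WithConv.linearEquiv (Kq k) (BMinus k C N →ₗ[Kq k] Kq k)).toLinearMap ∘ₗ
    (MulOpposite.opLinearEquiv (Kq k)).symm.toLinearMap ∘ₗ (dualHom k C P N).toLinearMap

theorem toDual_stdPairing (x : BPlus k C P) :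
    toDual (stdPairing k C P N) x = MulOpposite.unop (dualHom k C P N x) := rfl

theorem isDualPairing_stdPairing : IsDualPairing (stdPairing k C P N) := by
  have hmul : ∀ x y, toDual (stdPairing k C P N) (x * y) =
      toDual (stdPairing k C P N) y * toDual (stdPairing k C P N) x := fun x y => by
    rw [toDual_stdPairing, map_mul, MulOpposite.unop_mul]
    rfl
  have h1 : toDual (stdPairing k C P N) 1 = 1 := by
    rw [toDual_stdPairing, map_one, MulOpposite.unop_one]
  have hK : ∀ γ, toDual (stdPairing k C P N) (K k C 1 P γ) = charConv k C (-1) N γ :=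
    fun γ => by rw [toDual_stdPairing, dualHom_K, MulOpposite.unop_op]
  have hX : ∀ i, toDual (stdPairing k C P N) (X k C 1 P i) =
      skewDer k C (-1) N i (qpow k (-C.d i) - qpow k (C.d i))⁻¹ :=
    fun γ => by rw [toDual_stdPairing, dualHom_X, MulOpposite.unop_op]
  have hD : ∀ i, IsSkewDerivation (root i) i (toDual (stdPairing k C P N) (X k C 1 P i)) :=
    fun i => by
      rw [hX]
      exact isSkewDerivation_skewDer_minus i
  refine ⟨?_, ?_, ?_, ?_, ?_, ?_, ?_, ?_⟩
  · rw [comulDualMul_iff]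
    -- With u = 1 the generator criterion is the duality of the undeformed structures.
    have key := (mul_pullMul_eq_iff h1 (Or.inr hmul)
      (comul k 1 (StdData.a C 1) (StdData.b C 1) StdData.compat) 1).2
      ⟨fun γ => by rw [one_mul, mul_one, comul_K, tensMap_tmul, hK, pullMul_charConv],
        fun l => by
          rw [one_mul, mul_one, comul_X, map_add, tensMap_tmul, tensMap_tmul, hK, hK, (hD l).mul]
          congr 2
          exact charConv_zero.symm⟩
    intro x
    have := key x
    rw [one_mul, mul_one] at this
    exact this
  · intro x y z
    exact congrArg (fun φ => φ z) (hmul x y)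
  · intro x
    -- Writing 1 as the group-like K_0 makes evaluation at 1 multiplicative for convolution, so the
    -- induction passes through products.
    rw [← K_zero k C (-1) N, ← toDual_apply]
    induction x using induction_on with
    | hc c =>
      rw [AlgHom.commutes, Algebra.algebraMap_eq_smul_one, map_smul, h1, ofConv_smul,
        LinearMap.smul_apply, ← evalK_apply, map_one, Algebra.algebraMap_eq_smul_one]
    | hK γ =>
      rw [hK, charConv_apply, char_K, AddSubgroup.coe_zero, C.form_zero_right, neg_zero,
        qpow_zero, counit_K]
    | hX i => rw [(hD i).apply_K, counit_X]
    | hmul x y hx hy => rw [hmul, convMul_K, hx, hy, map_mul, mul_comm]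
    | hadd x y hx hy => rw [map_add, map_add, ofConv_add, LinearMap.add_apply, hx, hy]
  · exact fun x => congrArg (fun φ => φ x) h1
  · intro γ δ
    exact (congrArg (fun φ => φ (K k C (-1) N δ)) (hK γ)).trans (char_K _ _ _ _ _ _)
  · intro i j
    refine (congrArg (fun φ => φ (X k C (-1) N j)) (hX i)).trans ?_
    simp only [skewDer_X, eq_comm]
  · exact fun i δ => (hD i).apply_K δ
  · intro γ j
    exact (congrArg (fun φ => φ (X k C (-1) N j)) (hK γ)).trans (char_X _ _ _ _ _ _)

end QBorel

/-! ### Twist on one side, cocycle on the other. -/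

namespace QBorel

open WithConv Borel

variable {k : Type*} [Field k] {ι : Type*} [Fintype ι] [DecidableEq ι] {C : CartanDatum ι}
  {P N : AddSubgroup (ι → ℚ)} [hP : Fact (rootLattice ι ≤ P)] [hN : Fact (rootLattice ι ≤ N)]
  {Ψ : Matrix ι ι ℚ}

/-- As ζ⁺ = -ζ⁻, the twist shifts (a, b) by (ζ⁻, -ζ⁻), and (ζ⁻_i, α_i) is a diagonal value of the
antisymmetric form AᵀΨA, hence zero. -/
theorem antipode_twistPlus (hΨ : Ψ.transpose = -Ψ) (h : C.TwistAdmissible Ψ P) :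
    (twistPlus k h).antipode = (stdOps k C 1 P).antipode := by
  refine antipode_congr _ _ (fun i => ⟨C.psiMinus Ψ (root i), h.psiMinus_mem i⟩) (fun i => ?_)
    (fun i => ?_) fun i => ?_
  · exact (zero_add _).symm
  · apply Subtype.ext
    change root i + C.psiPlus Ψ (root i) = root i - C.psiMinus Ψ (root i)
    rw [C.psiPlus_eq_neg hΨ, sub_eq_add_neg]
  · rw [C.form_psiMinus_root, C.twistForm_self hΨ]

theorem antipode_twistMinus (hΨ : Ψ.transpose = -Ψ) (h : C.TwistAdmissible Ψ N) :
    (twistMinus k h).antipode = (stdOps k C (-1) N).antipode := by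
  refine antipode_congr _ _ (fun i => -⟨C.psiMinus Ψ (root i), h.psiMinus_mem i⟩) (fun i => ?_)
    (fun i => ?_) fun i => ?_
  · exact neg_add _ _
  · apply Subtype.ext
    change -C.psiPlus Ψ (root i) = 0 - -C.psiMinus Ψ (root i)
    rw [C.psiPlus_eq_neg hΨ, zero_sub]
  · rw [AddSubgroup.coe_neg, C.form_neg_left, C.form_psiMinus_root, C.twistForm_self hΨ, neg_zero]

variable {η : BPlus k C P →ₗ[Kq k] BMinus k C N →ₗ[Kq k] Kq k}

theorem comulDualMul_twistPlus_iff (hη : IsDualPairing η) (hΨ : Ψ.transpose = -Ψ)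
    (h : C.TwistAdmissible Ψ P) {σ : TwoCocycle (stdOps k C (-1) N)}
    (hd : C.A.det ≠ 0 ∨ σ.IsToral) :
    ComulDualMul (twistPlus k h) ((stdOps k C (-1) N).deform σ) η ↔ σ.Corresponds Ψ := by
  rw [comulDualMul_iff]
  refine dual_deform_iff_corresponds hΨ hd (Or.inr hη.toDual_mul) hP.out hη.toDual_K
    hη.isSkewDerivation_E _ (comul_K _) (comul_X _) (fun l => rfl) fun l => ?_
  change root l + C.psiPlus Ψ (root l) = _
  rw [C.psiPlus_eq_neg hΨ, sub_eq_add_neg]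

/-- In the opposite of Δ^Ψ(F_l) the group-likes are K_{-ζ⁺} = K_{ζ⁻} on the right and K_{-α - ζ⁻} on
the left. With μ = -α_l these have the same shape as on the positive side. -/
theorem mulDualComul_twistMinus_iff (hη : IsDualPairing η) (hΨ : Ψ.transpose = -Ψ)
    (h : C.TwistAdmissible Ψ N) {σ : TwoCocycle (stdOps k C 1 P)}
    (hd : C.A.det ≠ 0 ∨ σ.IsToral) :
    MulDualComul ((stdOps k C 1 P).deform σ) (twistMinus k h) η ↔ σ.Corresponds Ψ := by
  rw [mulDualComul_iff]
  refine dual_deform_iff_corresponds hΨ hd (Or.inl hη.toDual_flip_mul) hN.out hη.toDual_flip_K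
    hη.isSkewDerivation_F
    ((Algebra.TensorProduct.comm (Kq k) (BMinus k C N) (BMinus k C N)).toAlgHom.comp
      (comul k (-1) _ _ _)) (fun γ => ?_)
    (a := fun i => -⟨C.psiPlus Ψ (root i), h.psiPlus_mem i⟩)
    (b := fun i => -(⟨root i, CartanDatum.root_mem h.rootLattice_le i⟩ +
      ⟨C.psiMinus Ψ (root i), h.psiMinus_mem i⟩)) (fun l => ?_) (fun l => ?_) fun l => ?_
  · simp
  · simp [add_comm]
  · change -C.psiPlus Ψ (root l) = _
    rw [C.psiPlus_eq_neg hΨ, neg_neg]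
  · change -(root l + C.psiMinus Ψ (root l)) = _
    rw [neg_add, sub_eq_add_neg]

theorem IsSkewHopfPairing.congr {R : Type*} [CommRing R] {H L : Type*} [AddCommGroup H]
    [Module R H] [AddCommGroup L] [Module R L] {O₁ O₁' : HopfOps R H} {O₂ O₂' : HopfOps R L}
    {η : H →ₗ[R] L →ₗ[R] R} (h : IsSkewHopfPairing O₁ O₂ η) (hone₁ : O₁'.one = O₁.one)
    (hcounit₁ : O₁'.counit = O₁.counit) (hS₁ : O₁'.antipode = O₁.antipode)
    (hone₂ : O₂'.one = O₂.one) (hcounit₂ : O₂'.counit = O₂.counit)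
    (hS₂ : O₂'.antipode = O₂.antipode) (h₁ : ComulDualMul O₁' O₂' η)
    (h₂ : MulDualComul O₁' O₂' η) : IsSkewHopfPairing O₁' O₂' η where
  comul_mul := h₁
  mul_comul := h₂
  one_right := by rw [hone₂, hcounit₁]; exact h.one_right
  one_left := by rw [hone₁, hcounit₂]; exact h.one_left
  bijective_left := by rw [hS₁]; exact h.bijective_left
  bijective_right := by rw [hS₂]; exact h.bijective_right
  antipode := by rw [hS₁, hS₂]; exact h.antipode
  antipode_inv := by rw [hS₁, hS₂]; exact h.antipode_inv

theorem ComulDualMul.congr {R : Type*} [CommRing R] {H L : Type*} [AddCommGroup H]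
    [Module R H] [AddCommGroup L] [Module R L] {O₁ O₁' : HopfOps R H} {O₂ O₂' : HopfOps R L}
    {η : H →ₗ[R] L →ₗ[R] R} (h : ComulDualMul O₁ O₂ η) (h₁ : O₁'.comul = O₁.comul)
    (h₂ : O₂'.mul = O₂.mul) : ComulDualMul O₁' O₂' η := by
  rw [ComulDualMul, h₁, h₂]
  exact h

theorem MulDualComul.congr {R : Type*} [CommRing R] {H L : Type*} [AddCommGroup H]
    [Module R H] [AddCommGroup L] [Module R L] {O₁ O₁' : HopfOps R H} {O₂ O₂' : HopfOps R L}
    {η : H →ₗ[R] L →ₗ[R] R} (h : MulDualComul O₁ O₂ η) (h₁ : O₁'.mul = O₁.mul)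
    (h₂ : O₂'.comul = O₂.comul) : MulDualComul O₁' O₂' η := by
  rw [MulDualComul, h₁, h₂]
  exact h

theorem isSkewHopfPairing_stdOps (hη : IsStandardPairing k hP.out hN.out η) :
    IsSkewHopfPairing (stdOps k C 1 P) (stdOps k C (-1) N) η := hη.pairing

/-- Only the duality between the twisted coproduct and the deformed product is new. The other
product and coproduct, the units and the counits are untouched, and both antipodes stay the same. -/
theorem isSkewHopfPairing_twistPlus (hη : IsStandardPairing k hP.out hN.out η)
    (hΨ : Ψ.transpose = -Ψ) (h : C.TwistAdmissible Ψ P) {σ : TwoCocycle (stdOps k C (-1) N)}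
    (hσ : σ.Corresponds Ψ) :
    IsSkewHopfPairing (twistPlus k h) ((stdOps k C (-1) N).deform σ) η := by
  have hp := isSkewHopfPairing_stdOps hη
  have hm : (twistPlus k h).mul = (stdOps k C 1 P).mul :=
    (rfl : _ = LinearMap.mul' (Kq k) (BPlus k C P)).trans rfl
  have h1 : (twistPlus k h).one = (stdOps k C 1 P).one := (rfl : _ = (1 : BPlus k C P)).trans rfl
  have hc : (twistPlus k h).counit = (stdOps k C 1 P).counit :=
    (rfl : _ = (counit k C 1 P).toLinearMap).trans rfl
  exact hp.congr h1 hc (antipode_twistPlus hΨ h) rfl rfl (deform_antipode_eq hΨ hσ)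
    ((comulDualMul_twistPlus_iff hη.isDualPairing hΨ h (Or.inr hσ.1)).2 hσ)
    (hp.mul_comul.congr hm rfl)

theorem isSkewHopfPairing_twistMinus (hη : IsStandardPairing k hP.out hN.out η)
    (hΨ : Ψ.transpose = -Ψ) (h : C.TwistAdmissible Ψ N) {σ : TwoCocycle (stdOps k C 1 P)}
    (hσ : σ.Corresponds Ψ) :
    IsSkewHopfPairing ((stdOps k C 1 P).deform σ) (twistMinus k h) η := by
  have hp := isSkewHopfPairing_stdOps hη
  have hm : (twistMinus k h).mul = (stdOps k C (-1) N).mul :=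
    (rfl : _ = LinearMap.mul' (Kq k) (BMinus k C N)).trans rfl
  have h1 : (twistMinus k h).one = (stdOps k C (-1) N).one := (rfl : _ = (1 : BMinus k C N)).trans rfl
  have hc : (twistMinus k h).counit = (stdOps k C (-1) N).counit :=
    (rfl : _ = (counit k C (-1) N).toLinearMap).trans rfl
  exact hp.congr rfl rfl (deform_antipode_eq hΨ hσ) h1 hc (antipode_twistMinus hΨ h)
    (hp.comul_mul.congr rfl hm)
    ((mulDualComul_twistMinus_iff hη.isDualPairing hΨ h (Or.inr hσ.1)).2 hσ)

end QBorel

end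

open QBorel in
theorem mainTheorem4 {k : Type*} [Field k] [CharZero k] {ι : Type*} [Fintype ι] [DecidableEq ι]
    (C : CartanDatum ι) (Ψ : Matrix ι ι ℚ) (hΨ : Ψ.transpose = -Ψ) :
    -- the enlarged lattices `Γ'_±` are admissible
    (∀ Γp Γn : AddSubgroup (ι → ℚ), IsLattice Γp → IsLattice Γn →
      (IsLattice (C.enlarge Ψ Γp Γn) ∧ C.TwistAdmissible Ψ (C.enlarge Ψ Γp Γn)) ∧
      (IsLattice (C.enlarge Ψ Γn Γp) ∧ C.TwistAdmissible Ψ (C.enlarge Ψ Γn Γp))) ∧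
    ∀ (P N : AddSubgroup (ι → ℚ)) (hP : IsLattice P) (hN : IsLattice N),
      -- the standard pairing exists and is unique
      (∃! η : BPlus k C P →ₗ[Kq k] BMinus k C N →ₗ[Kq k] Kq k,
        IsStandardPairing k hP.2 hN.2 η) ∧
      ∀ η : BPlus k C P →ₗ[Kq k] BMinus k C N →ₗ[Kq k] Kq k, IsStandardPairing k hP.2 hN.2 η →
        -- twist on the positive side, cocycle on the negative side
        (∀ (hΨP : C.TwistAdmissible Ψ P) (σ : TwoCocycle (stdMinus k C hN.2)),
          (C.A.det ≠ 0 ∨ σ.IsToral →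
            (IsSkewHopfPairing (twistPlus k hΨP) ((stdMinus k C hN.2).deform σ) η ↔
              σ.Corresponds Ψ) ∧
            (ComulDualMul (twistPlus k hΨP) ((stdMinus k C hN.2).deform σ) η ↔
              σ.Corresponds Ψ)) ∧
          (σ.IsRationalToral →
            (σ.Corresponds Ψ ↔ ∀ i j : ι,
              σ.onTorus ⟨root i, CartanDatum.root_mem hN.2 i⟩
                ⟨root j, CartanDatum.root_mem hN.2 j⟩ =
                qpow k (-(C.AQ.transpose * Ψ * C.AQ) i j)))) ∧
        -- cocycle on the positive side, twist on the negative side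
        (∀ (hΨN : C.TwistAdmissible Ψ N) (σ : TwoCocycle (stdPlus k C hP.2)),
          (C.A.det ≠ 0 ∨ σ.IsToral →
            (IsSkewHopfPairing ((stdPlus k C hP.2).deform σ) (twistMinus k hΨN) η ↔
              σ.Corresponds Ψ) ∧
            (MulDualComul ((stdPlus k C hP.2).deform σ) (twistMinus k hΨN) η ↔
              σ.Corresponds Ψ)) ∧
          (σ.IsRationalToral →
            (σ.Corresponds Ψ ↔ ∀ i j : ι,
              σ.onTorus ⟨root i, CartanDatum.root_mem hP.2 i⟩
                ⟨root j, CartanDatum.root_mem hP.2 j⟩ =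
                qpow k (-(C.AQ.transpose * Ψ * C.AQ) i j)))) := by
  refine ⟨fun Γp Γn hp hn => ⟨⟨isLattice_enlarge C Ψ hp hn, twistAdmissible_enlarge C Ψ hp.2 hn.2⟩,
    isLattice_enlarge C Ψ hn hp, twistAdmissible_enlarge C Ψ hn.2 hp.2⟩, fun P N hP hN => ?_⟩
  have : Fact (rootLattice ι ≤ P) := ⟨hP.2⟩
  have : Fact (rootLattice ι ≤ N) := ⟨hN.2⟩
  refine ⟨⟨stdPairing k C P N, isDualPairing_stdPairing.isStandardPairing, fun η hη =>
    hη.isDualPairing.eq isDualPairing_stdPairing⟩, fun η hη => ⟨fun h σ => ⟨fun hd => ?_, fun hr =>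
      corresponds_iff_of_isRationalToral (σ := σ) hr hN.2⟩, fun h σ => ⟨fun hd => ?_, fun hr =>
      corresponds_iff_of_isRationalToral (σ := σ) hr hP.2⟩⟩⟩
  -- A skew-Hopf pairing contains this duality, which gives Ψ ↔ σ, and Ψ ↔ σ gives back the whole
  -- pairing.
  · have key := comulDualMul_twistPlus_iff hη.isDualPairing hΨ h (σ := σ) hd
    exact ⟨⟨fun H => key.1 H.comul_mul, isSkewHopfPairing_twistPlus hη hΨ h (σ := σ)⟩, key⟩
  · have key := mulDualComul_twistMinus_iff hη.isDualPairing hΨ h (σ := σ) hd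
    exact ⟨⟨fun H => key.1 H.mul_comul, isSkewHopfPairing_twistMinus hη hΨ h (σ := σ)⟩, key⟩
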